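/- Let $0<b<1$ and let $a>0$ be determined by $\tanh(2a)=3b/(2+b^2)$. Let $V(\phi)=2\phi^2(\phi-\tanh a)(\phi-\coth a)$. For collective coordinates $A(t),B(t),C(t)>0$ put $$\phi(x,t)=\tfrac12A(t)\bigl(\tanh(B(t)x+C(t))-\tanh(B(t)x-C(t))\bigr),$$ and let $S[A,B,C]=\int\int_{\mathbb R}\bigl(-\tfrac12\phi_t^2+\tfrac12\phi_x^2+V(\phi)\bigr)\,dx\,dt$ be the effective action obtained by integrating the Klein–Gordon action density of this ansatz over $x$. Then for all real parameters $B_0$ and $T$ the Euler–Lagrange equations $\delta S/\delta A=\delta S/\delta B=\delta S/\delta C=0$ have a lump solution $$\phi(x,t)=\tfrac12A\bigl(\tanh(B(x+X))-\tanh(B(x-X))\bigr),\qquad C=BX,$$ in the sense of formal asymptotic series in $1/(t+T)$ as $t\to\infty$, whose coefficients depend only on $b$ and $B_0$: $$X= (t+T)+\frac{b^2}{8(1-b^2)^2}\Bigl((t+T)^{-1}-\frac{b^2B_0}{2(1-b^2)}(t+T)^{-2}+\Bigl(\frac{b^4B_0^2}{4(1-b^2)^2}+\frac{\pi^2b^2}{12}+\frac{b^2(12b^6-44b^4+53b^2-22)}{16(2-b^2)(1-b^2)^2}\Bigr)(t+T)^{-3}+\cdots\Bigr),$$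 $$B=\frac{2(1-b^2)}{b^2}(t+T)+B_0+\frac{b^2}{4(1-b^2)}\Bigl(\frac{3-2b^2}{2-b^2}(t+T)^{-1}-\frac{B_0}{2(1-b^2)}(t+T)^{-2}+\Bigl(\frac{b^2B_0^2}{4(1-b^2)^2}+\frac{\pi^2(22-13b^2)}{36(2-b^2)}+\frac{80b^{10}-686b^8+2213b^6-3368b^4+2450b^2-692}{48(1-b^2)^2(2-b^2)^3}\Bigr)(t+T)^{-3}+\cdots\Bigr),$$ $$A=\frac1b+\frac{b}{8(2-b^2)}\Bigl((t+T)^{-2}-\frac{b^2B_0}{2(1-b^2)}(t+T)^{-3}+\Bigl(\frac{b^4B_0^2}{4(1-b^2)^2}-\frac{\pi^2b^2}{18(1-b^2)}-\frac{b^2(17b^6-91b^4+148b^2-62)}{24(1-b^2)^2(2-b^2)^2}\Bigr)(t+T)^{-4}+\cdots\Bigr).$$ Precisely, the series continue to all orders, and for every $N\ge 0$, if $X$ and $B$ are truncated after the term of order $(t+T)^{-N}$ and $A$ after the term of order $(t+T)^{-(N+1)}$, then the left-hand sides of the three Euler–Lagrange equations are $O(t^{-(N+1)})$ as $t\to\infty$.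 The conserved energy of the solution is $E=\tfrac23B_0/b^2$: for the same truncations, $\int_{\mathbb R}\bigl(\tfrac12\phi_t^2+\tfrac12\phi_x^2+V(\phi)\bigr)dx=\tfrac23B_0/b^2+O(t^{-(N+1)})$ for every $N\ge0$. No convergence of the series is claimed. -/

import Mathlib

open Filter Asymptotics MeasureTheory

noncomputable section

namespace Sphaleron

/-- The quartic potential with a false vacuum at `0`:
`V(φ) = 2 φ² (φ - tanh a) (φ - coth a)`. -/
def potential (a φ : ℝ) : ℝ :=
  2 * φ ^ 2 * (φ - Real.tanh a) * (φ - (Real.tanh a)⁻¹)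

/-- The Klein-Gordon energy at time `t` of a field `φ x t`. -/
def fieldEnergy (a : ℝ) (φ : ℝ → ℝ → ℝ) (t : ℝ) : ℝ :=
  ∫ x : ℝ, (1 / 2 * (deriv (fun s => φ x s) t) ^ 2
    + 1 / 2 * (deriv (fun y => φ y t) x) ^ 2 + potential a (φ x t))

/-- The kink-antikink profile with collective coordinates `A`, `B`, `C`. -/
def profile (A B C x : ℝ) : ℝ :=
  A / 2 * (Real.tanh (B * x + C) - Real.tanh (B * x - C))

/-- The time derivative of the profile when the collective coordinates are at `(A, B, C)` and
move with velocity `(A', B', C')`. -/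
def profileVelocity (A B C A' B' C' x : ℝ) : ℝ :=
  deriv (fun s => profile (A + s * A') (B + s * B') (C + s * C') x) 0

/-- The effective Lagrangian: the Klein-Gordon action density
`-φ_t² / 2 + φ_x² / 2 + V(φ)` of the profile, integrated over space. -/
def effLagrangian (a A B C A' B' C' : ℝ) : ℝ :=
  ∫ x : ℝ, (-(1 / 2) * (profileVelocity A B C A' B' C' x) ^ 2
    + 1 / 2 * (deriv (profile A B C) x) ^ 2 + potential a (profile A B C x))

/-- The variational derivative `δS/δA = ∂L/∂A - d/dt (∂L/∂A')` of the effective action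
`S[A, B, C] = ∫ L(A, B, C, A', B', C') dt` along the curve `(A, B, C)`. -/
def variationA (a : ℝ) (A B C : ℝ → ℝ) (t : ℝ) : ℝ :=
  deriv (fun y => effLagrangian a y (B t) (C t) (deriv A t) (deriv B t) (deriv C t)) (A t)
  - deriv (fun s =>
      deriv (fun y => effLagrangian a (A s) (B s) (C s) y (deriv B s) (deriv C s)) (deriv A s)) t

/-- The variational derivative `δS/δB` of the effective action. -/
def variationB (a : ℝ) (A B C : ℝ → ℝ) (t : ℝ) : ℝ :=
  deriv (fun y => effLagrangian a (A t) y (C t) (deriv A t) (deriv B t) (deriv C t)) (B t)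
  - deriv (fun s =>
      deriv (fun y => effLagrangian a (A s) (B s) (C s) (deriv A s) y (deriv C s)) (deriv B s)) t

/-- The variational derivative `δS/δC` of the effective action. -/
def variationC (a : ℝ) (A B C : ℝ → ℝ) (t : ℝ) : ℝ :=
  deriv (fun y => effLagrangian a (A t) (B t) y (deriv A t) (deriv B t) (deriv C t)) (C t)
  - deriv (fun s =>
      deriv (fun y => effLagrangian a (A s) (B s) (C s) (deriv A s) (deriv B s) y) (deriv C s)) t

/-- The lump with height `A`, flank steepness `B` and flanks located at `±X`. -/
def lump (A B X : ℝ → ℝ) (x t : ℝ) : ℝ :=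
  1 / 2 * A t * (Real.tanh (B t * (x + X t)) - Real.tanh (B t * (x - X t)))

/-- Partial sum of the series `X = (t + T) + ξ₁ (t + T)⁻¹ + ξ₂ (t + T)⁻² + ⋯`. -/
def seriesX (T : ℝ) (ξ : ℕ → ℝ) (N : ℕ) (t : ℝ) : ℝ :=
  (t + T) + ∑ n ∈ Finset.Icc 1 N, ξ n / (t + T) ^ n

/-- Partial sum of the series
`B = (2 (1 - b²) / b²) (t + T) + B₀ + β₁ (t + T)⁻¹ + β₂ (t + T)⁻² + ⋯`. -/
def seriesB (b T B₀ : ℝ) (β : ℕ → ℝ) (N : ℕ) (t : ℝ) : ℝ :=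
  2 * (1 - b ^ 2) / b ^ 2 * (t + T) + B₀ + ∑ n ∈ Finset.Icc 1 N, β n / (t + T) ^ n

/-- Partial sum of the series `A = 1 / b + α₂ (t + T)⁻² + α₃ (t + T)⁻³ + ⋯`. -/
def seriesA (b T : ℝ) (α : ℕ → ℝ) (N : ℕ) (t : ℝ) : ℝ :=
  1 / b + ∑ n ∈ Finset.Icc 2 N, α n / (t + T) ^ n

/-- `(A, B, X)`, given by their partial sums, are a formal (asymptotic) series solution of the
Euler-Lagrange equations of the effective action, with `C = B X`: the partial sums up to order
`N` (and `N + 1` for `A`) satisfy the three equations up to an error `O(t ^ (-(N + 1)))`,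
for every `N`. -/
def IsSeriesSolution (a : ℝ) (A B X : ℕ → ℝ → ℝ) : Prop :=
  ∀ N : ℕ,
    (variationA a (A (N + 1)) (B N) (fun t => B N t * X N t)
      =O[atTop] fun t : ℝ => (t ^ (N + 1))⁻¹) ∧
    (variationB a (A (N + 1)) (B N) (fun t => B N t * X N t)
      =O[atTop] fun t : ℝ => (t ^ (N + 1))⁻¹) ∧
    (variationC a (A (N + 1)) (B N) (fun t => B N t * X N t)
      =O[atTop] fun t : ℝ => (t ^ (N + 1))⁻¹)

end Sphaleron

end

/-! Put `k = coth (2C)` and `T(y) = tanh (y + C) - tanh (y - C)`, so that the field is `(A / 2) T(B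
x)`. The identity `k T = 1 - tanh (y + C) tanh (y - C)` (`cothTwo_mul_bump`) reduces the products of
`T` and its derivatives that occur in the action to functions with known moments, with coefficients
polynomial in `k`. Hence the effective Lagrangian and the energy are explicit: they are polynomial
in `A`, `C`, `k`, the velocities and `π²`, apart from powers of `B` (`effLagrangian_eq`,
`fieldEnergy_eq`).

Along the curve `C = B X ≥ t` eventually, so `k - 1` decays faster than every power of `t`. Setting
`k = 1` therefore does not affect any of the estimates (`approx_coefficients`), and in the variables
`A, B, X` the equations become the rational expressions `limA`, `limB`, `limX`. Their leading
balance is that `A = 1/b` is the true vacuum (`V'(1/b) = 0`), that the flanks move at the speed of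
light (`X' = 1`), and that `B' = 2(1 - b²)/b²`: the flanks get steeper by absorbing the vacuum
energy `-V(1/b)` released per unit length.

With `z = (t + T)⁻¹` the remaining equations are polynomial identities in `z` and the three
correction series. They are autonomous, so `T` drops out, while `B₀` is a parameter. At order `n`
the new unknowns enter linearly and triangularly: `δS/δB` contains only the new coefficient of `X`,
`δS/δA` also that of `A`, and `δS/δX` all three. The pivots are nonzero because `0 < b < 1`. So a
formal solution exists to all orders (`exists_formal_solution`), and orders 0, 1, 2 give the
displayed coefficients (`formal_solution_leading`).

The same expressions are evaluated in several rings. Truncations with `N` terms agree with the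
formal solution modulo `z^N`, so the polynomial equations are divisible by `z^N`; rescaling factors
`z` and `z²` supply the rest of the decay. For the energy, the time derivative is a combination of
the three equations, hence `O(z^(N+2))`, and the limit is `2 B₀ / (3 b²)`; integrating from infinity
gives the error `O(z^(N+1))` (`formal_solution_truncation`). -/

noncomputable section

namespace Sphaleron

/-! ### Moments of `sech²` -/

/-- `f` is integrable over the line with integral `v`. -/
def HasInt (f : ℝ → ℝ) (v : ℝ) : Prop := Integrable f ∧ ∫ x, f x = v

theorem HasInt.add {f g : ℝ → ℝ} {v w : ℝ} (hf : HasInt f v) (hg : HasInt g w) :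
    HasInt (fun x => f x + g x) (v + w) :=
  ⟨hf.1.add hg.1, by rw [integral_add hf.1 hg.1, hf.2, hg.2]⟩

theorem HasInt.const_mul {f : ℝ → ℝ} {v : ℝ} (c : ℝ) (hf : HasInt f v) :
    HasInt (fun x => c * f x) (c * v) :=
  ⟨hf.1.const_mul c, by rw [integral_const_mul, hf.2]⟩

theorem HasInt.sub {f g : ℝ → ℝ} {v w : ℝ} (hf : HasInt f v) (hg : HasInt g w) :
    HasInt (fun x => f x - g x) (v - w) :=
  ⟨hf.1.sub hg.1, by rw [integral_sub hf.1 hg.1, hf.2, hg.2]⟩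

theorem HasInt.congr {f g : ℝ → ℝ} {v w : ℝ} (hf : HasInt f v) (h : ∀ x, g x = f x)
    (hv : w = v) : HasInt g w := by
  rw [funext h, hv]; exact hf

theorem HasInt.comp_add {f : ℝ → ℝ} {v : ℝ} (c : ℝ) (hf : HasInt f v) :
    HasInt (fun x => f (x + c)) v :=
  ⟨hf.1.comp_add_right c, by rw [integral_add_right_eq_self, hf.2]⟩

theorem HasInt.comp_mul {f : ℝ → ℝ} {v : ℝ} {B : ℝ} (hB : 0 < B) (hf : HasInt f v) :
    HasInt (fun x => f (B * x)) (v / B) :=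
  ⟨hf.1.comp_mul_left' hB.ne', by
    rw [Measure.integral_comp_mul_left, hf.2, abs_of_pos (inv_pos.2 hB), smul_eq_mul]; ring⟩

theorem hasInt_zero_of_odd {f : ℝ → ℝ} (hf : Integrable f) (h : ∀ x, f (-x) = -f x) :
    HasInt f 0 := by
  refine ⟨hf, ?_⟩
  have h1 : ∫ x, f (-x) = ∫ x, f x := integral_neg_eq_self f volume
  simp only [h, integral_neg] at h1
  linarith

/-- `sech²`. -/
def sechSq (u : ℝ) : ℝ := 1 - Real.tanh u ^ 2

theorem sechSq_eq (u : ℝ) : sechSq u = 1 / Real.cosh u ^ 2 := by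
  have h := Real.cosh_pos u
  have h2 := Real.cosh_sq u
  rw [sechSq, Real.tanh_eq_sinh_div_cosh]
  field_simp
  linarith

theorem sechSq_pos (u : ℝ) : 0 < sechSq u := by
  rw [sechSq_eq]; have := Real.cosh_pos u; positivity

theorem sechSq_le_one (u : ℝ) : sechSq u ≤ 1 := by
  rw [sechSq]; nlinarith [sq_nonneg (Real.tanh u)]

theorem sechSq_neg (u : ℝ) : sechSq (-u) = sechSq u := by
  rw [sechSq, sechSq, Real.tanh_neg]; ring

theorem hasDerivAt_tanh (u : ℝ) : HasDerivAt Real.tanh (sechSq u) u := by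
  have h := (Real.hasDerivAt_sinh u).div (Real.hasDerivAt_cosh u) (Real.cosh_pos u).ne'
  have e : Real.tanh = fun x => Real.sinh x / Real.cosh x :=
    funext Real.tanh_eq_sinh_div_cosh
  rw [e]
  refine h.congr_deriv ?_
  rw [sechSq_eq, ← Real.cosh_sq_sub_sinh_sq u]
  ring

theorem continuous_tanh : Continuous Real.tanh :=
  continuous_iff_continuousAt.2 fun u => (hasDerivAt_tanh u).continuousAt

theorem continuous_sechSq : Continuous sechSq :=
  continuous_const.sub (continuous_tanh.pow 2)

theorem hasDerivAt_sechSq (u : ℝ) :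
    HasDerivAt sechSq (-2 * (Real.tanh u * sechSq u)) u := by
  have h := ((hasDerivAt_tanh u).pow 2).const_sub 1
  refine h.congr_deriv ?_
  simp only [Nat.cast_ofNat]
  ring

theorem sechSq_le_exp (u : ℝ) : sechSq u ≤ 4 * Real.exp (-(2 * |u|)) := by
  have h1 : Real.exp |u| / 2 ≤ Real.cosh u := by
    rw [← Real.cosh_abs, Real.cosh_eq]
    linarith [Real.exp_pos (-|u|)]
  have h0 : 0 < Real.exp |u| := Real.exp_pos _
  have h2 : Real.exp (-(2 * |u|)) = 1 / Real.exp |u| ^ 2 := by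
    rw [Real.exp_neg, ← Real.exp_nat_mul, one_div]; norm_num
  rw [sechSq_eq, h2, mul_one_div, div_le_div_iff₀ (by have := Real.cosh_pos u; positivity)
    (by positivity)]
  nlinarith

/-- The exponential decay of `sech²` beats any power, because `sech² u * e^|u| ≤ 4` and `|u|ⁿ ≤ n!
e^|u|`. The Cauchy density serves as an integrable majorant. -/
theorem abs_pow_mul_sechSq_le (n : ℕ) (u : ℝ) :
    |u| ^ n * sechSq u ≤ 4 * (n.factorial + (n + 2).factorial) * (1 + u ^ 2)⁻¹ := by
  have h0 := Real.exp_pos |u|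
  have h1 := Real.pow_div_factorial_le_exp |u| (abs_nonneg u) n
  have h2 := Real.pow_div_factorial_le_exp |u| (abs_nonneg u) (n + 2)
  have f1 : (0 : ℝ) < n.factorial := by positivity
  have f2 : (0 : ℝ) < (n + 2).factorial := by positivity
  rw [div_le_iff₀ (by positivity)] at h1 h2
  have h3 : sechSq u * Real.exp |u| ≤ 4 := by
    have h4 := mul_le_mul_of_nonneg_right (sechSq_le_exp u) h0.le
    rw [mul_assoc, ← Real.exp_add] at h4
    have : Real.exp (-(2 * |u|) + |u|) ≤ 1 := Real.exp_le_one_iff.2 (by linarith [abs_nonneg u])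
    linarith
  rw [← div_eq_mul_inv, le_div_iff₀ (by positivity)]
  have hs := sechSq_pos u
  calc |u| ^ n * sechSq u * (1 + u ^ 2) = sechSq u * (|u| ^ n + |u| ^ (n + 2)) := by
        rw [pow_add, sq_abs]; ring
    _ ≤ sechSq u * (Real.exp |u| * n.factorial + Real.exp |u| * (n + 2).factorial) := by gcongr
    _ = sechSq u * Real.exp |u| * (n.factorial + (n + 2).factorial) := by ring
    _ ≤ _ := by gcongr

theorem integrable_pow_mul_sechSq (n : ℕ) : Integrable fun u : ℝ => u ^ n * sechSq u := by
  refine Integrable.mono' (integrable_inv_one_add_sq.const_mul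
    (4 * (n.factorial + (n + 2).factorial : ℝ)))
    (((continuous_id.pow n).mul continuous_sechSq).aestronglyMeasurable) (ae_of_all _ fun u => ?_)
  rw [Real.norm_eq_abs, abs_mul, abs_pow, abs_of_pos (sechSq_pos u)]
  exact abs_pow_mul_sechSq_le n u

/-- A continuous bounded function times `uⁿ sech² u` is integrable. -/
theorem integrable_pow_mul_sechSq_mul (n : ℕ) {f : ℝ → ℝ} (hf : Continuous f)
    (hb : ∀ x, |f x| ≤ 1) : Integrable fun u : ℝ => u ^ n * (f u * sechSq u) := by
  refine (integrable_pow_mul_sechSq n).norm.mono'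
    (((continuous_id.pow n).mul (hf.mul continuous_sechSq)).aestronglyMeasurable)
    (ae_of_all _ fun u => ?_)
  rw [norm_mul, norm_mul, norm_mul]
  have := hb u
  rw [← Real.norm_eq_abs] at this
  have h1 := norm_nonneg (u ^ n)
  have h2 := norm_nonneg (sechSq u)
  nlinarith [mul_nonneg h1 h2]

theorem abs_tanh_le_one (x : ℝ) : |Real.tanh x| ≤ 1 := (Real.abs_tanh_lt_one x).le

theorem abs_sechSq_le_one (x : ℝ) : |sechSq x| ≤ 1 := by
  rw [abs_of_pos (sechSq_pos x)]; exact sechSq_le_one x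

/-- This form gives both the exponential decay of `1 - tanh` and its expansion as a geometric
series. -/
theorem one_sub_tanh_eq (u : ℝ) :
    1 - Real.tanh u = 2 * Real.exp (-(2 * u)) / (1 + Real.exp (-(2 * u))) := by
  have h : Real.exp (-(2 * u)) = Real.exp (-u) * Real.exp (-u) := by
    rw [← Real.exp_add]; ring_nf
  have h3 : Real.exp u * Real.exp (-u) = 1 := by rw [← Real.exp_add]; simp
  have h1 := Real.exp_pos u
  have h2 := Real.exp_pos (-u)
  rw [Real.tanh_eq, h, eq_div_iff (by positivity), sub_mul, div_mul_eq_mul_div,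
    sub_eq_iff_eq_add, ← sub_eq_iff_eq_add', eq_div_iff (by positivity)]
  linear_combination (-2 * Real.exp (-u)) * h3

theorem tendsto_tanh_atTop : Tendsto Real.tanh atTop (nhds 1) := by
  have h : Tendsto (fun u : ℝ => Real.exp (-(2 * u))) atTop (nhds 0) :=
    Real.tendsto_exp_neg_atTop_nhds_zero.comp (tendsto_id.const_mul_atTop (by norm_num : (0:ℝ) < 2))
  have h2 := (h.const_mul 2).div (h.const_add 1) (by norm_num)
  have h3 := h2.const_sub 1
  refine (h3.congr fun u => ?_).trans (by norm_num)
  simp only [Pi.div_apply, ← one_sub_tanh_eq]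
  ring

theorem tendsto_tanh_atBot : Tendsto Real.tanh atBot (nhds (-1)) := by
  have h := (tendsto_tanh_atTop.comp tendsto_neg_atBot_atTop).neg
  refine h.congr fun u => ?_
  simp [Real.tanh_neg]

theorem hasInt_sechSq : HasInt sechSq 2 := by
  have hi : Integrable sechSq := by simpa using integrable_pow_mul_sechSq 0
  refine ⟨hi, ?_⟩
  rw [integral_of_hasDerivAt_of_tendsto hasDerivAt_tanh hi tendsto_tanh_atBot tendsto_tanh_atTop]
  norm_num

theorem hasInt_mul_sechSq : HasInt (fun u => u * sechSq u) 0 :=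
  hasInt_zero_of_odd (by simpa using integrable_pow_mul_sechSq 1)
    fun x => by rw [sechSq_neg]; ring

theorem hasInt_cube_mul_sechSq : HasInt (fun u => u ^ 3 * sechSq u) 0 :=
  hasInt_zero_of_odd (integrable_pow_mul_sechSq 3) fun x => by rw [sechSq_neg]; ring

theorem hasInt_tanh_mul_sechSq : HasInt (fun u => Real.tanh u * sechSq u) 0 :=
  hasInt_zero_of_odd
    (by simpa using integrable_pow_mul_sechSq_mul 0 continuous_tanh abs_tanh_le_one)
    fun x => by rw [sechSq_neg, Real.tanh_neg]; ring

theorem hasInt_mul_tanh_mul_sechSq : HasInt (fun u => u * (Real.tanh u * sechSq u)) 1 := by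
  have hi : Integrable fun u => u * (Real.tanh u * sechSq u) := by
    simpa using integrable_pow_mul_sechSq_mul 1 continuous_tanh abs_tanh_le_one
  have h0 : ∀ x : ℝ, HasDerivAt (fun u => u * sechSq u)
      (sechSq x - 2 * (x * (Real.tanh x * sechSq x))) x := fun x => by
    refine ((hasDerivAt_id x).mul (hasDerivAt_sechSq x)).congr_deriv ?_
    simp only [id]; ring
  have h := integral_eq_zero_of_hasDerivAt_of_integrable h0
    (hasInt_sechSq.1.sub (hi.const_mul 2)) hasInt_mul_sechSq.1
  rw [integral_sub hasInt_sechSq.1 (hi.const_mul 2), integral_const_mul, hasInt_sechSq.2] at h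
  exact ⟨hi, by linarith⟩

theorem hasInt_sechSq_sq : HasInt (fun u => sechSq u ^ 2) (4 / 3) := by
  have hi : Integrable fun u => sechSq u ^ 2 := by
    simpa [sq] using integrable_pow_mul_sechSq_mul 0 continuous_sechSq abs_sechSq_le_one
  have h0 : ∀ x : ℝ, HasDerivAt (fun u => Real.tanh u - Real.tanh u ^ 3 / 3) (sechSq x ^ 2) x :=
    fun x => by
      refine ((hasDerivAt_tanh x).sub (((hasDerivAt_tanh x).pow 3).div_const 3)).congr_deriv ?_
      simp only [Nat.cast_ofNat, sechSq]; ring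
  refine ⟨hi, ?_⟩
  rw [integral_of_hasDerivAt_of_tendsto h0 hi
    (tendsto_tanh_atBot.sub ((tendsto_tanh_atBot.pow 3).div_const 3))
    (tendsto_tanh_atTop.sub ((tendsto_tanh_atTop.pow 3).div_const 3))]
  norm_num

theorem hasInt_mul_sechSq_sq : HasInt (fun u => u * sechSq u ^ 2) 0 :=
  hasInt_zero_of_odd
    (by simpa [sq] using integrable_pow_mul_sechSq_mul 1 continuous_sechSq abs_sechSq_le_one)
    fun x => by rw [sechSq_neg]; ring

/-! ### The second moments, where `π²` enters through `ζ(2)` -/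

/-- `∑ (-1)ⁿ / (n + 1)² = π² / 12`. -/
theorem hasSum_alternating_inv_sq :
    HasSum (fun n : ℕ => (-1 : ℝ) ^ n / ((n : ℝ) + 1) ^ 2) (Real.pi ^ 2 / 12) := by
  have h1 : HasSum (fun n : ℕ => (1 : ℝ) / ((n : ℝ) + 1) ^ 2) (Real.pi ^ 2 / 6) := by
    have := (hasSum_nat_add_iff' 1).2 hasSum_zeta_two
    simpa using this
  have h2 : HasSum (fun n : ℕ => if Even n then (0 : ℝ) else 2 * (1 / ((n : ℝ) + 1) ^ 2))
      (Real.pi ^ 2 / 12) := by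
    have hinj : Function.Injective fun n : ℕ => 2 * n + 1 := fun a b h => by simpa using h
    have h3 : HasSum (fun n : ℕ => 1 / 2 * (1 / ((n : ℝ) + 1) ^ 2)) (Real.pi ^ 2 / 12) := by
      have := h1.mul_left (1 / 2)
      rwa [show 1 / 2 * (Real.pi ^ 2 / 6) = Real.pi ^ 2 / 12 by ring] at this
    rw [← hinj.hasSum_iff]
    · refine h3.congr_fun fun n => ?_
      have : ¬ Even (2 * n + 1) := by simp
      simp only [Function.comp, this, if_false]
      push_cast
      field_simp
      ring
    · intro n hn
      rw [if_pos]
      by_contra h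
      rw [Nat.not_even_iff_odd] at h
      obtain ⟨m, hm⟩ := h
      exact hn ⟨m, hm.symm⟩
  have h4 := h1.sub h2
  have : Real.pi ^ 2 / 12 = Real.pi ^ 2 / 6 - Real.pi ^ 2 / 12 := by ring
  rw [this]
  refine h4.congr_fun fun n => ?_
  split_ifs with h
  · rw [h.neg_one_pow]; ring
  · rw [(Nat.not_even_iff_odd.1 h).neg_one_pow]; ring

/-- Expand `1 - tanh u = 2 ∑ (-1)ⁿ exp (-2(n+1)u)` for `u > 0` and integrate term by term; the
exchange is justified by summability of the integrals of the absolute values. -/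
theorem integral_mul_one_sub_tanh :
    ∫ u in Set.Ioi (0 : ℝ), u * (1 - Real.tanh u) = Real.pi ^ 2 / 24 := by
  have e : ∀ n : ℕ, ∀ u : ℝ, u * Real.exp (-(2 * ((n : ℝ) + 1) * u))
      = u ^ ((2 : ℝ) - 1) * Real.exp (-(2 * ((n : ℝ) + 1) * u)) := fun n u => by norm_num
  have hint : ∀ n : ℕ, ∫ u in Set.Ioi (0 : ℝ), u * Real.exp (-(2 * ((n : ℝ) + 1) * u))
      = 1 / (4 * ((n : ℝ) + 1) ^ 2) := fun n => by
    simp only [e]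
    rw [Real.integral_rpow_mul_exp_neg_mul_Ioi (by norm_num) (by positivity)]
    norm_num [div_pow]
    field_simp
    norm_num
  have hI : ∀ n : ℕ, IntegrableOn (fun u : ℝ => u * Real.exp (-(2 * ((n : ℝ) + 1) * u)))
      (Set.Ioi 0) := fun n => by
    -- The integral of a nonintegrable function is 0 by convention, so a nonzero value proves
    -- integrability.
    by_contra h
    have := hint n
    rw [integral_undef h] at this
    have h2 : (0 : ℝ) < 1 / (4 * ((n : ℝ) + 1) ^ 2) := by positivity
    linarith
  let F : ℕ → ℝ → ℝ := fun n u => (2 * (-1) ^ n) * (u * Real.exp (-(2 * ((n : ℝ) + 1) * u)))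
  have hF : ∀ n, IntegrableOn (F n) (Set.Ioi 0) := fun n => (hI n).const_mul _
  have hnorm : ∀ n, ∫ u in Set.Ioi (0 : ℝ), ‖F n u‖ = 2 * (1 / (4 * ((n : ℝ) + 1) ^ 2)) := by
    intro n
    rw [← hint n, ← integral_const_mul]
    refine setIntegral_congr_fun measurableSet_Ioi fun u hu => ?_
    have hu : 0 < u := hu
    simp only [F, norm_mul, norm_pow, norm_neg, norm_one, one_pow, mul_one, Real.norm_eq_abs,
      abs_of_pos hu, Real.abs_exp, abs_two]
  have hsum : Summable fun n => ∫ u in Set.Ioi (0 : ℝ), ‖F n u‖ := by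
    simp only [hnorm]
    have h1 : Summable fun n : ℕ => (1 : ℝ) / ((n : ℝ) + 1) ^ 2 := by
      have := (hasSum_nat_add_iff' 1).2 hasSum_zeta_two
      simpa using this.summable
    refine (h1.mul_left (1 / 2)).congr fun n => ?_
    field_simp
    ring
  have h := hasSum_integral_of_summable_integral_norm hF hsum
  have hval : ∀ n, ∫ u in Set.Ioi (0 : ℝ), F n u = 1 / 2 * ((-1) ^ n / ((n : ℝ) + 1) ^ 2) :=
    fun n => by
      simp only [F]
      rw [integral_const_mul, hint]
      field_simp
      ring
  simp only [hval] at h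
  have h2 := h.unique (hasSum_alternating_inv_sq.mul_left (1 / 2))
  have h3 : ∫ u in Set.Ioi (0 : ℝ), u * (1 - Real.tanh u)
      = ∫ u in Set.Ioi (0 : ℝ), ∑' n, F n u := by
    refine setIntegral_congr_fun measurableSet_Ioi fun u hu => ?_
    have hu : 0 < u := hu
    have hx : Real.exp (-(2 * u)) < 1 := Real.exp_lt_one_iff.2 (by linarith)
    have hx0 := Real.exp_pos (-(2 * u))
    have hg := (hasSum_geometric_of_abs_lt_one (r := -Real.exp (-(2 * u)))
      (by rw [abs_neg, abs_of_pos hx0]; exact hx)).mul_left (2 * u * Real.exp (-(2 * u)))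
    have : HasSum (fun n => F n u) (u * (1 - Real.tanh u)) := by
      have hv : u * (1 - Real.tanh u)
          = 2 * u * Real.exp (-(2 * u)) * (1 - -Real.exp (-(2 * u)))⁻¹ := by
        rw [one_sub_tanh_eq, sub_neg_eq_add]; ring
      rw [hv]
      refine hg.congr_fun fun n => ?_
      · simp only [F]
        have : Real.exp (-(2 * ((n : ℝ) + 1) * u))
            = Real.exp (-(2 * u)) ^ n * Real.exp (-(2 * u)) := by
          rw [← Real.exp_nat_mul, ← Real.exp_add]; ring_nf
        rw [this, neg_pow (Real.exp _)]; ring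
    exact this.tsum_eq.symm
  rw [h3, h2]; ring

/-- By evenness the integral is twice that over the half line, where integration by parts against
`-(1 - tanh u)`, the primitive vanishing at infinity, reduces it to `integral_mul_one_sub_tanh`. -/
theorem hasInt_sq_mul_sechSq : HasInt (fun u => u ^ 2 * sechSq u) (Real.pi ^ 2 / 6) := by
  have hi := integrable_pow_mul_sechSq 2
  refine ⟨hi, ?_⟩
  have he : ∀ x : ℝ, x ^ 2 * sechSq x = |x| ^ 2 * sechSq |x| := fun x => by
    rw [sq_abs]
    rcases abs_choice x with h | h <;> rw [h]
    rw [sechSq_neg]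
  have h1 : ∫ u, u ^ 2 * sechSq u = 2 * ∫ u in Set.Ioi (0 : ℝ), u ^ 2 * sechSq u := by
    rw [← integral_comp_abs (f := fun u => u ^ 2 * sechSq u)]
    exact integral_congr_ae (ae_of_all _ he)
  have hd : ∀ x : ℝ, HasDerivAt (fun u : ℝ => -(u ^ 2 * (1 - Real.tanh u)))
      (x ^ 2 * sechSq x - 2 * (x * (1 - Real.tanh x))) x := fun x => by
    refine (((hasDerivAt_id x).pow 2).mul ((hasDerivAt_tanh x).const_sub 1)).neg.congr_deriv ?_
    simp only [id, Nat.cast_ofNat, Pi.pow_apply]; ring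
  have hj : IntegrableOn (fun u : ℝ => u * (1 - Real.tanh u)) (Set.Ioi 0) := by
    by_contra h
    have := integral_mul_one_sub_tanh
    rw [integral_undef h] at this
    have := Real.pi_pos
    have : 0 < Real.pi ^ 2 / 24 := by positivity
    linarith
  have hlim : Tendsto (fun u : ℝ => -(u ^ 2 * (1 - Real.tanh u))) atTop (nhds 0) := by
    have h0 : Tendsto (fun u : ℝ => 2 * (u ^ 2 * Real.exp (-u))) atTop (nhds 0) := by
      simpa using (Real.tendsto_pow_mul_exp_neg_atTop_nhds_zero 2).const_mul 2
    rw [← neg_zero]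
    refine Tendsto.neg (squeeze_zero' (Eventually.of_forall fun u => ?_) ?_ h0)
    · exact mul_nonneg (sq_nonneg u) (by linarith [Real.tanh_lt_one u])
    · filter_upwards [eventually_ge_atTop 0] with u hu
      have h1 := Real.exp_pos (-(2 * u))
      have h2 : Real.exp (-(2 * u)) ≤ Real.exp (-u) := Real.exp_le_exp.2 (by linarith)
      have h3 : 1 - Real.tanh u ≤ 2 * Real.exp (-u) := by
        rw [one_sub_tanh_eq, div_le_iff₀ (by positivity)]
        nlinarith [Real.exp_pos (-u)]
      nlinarith [sq_nonneg u]
  have h2 := integral_Ioi_of_hasDerivAt_of_tendsto' (a := 0) (fun x _ => hd x)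
    (hi.integrableOn.sub (hj.const_mul 2)) hlim
  rw [integral_sub hi.integrableOn (hj.const_mul 2), integral_const_mul,
    integral_mul_one_sub_tanh] at h2
  rw [h1]
  norm_num at h2
  linarith

/-- Since `(sech²)'' = 4 sech² - 6 sech⁴`, the function `u² (sech²)' - 2u sech²` has derivative `4u²
sech² - 6u² sech⁴ - 2 sech²`, whose integral vanishes. -/
theorem hasInt_sq_mul_sechSq_sq :
    HasInt (fun u => u ^ 2 * sechSq u ^ 2) (Real.pi ^ 2 / 9 - 2 / 3) := by
  have hi : Integrable fun u => u ^ 2 * sechSq u ^ 2 := by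
    simpa [sq] using integrable_pow_mul_sechSq_mul 2 continuous_sechSq abs_sechSq_le_one
  have hi2 : Integrable fun u => u ^ 2 * (Real.tanh u * sechSq u) :=
    integrable_pow_mul_sechSq_mul 2 continuous_tanh abs_tanh_le_one
  have h0 : ∀ x : ℝ, HasDerivAt (fun u => -2 * (u ^ 2 * (Real.tanh u * sechSq u))
      + -2 * (u * sechSq u))
      (4 * (x ^ 2 * sechSq x) - 6 * (x ^ 2 * sechSq x ^ 2) - 2 * sechSq x) x := fun x => by
    have ht := hasDerivAt_tanh x
    have hs := hasDerivAt_sechSq x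
    refine (((((hasDerivAt_id x).pow 2).mul (ht.mul hs)).const_mul (-2)).add
      (((hasDerivAt_id x).mul hs).const_mul (-2))).congr_deriv ?_
    simp only [id, Nat.cast_ofNat, sechSq, Pi.pow_apply, Pi.mul_apply]; ring
  have hA := hasInt_sq_mul_sechSq.const_mul 4
  have hB := hasInt_sechSq.const_mul 2
  have hC := hi.const_mul 6
  have h := integral_eq_zero_of_hasDerivAt_of_integrable h0 ((hA.1.sub hC).sub hB.1)
    ((hi2.const_mul _).add (hasInt_mul_sechSq.1.const_mul _))
  have h1 := integral_sub (hA.1.sub hC) hB.1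
  simp only [Pi.sub_apply] at h1
  rw [h1, integral_sub hA.1 hC, hA.2, hB.2, integral_const_mul] at h
  exact ⟨hi, by linarith⟩

/-! ### Spatial integrals of the kink-antikink profile -/

theorem hasInt_sechSq_shift (c : ℝ) : HasInt (fun y => sechSq (y + c)) 2 :=
  hasInt_sechSq.comp_add c

/-- Here and below: expand powers of `y = (y + c) - c` and translate. -/
theorem hasInt_mul_sechSq_shift (c : ℝ) : HasInt (fun y => y * sechSq (y + c)) (-2 * c) :=
  ((hasInt_mul_sechSq.comp_add c).sub ((hasInt_sechSq.comp_add c).const_mul c)).congr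
    (fun y => by ring) (by ring)

theorem hasInt_sq_mul_sechSq_shift (c : ℝ) :
    HasInt (fun y => y ^ 2 * sechSq (y + c)) (Real.pi ^ 2 / 6 + 2 * c ^ 2) :=
  (((hasInt_sq_mul_sechSq.comp_add c).sub ((hasInt_mul_sechSq.comp_add c).const_mul (2 * c))).add
    ((hasInt_sechSq.comp_add c).const_mul (c ^ 2))).congr (fun y => by ring) (by ring)

theorem hasInt_cube_mul_sechSq_shift (c : ℝ) :
    HasInt (fun y => y ^ 3 * sechSq (y + c)) (-(Real.pi ^ 2 / 2 * c + 2 * c ^ 3)) :=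
  ((((hasInt_cube_mul_sechSq.comp_add c).sub
    ((hasInt_sq_mul_sechSq.comp_add c).const_mul (3 * c))).add
    ((hasInt_mul_sechSq.comp_add c).const_mul (3 * c ^ 2))).sub
    ((hasInt_sechSq.comp_add c).const_mul (c ^ 3))).congr (fun y => by ring) (by ring)

theorem hasInt_sechSq_sq_shift (c : ℝ) : HasInt (fun y => sechSq (y + c) ^ 2) (4 / 3) :=
  hasInt_sechSq_sq.comp_add c

theorem hasInt_mul_sechSq_sq_shift (c : ℝ) :
    HasInt (fun y => y * sechSq (y + c) ^ 2) (-(4 / 3) * c) :=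
  ((hasInt_mul_sechSq_sq.comp_add c).sub ((hasInt_sechSq_sq.comp_add c).const_mul c)).congr
    (fun y => by ring) (by ring)

theorem hasInt_sq_mul_sechSq_sq_shift (c : ℝ) :
    HasInt (fun y => y ^ 2 * sechSq (y + c) ^ 2) (Real.pi ^ 2 / 9 - 2 / 3 + 4 / 3 * c ^ 2) :=
  (((hasInt_sq_mul_sechSq_sq.comp_add c).sub
    ((hasInt_mul_sechSq_sq.comp_add c).const_mul (2 * c))).add
    ((hasInt_sechSq_sq.comp_add c).const_mul (c ^ 2))).congr (fun y => by ring) (by ring)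

theorem hasInt_tanh_mul_sechSq_shift (c : ℝ) :
    HasInt (fun y => Real.tanh (y + c) * sechSq (y + c)) 0 :=
  hasInt_tanh_mul_sechSq.comp_add c

theorem hasInt_mul_tanh_mul_sechSq_shift (c : ℝ) :
    HasInt (fun y => y * (Real.tanh (y + c) * sechSq (y + c))) 1 :=
  ((hasInt_mul_tanh_mul_sechSq.comp_add c).sub
    ((hasInt_tanh_mul_sechSq.comp_add c).const_mul c)).congr (fun y => by ring) (by ring)

/-- The kink-antikink `tanh (y + C) - tanh (y - C)`. -/
def bump (C y : ℝ) : ℝ := Real.tanh (y + C) - Real.tanh (y + -C)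

/-- The derivative of `bump C y` in `C`. -/
def bumpSum (C y : ℝ) : ℝ := sechSq (y + C) + sechSq (y + -C)

/-- The derivative of `bump C y` in `y`. -/
def bumpDiff (C y : ℝ) : ℝ := sechSq (y + C) - sechSq (y + -C)

/-- `coth (2 C)`. -/
def cothTwo (C : ℝ) : ℝ := (Real.tanh (2 * C))⁻¹

theorem bump_eq (C y : ℝ) :
    bump C y = Real.sinh (2 * C) / (Real.cosh (y + C) * Real.cosh (y + -C)) := by
  have h1 := Real.cosh_pos (y + C)
  have h2 := Real.cosh_pos (y + -C)
  have h3 : Real.sinh (2 * C) = Real.sinh ((y + C) - (y + -C)) := by ring_nf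
  rw [h3, Real.sinh_sub, bump, Real.tanh_eq_sinh_div_cosh, Real.tanh_eq_sinh_div_cosh]
  field_simp

/-- The subtraction formulas for `sinh` and `cosh` applied to `2C = (y + C) - (y - C)`. All later
reductions of products are polynomial consequences of this single relation between the two `tanh`
factors. -/
theorem cothTwo_mul_bump {C : ℝ} (hC : 0 < C) (y : ℝ) :
    cothTwo C * bump C y = 1 - Real.tanh (y + C) * Real.tanh (y + -C) := by
  have h1 := Real.cosh_pos (y + C)
  have h2 := Real.cosh_pos (y + -C)
  have h4 : 0 < Real.sinh (2 * C) := Real.sinh_pos_iff.2 (by linarith)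
  have h5 := Real.cosh_pos (2 * C)
  have h3 : Real.cosh (2 * C) = Real.cosh ((y + C) - (y + -C)) := by ring_nf
  have h6 : cothTwo C = Real.cosh (2 * C) / Real.sinh (2 * C) := by
    rw [cothTwo, Real.tanh_eq_sinh_div_cosh, inv_div]
  have h7 : cothTwo C * bump C y
      = Real.cosh (2 * C) / (Real.cosh (y + C) * Real.cosh (y + -C)) := by
    rw [h6, bump_eq]; field_simp
  rw [h7, h3, Real.cosh_sub, Real.tanh_eq_sinh_div_cosh, Real.tanh_eq_sinh_div_cosh]
  field_simp

theorem continuous_bump (C : ℝ) : Continuous (bump C) :=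
  (continuous_tanh.comp (continuous_id.add continuous_const)).sub
    (continuous_tanh.comp (continuous_id.add continuous_const))

/-- The product `cosh (y + C) cosh (y - C)` equals `cosh² y + sinh² C`, so the bump is at most
`|sinh (2C)| sech² y` in absolute value. -/
theorem integrable_pow_mul_bump (C : ℝ) (n : ℕ) : Integrable fun y => y ^ n * bump C y := by
  refine ((integrable_pow_mul_sechSq n).norm.const_mul |Real.sinh (2 * C)|).mono'
    (((continuous_id.pow n).mul (continuous_bump C)).aestronglyMeasurable)
    (ae_of_all _ fun y => ?_)
  have h1 := Real.cosh_pos (y + C)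
  have h2 := Real.cosh_pos (y + -C)
  have h0 := Real.cosh_pos y
  have h3 : Real.cosh y ^ 2 ≤ Real.cosh (y + C) * Real.cosh (y + -C) := by
    rw [Real.cosh_add, Real.cosh_add, Real.cosh_neg, Real.sinh_neg]
    nlinarith [Real.cosh_sq C, Real.cosh_sq y, sq_nonneg (Real.sinh C)]
  have h4 : |bump C y| ≤ |Real.sinh (2 * C)| * sechSq y := by
    rw [bump_eq, abs_div, abs_of_pos (mul_pos h1 h2), sechSq_eq, mul_one_div]
    gcongr
  rw [norm_mul, norm_mul, Real.norm_eq_abs (bump C y), Real.norm_eq_abs (sechSq y),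
    abs_of_pos (sechSq_pos y)]
  calc ‖y ^ n‖ * |bump C y| ≤ ‖y ^ n‖ * (|Real.sinh (2 * C)| * sechSq y) := by gcongr
    _ = _ := by ring

theorem hasDerivAt_bump (C y : ℝ) : HasDerivAt (bump C) (bumpDiff C y) y := by
  have h := fun c : ℝ => (hasDerivAt_tanh (y + c)).comp y ((hasDerivAt_id y).add_const c)
  refine ((h C).sub (h (-C))).congr_deriv ?_
  simp only [mul_one, bumpDiff]

/-- Integration by parts: `y * bump C y` vanishes at infinity, which leaves first moments of shifted
`sech²`. -/
theorem hasInt_bump (C : ℝ) : HasInt (bump C) (4 * C) := by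
  have hi : Integrable (bump C) := by simpa using integrable_pow_mul_bump C 0
  have hd := (hasInt_mul_sechSq_shift C).sub (hasInt_mul_sechSq_shift (-C))
  have h0 : ∀ y : ℝ, HasDerivAt (fun y => y * bump C y)
      (bump C y + (y * sechSq (y + C) - y * sechSq (y + -C))) y := fun y => by
    refine ((hasDerivAt_id y).mul (hasDerivAt_bump C y)).congr_deriv ?_
    simp only [id, bumpDiff]; ring
  have h := integral_eq_zero_of_hasDerivAt_of_integrable h0 (hi.add hd.1)
    (by simpa using integrable_pow_mul_bump C 1)
  rw [integral_add hi hd.1, hd.2] at h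
  exact ⟨hi, by linarith⟩

theorem hasInt_sq_mul_bump (C : ℝ) :
    HasInt (fun y => y ^ 2 * bump C y) (4 / 3 * C ^ 3 + Real.pi ^ 2 / 3 * C) := by
  have hi := integrable_pow_mul_bump C 2
  have hd := ((hasInt_cube_mul_sechSq_shift C).sub (hasInt_cube_mul_sechSq_shift (-C)))
  have h0 : ∀ y : ℝ, HasDerivAt (fun y => y ^ 3 * bump C y)
      (3 * (y ^ 2 * bump C y) + (y ^ 3 * sechSq (y + C) - y ^ 3 * sechSq (y + -C))) y :=
    fun y => by
      refine (((hasDerivAt_id y).pow 3).mul (hasDerivAt_bump C y)).congr_deriv ?_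
      simp only [id, bumpDiff, Nat.cast_ofNat, Pi.pow_apply]; ring
  have h := integral_eq_zero_of_hasDerivAt_of_integrable h0 ((hi.const_mul 3).add hd.1)
    (integrable_pow_mul_bump C 3)
  rw [integral_add (hi.const_mul 3) hd.1, hd.2, integral_const_mul] at h
  exact ⟨hi, by linarith⟩

theorem bump_sq {C : ℝ} (hC : 0 < C) (y : ℝ) :
    bump C y ^ 2 = 2 * cothTwo C * bump C y - bumpSum C y := by
  have h := cothTwo_mul_bump hC y
  simp only [bumpSum, sechSq]
  unfold bump at h ⊢
  linear_combination (-2) * h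

/-- With `s`, `t` the two `tanh` values, `(1 - s²)(1 - t²) = (1 - s t)² - (s - t)²`. The factor `k²
- 1` makes the overlap of the two flanks exponentially small. -/
theorem sechSq_mul_sechSq {C : ℝ} (hC : 0 < C) (y : ℝ) :
    sechSq (y + C) * sechSq (y + -C) = (cothTwo C ^ 2 - 1) * bump C y ^ 2 := by
  have h := cothTwo_mul_bump hC y
  simp only [sechSq]
  unfold bump at h ⊢
  linear_combination
    (-(cothTwo C * (Real.tanh (y + C) - Real.tanh (y + -C)) + 1
      - Real.tanh (y + C) * Real.tanh (y + -C))) * h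

/-- A product of two localized functions becomes a linear combination of single ones, each with
known moments. -/
theorem bump_mul_sechSq_left {C : ℝ} (hC : 0 < C) (y : ℝ) :
    bump C y * sechSq (y + C) = Real.tanh (y + C) * sechSq (y + C)
      - (cothTwo C ^ 2 - 1) * bump C y + cothTwo C * sechSq (y + C) := by
  have h := cothTwo_mul_bump hC y
  simp only [sechSq]
  unfold bump at h ⊢
  linear_combination (Real.tanh (y + C) + cothTwo C) * h

theorem bump_mul_sechSq_right {C : ℝ} (hC : 0 < C) (y : ℝ) :
    bump C y * sechSq (y + -C) = -(Real.tanh (y + -C) * sechSq (y + -C))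
      - (cothTwo C ^ 2 - 1) * bump C y + cothTwo C * sechSq (y + -C) := by
  have h := cothTwo_mul_bump hC y
  simp only [sechSq]
  unfold bump at h ⊢
  linear_combination (cothTwo C - Real.tanh (y + -C)) * h

theorem hasInt_bump_sq {C : ℝ} (hC : 0 < C) :
    HasInt (fun y => bump C y ^ 2) (8 * cothTwo C * C - 4) :=
  (((hasInt_bump C).const_mul (2 * cothTwo C)).sub
    ((hasInt_sechSq_shift C).add (hasInt_sechSq_shift (-C)))).congr
    (fun y => by rw [bump_sq hC]; rfl) (by ring)

theorem hasInt_sq_mul_bump_sq {C : ℝ} (hC : 0 < C) : HasInt (fun y => y ^ 2 * bump C y ^ 2)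
    (2 * cothTwo C * (4 / 3 * C ^ 3 + Real.pi ^ 2 / 3 * C)
      - (Real.pi ^ 2 / 3 + 4 * C ^ 2)) :=
  (((hasInt_sq_mul_bump C).const_mul (2 * cothTwo C)).sub
    ((hasInt_sq_mul_sechSq_shift C).add (hasInt_sq_mul_sechSq_shift (-C)))).congr
    (fun y => by rw [bump_sq hC, bumpSum]; ring) (by ring)

theorem hasInt_bump_mul_bumpSum {C : ℝ} (hC : 0 < C) : HasInt (fun y => bump C y * bumpSum C y)
    (4 * cothTwo C - 8 * (cothTwo C ^ 2 - 1) * C) :=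
  ((((hasInt_tanh_mul_sechSq_shift C).sub (hasInt_tanh_mul_sechSq_shift (-C))).sub
    ((hasInt_bump C).const_mul (2 * (cothTwo C ^ 2 - 1)))).add
    (((hasInt_sechSq_shift C).add (hasInt_sechSq_shift (-C))).const_mul (cothTwo C))).congr
    (fun y => by
      rw [bumpSum, mul_add, bump_mul_sechSq_left hC, bump_mul_sechSq_right hC]; ring) (by ring)

theorem hasInt_bump_cube {C : ℝ} (hC : 0 < C) : HasInt (fun y => bump C y ^ 3)
    (2 * cothTwo C * (8 * cothTwo C * C - 4)
      - (4 * cothTwo C - 8 * (cothTwo C ^ 2 - 1) * C)) :=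
  (((hasInt_bump_sq hC).const_mul (2 * cothTwo C)).sub (hasInt_bump_mul_bumpSum hC)).congr
    (fun y => by linear_combination bump C y * bump_sq hC y) rfl

theorem hasInt_bumpSum_sq {C : ℝ} (hC : 0 < C) : HasInt (fun y => bumpSum C y ^ 2)
    (8 / 3 + 2 * (cothTwo C ^ 2 - 1) * (8 * cothTwo C * C - 4)) :=
  (((hasInt_sechSq_sq_shift C).add (hasInt_sechSq_sq_shift (-C))).add
    ((hasInt_bump_sq hC).const_mul (2 * (cothTwo C ^ 2 - 1)))).congr
    (fun y => by rw [bumpSum]; linear_combination 2 * sechSq_mul_sechSq hC y) (by ring)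

theorem hasInt_bumpDiff_sq {C : ℝ} (hC : 0 < C) : HasInt (fun y => bumpDiff C y ^ 2)
    (8 / 3 - 2 * (cothTwo C ^ 2 - 1) * (8 * cothTwo C * C - 4)) :=
  (((hasInt_sechSq_sq_shift C).add (hasInt_sechSq_sq_shift (-C))).sub
    ((hasInt_bump_sq hC).const_mul (2 * (cothTwo C ^ 2 - 1)))).congr
    (fun y => by rw [bumpDiff]; linear_combination (-2) * sechSq_mul_sechSq hC y) (by ring)

theorem hasInt_bump_pow_four {C : ℝ} (hC : 0 < C) : HasInt (fun y => bump C y ^ 4)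
    (4 * cothTwo C ^ 2 * (8 * cothTwo C * C - 4)
      - 4 * cothTwo C * (4 * cothTwo C - 8 * (cothTwo C ^ 2 - 1) * C)
      + (8 / 3 + 2 * (cothTwo C ^ 2 - 1) * (8 * cothTwo C * C - 4))) :=
  ((((hasInt_bump_sq hC).const_mul (4 * cothTwo C ^ 2)).sub
    ((hasInt_bump_mul_bumpSum hC).const_mul (4 * cothTwo C))).add (hasInt_bumpSum_sq hC)).congr
    (fun y => by
      linear_combination (bump C y ^ 2 + 2 * cothTwo C * bump C y - bumpSum C y) * bump_sq hC y)
    rfl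

theorem hasInt_sq_mul_bumpDiff_sq {C : ℝ} (hC : 0 < C) : HasInt (fun y => y ^ 2 * bumpDiff C y ^ 2)
    (2 * (Real.pi ^ 2 / 9 - 2 / 3) + 8 / 3 * C ^ 2
      - 2 * (cothTwo C ^ 2 - 1) * (2 * cothTwo C * (4 / 3 * C ^ 3 + Real.pi ^ 2 / 3 * C)
      - (Real.pi ^ 2 / 3 + 4 * C ^ 2))) :=
  (((hasInt_sq_mul_sechSq_sq_shift C).add (hasInt_sq_mul_sechSq_sq_shift (-C))).sub
    ((hasInt_sq_mul_bump_sq hC).const_mul (2 * (cothTwo C ^ 2 - 1)))).congr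
    (fun y => by rw [bumpDiff]; linear_combination (-2 * y ^ 2) * sechSq_mul_sechSq hC y)
    (by ring)

theorem hasInt_mul_bump_mul_bumpDiff {C : ℝ} (hC : 0 < C) :
    HasInt (fun y => y * (bump C y * bumpDiff C y))
    (2 - 4 * cothTwo C * C) :=
  (((hasInt_mul_tanh_mul_sechSq_shift C).add (hasInt_mul_tanh_mul_sechSq_shift (-C))).add
    (((hasInt_mul_sechSq_shift C).sub (hasInt_mul_sechSq_shift (-C))).const_mul
      (cothTwo C))).congr
    (fun y => by
      rw [bumpDiff, mul_sub (bump C y), bump_mul_sechSq_left hC, bump_mul_sechSq_right hC]; ring)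
    (by ring)

theorem hasInt_mul_bumpDiff_mul_bumpSum (C : ℝ) :
    HasInt (fun y => y * (bumpDiff C y * bumpSum C y)) (-(8 / 3) * C) :=
  ((hasInt_mul_sechSq_sq_shift C).sub (hasInt_mul_sechSq_sq_shift (-C))).congr
    (fun y => by rw [bumpDiff, bumpSum]; ring) (by ring)

/-! ### Closed form of the effective Lagrangian and of the energy -/

/-- `∫ φ_t²` of the moving profile, where `k = coth (2 C)`. -/
def kineticForm (k A B C A' B' C' : ℝ) : ℝ :=
  (A' ^ 2 / 4 * (8 * k * C - 4)
    + A ^ 2 / 4 * (B' / B) ^ 2 * (2 * (Real.pi ^ 2 / 9 - 2 / 3) + 8 / 3 * C ^ 2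
      - 2 * (k ^ 2 - 1) * (2 * k * (4 / 3 * C ^ 3 + Real.pi ^ 2 / 3 * C)
      - (Real.pi ^ 2 / 3 + 4 * C ^ 2)))
    + A ^ 2 / 4 * C' ^ 2 * (8 / 3 + 2 * (k ^ 2 - 1) * (8 * k * C - 4))
    + A * A' / 2 * (B' / B) * (2 - 4 * k * C)
    + A * A' / 2 * C' * (4 * k - 8 * (k ^ 2 - 1) * C)
    + A ^ 2 / 2 * (B' / B) * C' * (-(8 / 3) * C)) / B

/-- `∫ (φ_x² / 2 + V(φ))` of the profile, where `k = coth (2 C)`. -/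
def staticForm (c k A B C : ℝ) : ℝ :=
  A ^ 2 * B / 8 * (8 / 3 - 2 * (k ^ 2 - 1) * (8 * k * C - 4))
  + (A ^ 4 / 8 * (4 * k ^ 2 * (8 * k * C - 4) - 4 * k * (4 * k - 8 * (k ^ 2 - 1) * C)
      + (8 / 3 + 2 * (k ^ 2 - 1) * (8 * k * C - 4)))
    - c * A ^ 3 / 8 * (2 * k * (8 * k * C - 4) - (4 * k - 8 * (k ^ 2 - 1) * C))
    + A ^ 2 / 2 * (8 * k * C - 4)) / B

theorem profile_eq (A B C x : ℝ) : profile A B C x = A / 2 * bump C (B * x) := by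
  rw [profile, bump, sub_eq_add_neg (B * x) C]

theorem hasDerivAt_profile_line {A B C : ℝ → ℝ} {A' B' C' t : ℝ} (hA : HasDerivAt A A' t)
    (hB : HasDerivAt B B' t) (hC : HasDerivAt C C' t) (x : ℝ) :
    HasDerivAt (fun s => profile (A s) (B s) (C s) x)
      (A' / 2 * bump (C t) (B t * x) + A t / 2 * (B' * x * bumpDiff (C t) (B t * x)
        + C' * bumpSum (C t) (B t * x))) t := by
  simp only [profile]
  have h1 := (hasDerivAt_tanh (B t * x + C t)).comp t ((hB.mul_const x).add hC)
  have h2 := (hasDerivAt_tanh (B t * x - C t)).comp t ((hB.mul_const x).sub hC)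
  refine ((hA.div_const 2).mul (h1.sub h2)).congr_deriv ?_
  simp only [bump, bumpDiff, bumpSum, Pi.sub_apply, Pi.add_apply, Function.comp,
    sub_eq_add_neg (B t * x) (C t)]
  ring

theorem profileVelocity_eq (A B C A' B' C' x : ℝ) :
    profileVelocity A B C A' B' C' x = A' / 2 * bump C (B * x)
      + A / 2 * (B' * x * bumpDiff C (B * x) + C' * bumpSum C (B * x)) := by
  have h : ∀ p p' : ℝ, HasDerivAt (fun s : ℝ => p + s * p') p' 0 := fun p p' => by
    simpa using ((hasDerivAt_id (0 : ℝ)).mul_const p').const_add p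
  have := (hasDerivAt_profile_line (h A A') (h B B') (h C C') x).deriv
  simpa [profileVelocity] using this

theorem deriv_profile (A B C x : ℝ) :
    deriv (profile A B C) x = A / 2 * (B * bumpDiff C (B * x)) := by
  have e : profile A B C = fun x => A / 2 * bump C (B * x) := funext (profile_eq A B C)
  rw [e]
  have h : HasDerivAt (fun x => bump C (B * x)) (bumpDiff C (B * x) * (B * 1)) x :=
    (hasDerivAt_bump C (B * x)).comp x ((hasDerivAt_id x).const_mul B)
  rw [(h.const_mul (A / 2)).deriv]
  ring

/-- Expand the square of the velocity and substitute `y = B x`; the explicit factor `x` in the `B'`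
term becomes `y / B`, which accounts for the ratios `B' / B`. -/
theorem hasInt_velocity_sq (A : ℝ) {B C : ℝ} (hB : 0 < B) (hC : 0 < C) (A' B' C' : ℝ) :
    HasInt (fun x => (profileVelocity A B C A' B' C' x) ^ 2)
      (kineticForm (cothTwo C) A B C A' B' C') := by
  have h := ((((((hasInt_bump_sq hC).const_mul (A' ^ 2 / 4)).add
    ((hasInt_sq_mul_bumpDiff_sq hC).const_mul (A ^ 2 / 4 * (B' / B) ^ 2))).add
    ((hasInt_bumpSum_sq hC).const_mul (A ^ 2 / 4 * C' ^ 2))).add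
    ((hasInt_mul_bump_mul_bumpDiff hC).const_mul (A * A' / 2 * (B' / B)))).add
    ((hasInt_bump_mul_bumpSum hC).const_mul (A * A' / 2 * C'))).add
    ((hasInt_mul_bumpDiff_mul_bumpSum C).const_mul (A ^ 2 / 2 * (B' / B) * C'))
  refine (h.comp_mul hB).congr (fun x => ?_) rfl
  rw [profileVelocity_eq]
  field_simp
  ring

theorem potential_eq {a c : ℝ} (ha : 0 < a) (hc : 2 * (Real.tanh a + (Real.tanh a)⁻¹) = c)
    (φ : ℝ) : potential a φ = 2 * φ ^ 4 - c * φ ^ 3 + 2 * φ ^ 2 := by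
  have h : Real.tanh a * (Real.tanh a)⁻¹ = 1 := by
    refine mul_inv_cancel₀ ?_
    rw [Real.tanh_eq_sinh_div_cosh]
    exact (div_pos (Real.sinh_pos_iff.2 ha) (Real.cosh_pos a)).ne'
  rw [potential]
  linear_combination (-φ ^ 3) * hc + 2 * φ ^ 2 * h

theorem hasInt_static {a c : ℝ} (ha : 0 < a) (hc : 2 * (Real.tanh a + (Real.tanh a)⁻¹) = c)
    (A : ℝ) {B C : ℝ} (hB : 0 < B) (hC : 0 < C) :
    HasInt (fun x => 1 / 2 * (deriv (profile A B C) x) ^ 2 + potential a (profile A B C x))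
      (staticForm c (cothTwo C) A B C) := by
  have h := ((((hasInt_bumpDiff_sq hC).const_mul (A ^ 2 * B ^ 2 / 8)).add
    ((hasInt_bump_pow_four hC).const_mul (A ^ 4 / 8))).sub
    ((hasInt_bump_cube hC).const_mul (c * A ^ 3 / 8))).add
    ((hasInt_bump_sq hC).const_mul (A ^ 2 / 2))
  refine (h.comp_mul hB).congr (fun x => ?_) ?_
  · rw [deriv_profile, potential_eq ha hc, profile_eq]; ring
  · rw [staticForm]; field_simp; ring

theorem effLagrangian_eq {a c : ℝ} (ha : 0 < a)
    (hc : 2 * (Real.tanh a + (Real.tanh a)⁻¹) = c) (A : ℝ) {B C : ℝ} (hB : 0 < B) (hC : 0 < C)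
    (A' B' C' : ℝ) :
    effLagrangian a A B C A' B' C' = -(1 / 2) * kineticForm (cothTwo C) A B C A' B' C'
      + staticForm c (cothTwo C) A B C := by
  rw [← (((hasInt_velocity_sq A hB hC A' B' C').const_mul (-(1 / 2))).add
    (hasInt_static ha hc A hB hC)).2, effLagrangian]
  simp only [add_assoc]

theorem fieldEnergy_eq {a c : ℝ} (ha : 0 < a)
    (hc : 2 * (Real.tanh a + (Real.tanh a)⁻¹) = c) {A B X : ℝ → ℝ} {A' B' X' t : ℝ}
    (hA : HasDerivAt A A' t) (hB : HasDerivAt B B' t) (hX : HasDerivAt X X' t)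
    (hB0 : 0 < B t) (hX0 : 0 < X t) :
    fieldEnergy a (lump A B X) t
      = 1 / 2 * kineticForm (cothTwo (B t * X t)) (A t) (B t) (B t * X t) A' B'
          (B' * X t + B t * X')
        + staticForm c (cothTwo (B t * X t)) (A t) (B t) (B t * X t) := by
  have hC0 := mul_pos hB0 hX0
  have e : ∀ s x, lump A B X x s = profile (A s) (B s) (B s * X s) x := fun s x => by
    rw [lump, profile, mul_add, mul_sub]; ring_nf
  rw [← (((hasInt_velocity_sq (A t) hB0 hC0 A' B' (B' * X t + B t * X')).const_mul (1 / 2)).add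
    (hasInt_static ha hc (A t) hB0 hC0)).2, fieldEnergy]
  refine integral_congr_ae (ae_of_all _ fun x => ?_)
  simp only [e]
  have hC : HasDerivAt (fun s => B s * X s) (B' * X t + B t * X') t := hB.mul hX
  rw [(hasDerivAt_profile_line hA hB hC x).deriv, profileVelocity_eq]
  simp only [add_assoc]

/-- By the double angle formula `tanh a + coth a = 2 coth (2a)`. Thus the cubic coefficient of the
potential is rational in `b`. -/
theorem tanh_add_inv_tanh {a b : ℝ} (ha : 0 < a)
    (hab : Real.tanh (2 * a) = 3 * b / (2 + b ^ 2)) (hb : 0 < b) :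
    2 * (Real.tanh a + (Real.tanh a)⁻¹) = 4 * (2 + b ^ 2) / (3 * b) := by
  have hs : 0 < Real.sinh a := Real.sinh_pos_iff.2 ha
  have hc := Real.cosh_pos a
  have h : Real.tanh a + (Real.tanh a)⁻¹ = 2 * (Real.tanh (2 * a))⁻¹ := by
    rw [Real.tanh_eq_sinh_div_cosh, Real.tanh_eq_sinh_div_cosh, Real.sinh_two_mul,
      Real.cosh_two_mul]
    field_simp
    ring
  rw [h, hab]
  field_simp
  ring

/-! ### The Euler-Lagrange expressions of the effective Lagrangian -/

theorem tanh_pos {x : ℝ} (hx : 0 < x) : 0 < Real.tanh x := by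
  rw [Real.tanh_eq_sinh_div_cosh]
  exact div_pos (Real.sinh_pos_iff.2 hx) (Real.cosh_pos x)

/-- The derivative is a polynomial in `k = coth (2C)`, so differentiating the coefficient functions
stays within polynomials in `k` and `C`. -/
theorem hasDerivAt_cothTwo {C : ℝ} (hC : 0 < C) :
    HasDerivAt cothTwo (-2 * (cothTwo C ^ 2 - 1)) C := by
  have h0 : Real.tanh (2 * C) ≠ 0 := (tanh_pos (by linarith)).ne'
  have h1 : HasDerivAt (fun C => Real.tanh (2 * C)) (sechSq (2 * C) * (2 * 1)) C :=
    (hasDerivAt_tanh (2 * C)).comp C ((hasDerivAt_id C).const_mul 2)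
  refine (h1.inv h0).congr_deriv ?_
  rw [cothTwo, sechSq]
  field_simp

/-- `∫ T²` for `T = bump C`, as a function of `C` and `k = coth (2 C)`. -/
def coeffP (k C : ℝ) : ℝ := 8 * k * C - 4

/-- `∫ y² (∂_y T)²`. -/
def coeffQ (k C : ℝ) : ℝ := 2 * (Real.pi ^ 2 / 9 - 2 / 3) + 8 / 3 * C ^ 2
  - 2 * (k ^ 2 - 1) * (2 * k * (4 / 3 * C ^ 3 + Real.pi ^ 2 / 3 * C)
    - (Real.pi ^ 2 / 3 + 4 * C ^ 2))

/-- `∫ (∂_C T)²`. -/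
def coeffR (k C : ℝ) : ℝ := 8 / 3 + 2 * (k ^ 2 - 1) * (8 * k * C - 4)

/-- `∫ T ∂_C T`. -/
def coeffV (k C : ℝ) : ℝ := 4 * k - 8 * (k ^ 2 - 1) * C

/-- `∫ T³`. -/
def coeffCube (k C : ℝ) : ℝ := 2 * k * coeffP k C - coeffV k C

/-- `∫ T⁴`. -/
def coeffQuartic (k C : ℝ) : ℝ := 4 * k ^ 2 * coeffP k C - 4 * k * coeffV k C + coeffR k C

/-- The kinetic form in terms of its coefficient functions. -/
def kinForm (p q r v A B C A' B' C' : ℝ) : ℝ :=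
  (A' ^ 2 / 4 * p + A ^ 2 / 4 * (B' / B) ^ 2 * q + A ^ 2 / 4 * C' ^ 2 * r
    - A * A' / 4 * (B' / B) * p + A * A' / 2 * C' * v - 4 / 3 * A ^ 2 * (B' / B) * C' * C) / B

/-- The static energy in terms of its coefficient functions. -/
def statForm (c p r s₃ s₄ A B : ℝ) : ℝ :=
  A ^ 2 * B / 8 * (16 / 3 - r) + (A ^ 4 / 8 * s₄ - c * A ^ 3 / 8 * s₃ + A ^ 2 / 2 * p) / B

theorem kineticForm_eq (k A B C A' B' C' : ℝ) : kineticForm k A B C A' B' C'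
    = kinForm (coeffP k C) (coeffQ k C) (coeffR k C) (coeffV k C) A B C A' B' C' := by
  simp only [kineticForm, kinForm, coeffP, coeffQ, coeffR, coeffV]; ring

theorem staticForm_eq (c k A B C : ℝ) : staticForm c k A B C
    = statForm c (coeffP k C) (coeffR k C) (coeffCube k C) (coeffQuartic k C) A B := by
  simp only [staticForm, statForm, coeffP, coeffR, coeffV, coeffCube, coeffQuartic]; ring

/-- The derivatives of the coefficient functions along `k = coth (2 C)`. -/
def coeffP' (k C : ℝ) : ℝ := 8 * k - 16 * (k ^ 2 - 1) * C

def coeffQ' (k C : ℝ) : ℝ := 16 / 3 * C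
  + (k ^ 2 - 1) * (8 * k * (2 * k * (4 / 3 * C ^ 3 + Real.pi ^ 2 / 3 * C)
    - (Real.pi ^ 2 / 3 + 4 * C ^ 2))
  - 2 * (2 * k * (4 * C ^ 2 + Real.pi ^ 2 / 3) - 8 * C
    - 4 * (k ^ 2 - 1) * (4 / 3 * C ^ 3 + Real.pi ^ 2 / 3 * C)))

def coeffR' (k C : ℝ) : ℝ :=
  (k ^ 2 - 1) * (2 * (8 * k - 16 * (k ^ 2 - 1) * C) - 8 * k * (8 * k * C - 4))

def coeffV' (k C : ℝ) : ℝ := (k ^ 2 - 1) * (32 * k * C - 16)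

def coeffCube' (k C : ℝ) : ℝ :=
  2 * k * coeffP' k C - 4 * (k ^ 2 - 1) * coeffP k C - coeffV' k C

def coeffQuartic' (k C : ℝ) : ℝ :=
  4 * k ^ 2 * coeffP' k C - 16 * k * (k ^ 2 - 1) * coeffP k C
    - 4 * k * coeffV' k C + 8 * (k ^ 2 - 1) * coeffV k C + coeffR' k C

/-- The coefficient functions at `k = coth (2 C)`. -/
def intP (C : ℝ) : ℝ := coeffP (cothTwo C) C
def intQ (C : ℝ) : ℝ := coeffQ (cothTwo C) C
def intR (C : ℝ) : ℝ := coeffR (cothTwo C) C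
def intV (C : ℝ) : ℝ := coeffV (cothTwo C) C
def intCube (C : ℝ) : ℝ := coeffCube (cothTwo C) C
def intQuartic (C : ℝ) : ℝ := coeffQuartic (cothTwo C) C
def intP' (C : ℝ) : ℝ := coeffP' (cothTwo C) C
def intQ' (C : ℝ) : ℝ := coeffQ' (cothTwo C) C
def intR' (C : ℝ) : ℝ := coeffR' (cothTwo C) C
def intV' (C : ℝ) : ℝ := coeffV' (cothTwo C) C
def intCube' (C : ℝ) : ℝ := coeffCube' (cothTwo C) C
def intQuartic' (C : ℝ) : ℝ := coeffQuartic' (cothTwo C) C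

theorem hasDerivAt_intP {C : ℝ} (hC : 0 < C) :
    HasDerivAt intP (intP' C) C := by
  have hk := hasDerivAt_cothTwo hC
  refine (((hk.const_mul 8).mul (hasDerivAt_id C)).sub_const 4).congr_deriv ?_
  simp only [intP', coeffP', id]; ring

theorem hasDerivAt_intR {C : ℝ} (hC : 0 < C) :
    HasDerivAt intR (intR' C) C := by
  have hk := hasDerivAt_cothTwo hC
  refine ((((((hk.pow 2).sub_const 1).const_mul 2).mul
    (((hk.const_mul 8).mul (hasDerivAt_id C)).sub_const 4)).const_add (8 / 3)).congr_deriv ?_)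
  simp only [intR', coeffR', id, Pi.mul_apply, Pi.pow_apply, Nat.cast_ofNat]; ring

theorem hasDerivAt_intV {C : ℝ} (hC : 0 < C) :
    HasDerivAt intV (intV' C) C := by
  have hk := hasDerivAt_cothTwo hC
  refine ((hk.const_mul 4).sub
    ((((hk.pow 2).sub_const 1).const_mul 8).mul (hasDerivAt_id C))).congr_deriv ?_
  simp only [intV', coeffV', id, Pi.pow_apply, Nat.cast_ofNat]; ring

theorem hasDerivAt_intCube {C : ℝ} (hC : 0 < C) :
    HasDerivAt intCube (intCube' C) C := by
  have hk := hasDerivAt_cothTwo hC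
  refine (((hk.const_mul 2).mul (hasDerivAt_intP hC)).sub (hasDerivAt_intV hC)).congr_deriv ?_
  simp only [intCube', coeffCube', intP, intP', intV', coeffP, coeffP', coeffV']; ring

theorem hasDerivAt_intQuartic {C : ℝ} (hC : 0 < C) :
    HasDerivAt intQuartic (intQuartic' C) C := by
  have hk := hasDerivAt_cothTwo hC
  refine (((((hk.pow 2).const_mul 4).mul (hasDerivAt_intP hC)).sub
    ((hk.const_mul 4).mul (hasDerivAt_intV hC))).add (hasDerivAt_intR hC)).congr_deriv ?_
  simp only [intQuartic', coeffQuartic', intP, intP', intV, intV', intR', coeffP, coeffP',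
    coeffV, coeffV', coeffR',
     Pi.pow_apply, Nat.cast_ofNat]; ring

theorem hasDerivAt_intQ {C : ℝ} (hC : 0 < C) :
    HasDerivAt intQ (intQ' C) C := by
  have hk := hasDerivAt_cothTwo hC
  have hi := hasDerivAt_id C
  refine (((((hi.pow 2).const_mul (8 / 3)).const_add (2 * (Real.pi ^ 2 / 9 - 2 / 3))).sub
    ((((hk.pow 2).sub_const 1).const_mul 2).mul
      (((hk.const_mul 2).mul (((hi.pow 3).const_mul (4 / 3)).add
        (hi.const_mul (Real.pi ^ 2 / 3)))).sub
      (((hi.pow 2).const_mul 4).const_add (Real.pi ^ 2 / 3))))).congr_deriv ?_)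
  simp only [intQ', coeffQ', id, Pi.mul_apply, Pi.pow_apply, Pi.add_apply, Pi.sub_apply,
    Nat.cast_ofNat]
  ring

/-- The effective Lagrangian in closed form. -/
def closedLagrangian (c A B C A' B' C' : ℝ) : ℝ :=
  -(1 / 2) * kinForm (intP C) (intQ C) (intR C) (intV C) A B C A' B' C'
    + statForm c (intP C) (intR C) (intCube C) (intQuartic C) A B

theorem effLagrangian_eq_closed {a c : ℝ} (ha : 0 < a)
    (hc : 2 * (Real.tanh a + (Real.tanh a)⁻¹) = c) (A : ℝ) {B C : ℝ} (hB : 0 < B) (hC : 0 < C)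
    (A' B' C' : ℝ) :
    effLagrangian a A B C A' B' C' = closedLagrangian c A B C A' B' C' := by
  rw [effLagrangian_eq ha hc A hB hC, kineticForm_eq, staticForm_eq]
  rfl

/-- The partial derivatives of the Lagrangian are read off from its shape: at most quartic in `A`,
quadratic in each velocity, a Laurent polynomial in `B`, and linear in the coefficient functions of
`C`. -/
theorem deriv_eq_of_quartic {f : ℝ → ℝ} (c₀ c₁ c₂ c₃ c₄ x : ℝ)
    (h : ∀ y, f y = c₀ + c₁ * y + c₂ * y ^ 2 + c₃ * y ^ 3 + c₄ * y ^ 4) :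
    deriv f x = c₁ + 2 * c₂ * x + 3 * c₃ * x ^ 2 + 4 * c₄ * x ^ 3 := by
  rw [funext h]
  have hi := hasDerivAt_id x
  have := ((((hi.const_mul c₁).const_add c₀).add ((hi.pow 2).const_mul c₂)).add
    ((hi.pow 3).const_mul c₃)).add ((hi.pow 4).const_mul c₄)
  refine this.deriv.trans ?_
  simp only [id, Nat.cast_ofNat]
  ring

theorem deriv_eq_of_laurent {f : ℝ → ℝ} (c₁ d₁ d₂ d₃ : ℝ) {x : ℝ} (hx : x ≠ 0)
    (h : ∀ᶠ y in nhds x, f y = c₁ * y + d₁ / y + d₂ / y ^ 2 + d₃ / y ^ 3) :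
    deriv f x = c₁ - d₁ / x ^ 2 - 2 * d₂ / x ^ 3 - 3 * d₃ / x ^ 4 := by
  rw [EventuallyEq.deriv_eq h]
  have hi := hasDerivAt_id x
  have := (((hi.const_mul c₁).add ((hasDerivAt_const x d₁).div hi hx)).add
    ((hasDerivAt_const x d₂).div (hi.pow 2) (pow_ne_zero 2 hx))).add
    ((hasDerivAt_const x d₃).div (hi.pow 3) (pow_ne_zero 3 hx))
  refine this.deriv.trans ?_
  simp only [id, Nat.cast_ofNat, Pi.pow_apply]
  field_simp
  ring

theorem deriv_eq_of_linear {f : ℝ → ℝ} (e p q r v s₃ s₄ i : ℝ) {x : ℝ} (hx : 0 < x)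
    (h : ∀ᶠ y in nhds x, f y = e + p * intP y + q * intQ y + r * intR y + v * intV y
      + s₃ * intCube y + s₄ * intQuartic y + i * y) :
    deriv f x = p * intP' x + q * intQ' x + r * intR' x + v * intV' x
      + s₃ * intCube' x + s₄ * intQuartic' x + i := by
  rw [EventuallyEq.deriv_eq h]
  have := (((((((hasDerivAt_intP hx).const_mul p).const_add e).add
    ((hasDerivAt_intQ hx).const_mul q)).add ((hasDerivAt_intR hx).const_mul r)).add
    ((hasDerivAt_intV hx).const_mul v)).add ((hasDerivAt_intCube hx).const_mul s₃)).add
    ((hasDerivAt_intQuartic hx).const_mul s₄)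
  refine (this.add ((hasDerivAt_id x).const_mul i)).deriv.trans ?_
  ring

/-- `δS/δA` in terms of the coefficient functions and the jet of the curve. -/
def elA (c A A₁ A₂ B B₁ B₂ C C₁ C₂ p q r v s₃ s₄ p' v' : ℝ) : ℝ :=
  -(1 / 2) * ((A / 2 * (B₁ / B) ^ 2 * q + A / 2 * C₁ ^ 2 * r - A₁ / 4 * (B₁ / B) * p
      + A₁ / 2 * C₁ * v - 8 / 3 * A * (B₁ / B) * C₁ * C) / B)
    + A * B / 4 * (16 / 3 - r) + (A ^ 3 / 2 * s₄ - 3 / 8 * c * A ^ 2 * s₃ + A * p) / B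
  + 1 / 2 * ((A₂ / 2 * p + A₁ / 2 * C₁ * p' - (A₁ * B₁ + A * B₂) / 4 / B * p
      - A * B₁ * C₁ / 4 / B * p' + A * B₁ ^ 2 / 4 / B ^ 2 * p + (A₁ * C₁ + A * C₂) / 2 * v
      + A * C₁ ^ 2 / 2 * v') / B
    - B₁ / B ^ 2 * (A₁ / 2 * p - A / 4 * (B₁ / B) * p + A / 2 * C₁ * v))

/-- `δS/δB` in terms of the coefficient functions and the jet of the curve. -/
def elB (c A A₁ A₂ B B₁ B₂ C C₁ C₂ p q r v s₃ s₄ p' q' : ℝ) : ℝ :=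
  -(1 / 2) * (-(A₁ ^ 2 / 4 / B ^ 2 * p) - 3 / 4 * A ^ 2 * B₁ ^ 2 / B ^ 4 * q
      - A ^ 2 * C₁ ^ 2 / 4 / B ^ 2 * r + A * A₁ * B₁ / 2 / B ^ 3 * p
      - A * A₁ * C₁ / 2 / B ^ 2 * v + 8 / 3 * A ^ 2 * B₁ * C₁ * C / B ^ 3)
    + A ^ 2 / 8 * (16 / 3 - r) - (A ^ 4 / 8 * s₄ - c * A ^ 3 / 8 * s₃ + A ^ 2 / 2 * p) / B ^ 2
  + 1 / 2 * (A * A₁ * B₁ / B ^ 3 * q + A ^ 2 * B₂ / 2 / B ^ 3 * q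
      + A ^ 2 * B₁ * C₁ / 2 / B ^ 3 * q' - 3 / 2 * A ^ 2 * B₁ ^ 2 / B ^ 4 * q
      - (A₁ ^ 2 + A * A₂) / 4 / B ^ 2 * p - A * A₁ * C₁ / 4 / B ^ 2 * p'
      + A * A₁ * B₁ / 2 / B ^ 3 * p
      - 4 / 3 * (2 * A * A₁ * C₁ * C + A ^ 2 * C₂ * C + A ^ 2 * C₁ ^ 2) / B ^ 2
      + 8 / 3 * A ^ 2 * C₁ * C * B₁ / B ^ 3)

/-- `δS/δC` in terms of the coefficient functions and the jet of the curve. -/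
def elC (c A A₁ A₂ B B₁ B₂ C C₁ C₂ r v p' q' r' v' s₃' s₄' : ℝ) : ℝ :=
  -(1 / 2) * ((A₁ ^ 2 / 4 * p' + A ^ 2 / 4 * (B₁ / B) ^ 2 * q' + A ^ 2 / 4 * C₁ ^ 2 * r'
      - A * A₁ / 4 * (B₁ / B) * p' + A * A₁ / 2 * C₁ * v' - 4 / 3 * A ^ 2 * (B₁ / B) * C₁) / B)
    - A ^ 2 * B / 8 * r' + (A ^ 4 / 8 * s₄' - c * A ^ 3 / 8 * s₃' + A ^ 2 / 2 * p') / B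
  + 1 / 2 * ((A * A₁ * C₁ * r + A ^ 2 / 2 * C₂ * r + A ^ 2 / 2 * C₁ ^ 2 * r'
      + (A₁ ^ 2 + A * A₂) / 2 * v + A * A₁ / 2 * C₁ * v') / B
    - B₁ / B ^ 2 * (A ^ 2 / 2 * C₁ * r + A * A₁ / 2 * v)
    - 4 / 3 * (2 * A * A₁ * B₁ * C + A ^ 2 * B₂ * C + A ^ 2 * B₁ * C₁) / B ^ 2
    + 8 / 3 * A ^ 2 * B₁ ^ 2 * C / B ^ 3)

/-- `f₁`, `f₂` are the first two derivatives of `f` near `t`. -/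
def IsJet (f f₁ : ℝ → ℝ) (f₂ t : ℝ) : Prop :=
  (∀ᶠ s in nhds t, HasDerivAt f (f₁ s) s) ∧ HasDerivAt f₁ f₂ t

theorem IsJet.hasDerivAt {f f₁ : ℝ → ℝ} {f₂ t : ℝ} (h : IsJet f f₁ f₂ t) :
    HasDerivAt f (f₁ t) t := h.1.self_of_nhds

theorem IsJet.deriv_eventuallyEq {f f₁ : ℝ → ℝ} {f₂ t : ℝ} (h : IsJet f f₁ f₂ t) :
    deriv f =ᶠ[nhds t] f₁ := h.1.mono fun _ hs => hs.deriv

section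

variable {a c : ℝ} {A A₁ B B₁ C C₁ : ℝ → ℝ} {A₂ B₂ C₂ t : ℝ}

theorem variationA_eq (ha : 0 < a) (hc : 2 * (Real.tanh a + (Real.tanh a)⁻¹) = c)
    (hA : IsJet A A₁ A₂ t) (hB : IsJet B B₁ B₂ t) (hC : IsJet C C₁ C₂ t)
    (hB0 : 0 < B t) (hC0 : 0 < C t) :
    variationA a A B C t = elA c (A t) (A₁ t) A₂ (B t) (B₁ t) B₂ (C t) (C₁ t) C₂
      (intP (C t)) (intQ (C t)) (intR (C t)) (intV (C t)) (intCube (C t)) (intQuartic (C t))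
      (intP' (C t)) (intV' (C t)) := by
  have dA := hA.hasDerivAt
  have dB := hB.hasDerivAt
  have dC := hC.hasDerivAt
  -- The momentum `∂L/∂A'` is needed on a whole neighbourhood of `t`, since it is differentiated in
  -- time afterwards.
  have hin : (fun s => deriv (fun y => effLagrangian a (A s) (B s) (C s) y (deriv B s) (deriv C s))
      (deriv A s)) =ᶠ[nhds t] fun s => -(1 / 2) * ((A₁ s / 2 * intP (C s)
        - A s / 4 * (B₁ s / B s) * intP (C s) + A s / 2 * C₁ s * intV (C s)) / B s) := by
    filter_upwards [dB.continuousAt.eventually (lt_mem_nhds hB0),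
      dC.continuousAt.eventually (lt_mem_nhds hC0), hA.deriv_eventuallyEq,
      hB.deriv_eventuallyEq, hC.deriv_eventuallyEq] with s hBs hCs h1 h2 h3
    simp only [effLagrangian_eq_closed ha hc _ hBs hCs, h1, h2, h3]
    rw [deriv_eq_of_quartic (closedLagrangian c (A s) (B s) (C s) 0 (B₁ s) (C₁ s))
      (-(1 / 2) * (-(A s / 4 * (B₁ s / B s) * intP (C s)) + A s / 2 * C₁ s * intV (C s)) / B s)
      (-(1 / 8) * intP (C s) / B s) 0 0]
    · ring
    · intro y
      simp only [closedLagrangian, kinForm]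
      ring
  have dp := (hasDerivAt_intP hC0).comp t dC
  have dv := (hasDerivAt_intV hC0).comp t dC
  have hout := (((((hA.2.div_const 2).mul dp).sub
    (((dA.div_const 4).mul (hB.2.div dB hB0.ne')).mul dp)).add
    (((dA.div_const 2).mul hC.2).mul dv)).div dB hB0.ne').const_mul (-(1 / 2))
  rw [variationA, hin.deriv_eq]
  refine (congrArg (_ - ·) hout.deriv).trans ?_
  simp only [effLagrangian_eq_closed ha hc _ hB0 hC0, dA.deriv, dB.deriv, dC.deriv]
  rw [deriv_eq_of_quartic (-(1 / 8) * A₁ t ^ 2 * intP (C t) / B t)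
    (-(1 / 2) * (-(A₁ t / 4 * (B₁ t / B t) * intP (C t)) + A₁ t / 2 * C₁ t * intV (C t)) / B t)
    (-(1 / 2) * (1 / 4 * (B₁ t / B t) ^ 2 * intQ (C t) + 1 / 4 * C₁ t ^ 2 * intR (C t)
        - 4 / 3 * (B₁ t / B t) * C₁ t * C t) / B t
      + B t / 8 * (16 / 3 - intR (C t)) + 1 / 2 * intP (C t) / B t)
    (-(c / 8 * intCube (C t)) / B t) (1 / 8 * intQuartic (C t) / B t)]
  · simp only [elA, Pi.mul_apply, Pi.sub_apply, Pi.add_apply, Pi.div_apply, Function.comp]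
    have := hB0.ne'
    field_simp
    ring
  · intro y
    simp only [closedLagrangian, kinForm, statForm]
    ring

theorem variationB_eq (ha : 0 < a) (hc : 2 * (Real.tanh a + (Real.tanh a)⁻¹) = c)
    (hA : IsJet A A₁ A₂ t) (hB : IsJet B B₁ B₂ t) (hC : IsJet C C₁ C₂ t)
    (hB0 : 0 < B t) (hC0 : 0 < C t) :
    variationB a A B C t = elB c (A t) (A₁ t) A₂ (B t) (B₁ t) B₂ (C t) (C₁ t) C₂
      (intP (C t)) (intQ (C t)) (intR (C t)) (intV (C t)) (intCube (C t)) (intQuartic (C t))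
      (intP' (C t)) (intQ' (C t)) := by
  have dA := hA.hasDerivAt
  have dB := hB.hasDerivAt
  have dC := hC.hasDerivAt
  have hin : (fun s => deriv (fun y => effLagrangian a (A s) (B s) (C s) (deriv A s) y (deriv C s))
      (deriv B s)) =ᶠ[nhds t] fun s => -(1 / 2) * ((A s ^ 2 * B₁ s / 2 * intQ (C s)) / B s ^ 3
        - (A s * A₁ s / 4 * intP (C s) + 4 / 3 * (A s ^ 2 * C₁ s * C s)) / B s ^ 2) := by
    filter_upwards [dB.continuousAt.eventually (lt_mem_nhds hB0),
      dC.continuousAt.eventually (lt_mem_nhds hC0), hA.deriv_eventuallyEq,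
      hB.deriv_eventuallyEq, hC.deriv_eventuallyEq] with s hBs hCs h1 h2 h3
    simp only [effLagrangian_eq_closed ha hc _ hBs hCs, h1, h2, h3]
    rw [deriv_eq_of_quartic (closedLagrangian c (A s) (B s) (C s) (A₁ s) 0 (C₁ s))
      (1 / 2 * (A s * A₁ s / 4 * intP (C s) + 4 / 3 * A s ^ 2 * C₁ s * C s) / B s ^ 2)
      (-(1 / 8) * A s ^ 2 * intQ (C s) / B s ^ 3) 0 0]
    · ring
    · intro y
      simp only [closedLagrangian, kinForm]
      ring
  have dp := (hasDerivAt_intP hC0).comp t dC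
  have dq := (hasDerivAt_intQ hC0).comp t dC
  have hout := ((((((dA.pow 2).mul hB.2).div_const 2).mul dq).div (dB.pow 3)
    (pow_ne_zero 3 hB0.ne')).sub (((((dA.mul hA.2).div_const 4).mul dp).add
    ((((dA.pow 2).mul hC.2).mul dC).const_mul (4 / 3))).div (dB.pow 2)
    (pow_ne_zero 2 hB0.ne'))).const_mul (-(1 / 2))
  rw [variationB, hin.deriv_eq]
  refine (congrArg (_ - ·) hout.deriv).trans ?_
  rw [deriv_eq_of_laurent (A t ^ 2 / 8 * (16 / 3 - intR (C t)))
    (-(1 / 2) * (A₁ t ^ 2 / 4 * intP (C t) + A t ^ 2 / 4 * C₁ t ^ 2 * intR (C t)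
        + A t * A₁ t / 2 * C₁ t * intV (C t))
      + (A t ^ 4 / 8 * intQuartic (C t) - c * A t ^ 3 / 8 * intCube (C t)
        + A t ^ 2 / 2 * intP (C t)))
    (1 / 2 * (A t * A₁ t / 4 * B₁ t * intP (C t) + 4 / 3 * A t ^ 2 * B₁ t * C₁ t * C t))
    (-(1 / 8) * A t ^ 2 * B₁ t ^ 2 * intQ (C t)) hB0.ne']
  · simp only [elB, Pi.mul_apply, Pi.add_apply, Pi.pow_apply,
      Function.comp, Nat.cast_ofNat]
    have := hB0.ne'
    field_simp
    ring
  · filter_upwards [lt_mem_nhds hB0] with y hy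
    simp only [effLagrangian_eq_closed ha hc _ hy hC0, dA.deriv, dB.deriv, dC.deriv,
      closedLagrangian, kinForm, statForm]
    ring

theorem variationC_eq (ha : 0 < a) (hc : 2 * (Real.tanh a + (Real.tanh a)⁻¹) = c)
    (hA : IsJet A A₁ A₂ t) (hB : IsJet B B₁ B₂ t) (hC : IsJet C C₁ C₂ t)
    (hB0 : 0 < B t) (hC0 : 0 < C t) :
    variationC a A B C t = elC c (A t) (A₁ t) A₂ (B t) (B₁ t) B₂ (C t) (C₁ t) C₂
      (intR (C t)) (intV (C t)) (intP' (C t)) (intQ' (C t)) (intR' (C t)) (intV' (C t))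
      (intCube' (C t)) (intQuartic' (C t)) := by
  have dA := hA.hasDerivAt
  have dB := hB.hasDerivAt
  have dC := hC.hasDerivAt
  have hin : (fun s => deriv (fun y => effLagrangian a (A s) (B s) (C s) (deriv A s) (deriv B s) y)
      (deriv C s)) =ᶠ[nhds t] fun s => -(1 / 2) * ((A s ^ 2 * C₁ s / 2 * intR (C s)
        + A s * A₁ s / 2 * intV (C s)) / B s
        - (4 / 3 * (A s ^ 2 * B₁ s * C s)) / B s ^ 2) := by
    filter_upwards [dB.continuousAt.eventually (lt_mem_nhds hB0),
      dC.continuousAt.eventually (lt_mem_nhds hC0), hA.deriv_eventuallyEq,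
      hB.deriv_eventuallyEq, hC.deriv_eventuallyEq] with s hBs hCs h1 h2 h3
    simp only [effLagrangian_eq_closed ha hc _ hBs hCs, h1, h2, h3]
    rw [deriv_eq_of_quartic (closedLagrangian c (A s) (B s) (C s) (A₁ s) (B₁ s) 0)
      (-(1 / 2) * (A s * A₁ s / 2 * intV (C s) / B s - 4 / 3 * A s ^ 2 * B₁ s * C s / B s ^ 2))
      (-(1 / 8) * A s ^ 2 * intR (C s) / B s) 0 0]
    · ring
    · intro y
      simp only [closedLagrangian, kinForm]
      ring
  have dr := (hasDerivAt_intR hC0).comp t dC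
  have dv := (hasDerivAt_intV hC0).comp t dC
  have hout := ((((((((dA.pow 2).mul hC.2).div_const 2).mul dr).add
    (((dA.mul hA.2).div_const 2).mul dv)).div dB hB0.ne').sub
    (((((dA.pow 2).mul hB.2).mul dC).const_mul (4 / 3)).div (dB.pow 2)
    (pow_ne_zero 2 hB0.ne'))).const_mul (-(1 / 2)))
  rw [variationC, hin.deriv_eq]
  refine (congrArg (_ - ·) hout.deriv).trans ?_
  rw [deriv_eq_of_linear (A t ^ 2 * B t / 8 * (16 / 3))
    (-(1 / 2) * (A₁ t ^ 2 / 4 - A t * A₁ t / 4 * (B₁ t / B t)) / B t + A t ^ 2 / 2 / B t)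
    (-(1 / 8) * A t ^ 2 * (B₁ t / B t) ^ 2 / B t)
    (-(1 / 8) * A t ^ 2 * C₁ t ^ 2 / B t - A t ^ 2 * B t / 8)
    (-(1 / 4) * A t * A₁ t * C₁ t / B t) (-(c * A t ^ 3 / 8) / B t) (A t ^ 4 / 8 / B t)
    (2 / 3 * A t ^ 2 * (B₁ t / B t) * C₁ t / B t) hC0]
  · simp only [elC, Pi.mul_apply, Pi.add_apply, Pi.pow_apply,
      Function.comp, Nat.cast_ofNat]
    have := hB0.ne'
    field_simp
    ring
  · filter_upwards [lt_mem_nhds hC0] with y hy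
    simp only [effLagrangian_eq_closed ha hc _ hB0 hy, dA.deriv, dB.deriv, dC.deriv,
      closedLagrangian, kinForm, statForm]
    ring

end

/-! ### Exponentially small corrections -/

/-- `f` decays faster than every power of `t`. -/
def Negl (f : ℝ → ℝ) : Prop := ∀ n : ℕ, f =O[atTop] fun t : ℝ => (t ^ n)⁻¹

/-- `f` grows at most like a power of `t`. -/
def Tame (f : ℝ → ℝ) : Prop := ∃ n : ℕ, f =O[atTop] fun t : ℝ => t ^ n

/-- `f` and `g` differ by a negligible function. -/
def Near (f g : ℝ → ℝ) : Prop := Negl fun t => f t - g t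

theorem isBigO_pow_of_le {m n : ℕ} (h : m ≤ n) :
    (fun t : ℝ => t ^ m) =O[atTop] fun t : ℝ => t ^ n := by
  refine IsBigO.of_bound 1 ?_
  filter_upwards [eventually_ge_atTop (1 : ℝ)] with t ht
  have h0 : 0 ≤ t := by linarith
  rw [one_mul, Real.norm_of_nonneg (pow_nonneg h0 m), Real.norm_of_nonneg (pow_nonneg h0 n)]
  exact pow_le_pow_right₀ ht h

theorem Tame.const (c : ℝ) : Tame fun _ => c :=
  ⟨0, by simpa using isBigO_const_const c (one_ne_zero' ℝ) atTop⟩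

theorem Tame.mul {f g : ℝ → ℝ} (hf : Tame f) (hg : Tame g) : Tame fun t => f t * g t := by
  obtain ⟨m, hm⟩ := hf
  obtain ⟨n, hn⟩ := hg
  exact ⟨m + n, by simpa only [pow_add] using hm.mul hn⟩

theorem Tame.add {f g : ℝ → ℝ} (hf : Tame f) (hg : Tame g) : Tame fun t => f t + g t := by
  obtain ⟨m, hm⟩ := hf
  obtain ⟨n, hn⟩ := hg
  exact ⟨m + n, (hm.trans (isBigO_pow_of_le (by omega))).add
    (hn.trans (isBigO_pow_of_le (by omega)))⟩

theorem Tame.neg {f : ℝ → ℝ} (hf : Tame f) : Tame fun t => -f t := by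
  obtain ⟨m, hm⟩ := hf
  exact ⟨m, hm.neg_left⟩

theorem Tame.pow {f : ℝ → ℝ} (hf : Tame f) (k : ℕ) : Tame fun t => f t ^ k := by
  induction k with
  | zero => simpa using Tame.const 1
  | succ k ih => simpa only [pow_succ] using ih.mul hf

theorem Tame.inv_pow {g : ℝ → ℝ} (hg : Tame fun t => (g t)⁻¹) (k : ℕ) :
    Tame fun t => (g t ^ k)⁻¹ := by
  simpa only [_root_.inv_pow] using hg.pow k

theorem Negl.add {f g : ℝ → ℝ} (hf : Negl f) (hg : Negl g) : Negl fun t => f t + g t :=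
  fun n => (hf n).add (hg n)

/-- Polynomial growth of order `k` is absorbed by using the decay of order `n + k`. -/
theorem Negl.mul_left {m f : ℝ → ℝ} (hm : Tame m) (hf : Negl f) : Negl fun t => m t * f t := by
  obtain ⟨k, hk⟩ := hm
  intro n
  refine (hk.mul (hf (n + k))).trans_eventuallyEq ?_
  filter_upwards [eventually_gt_atTop (0 : ℝ)] with t ht
  rw [pow_add]
  field_simp

theorem Negl.congr {f g : ℝ → ℝ} (hf : Negl f) (h : ∀ t, g t = f t) : Negl g := by
  rwa [funext h]

/-- `f` and `g` are tame and differ by a negligible function. -/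
structure Approx (f g : ℝ → ℝ) : Prop where
  left : Tame f
  right : Tame g
  near : Near f g

theorem Approx.refl {f : ℝ → ℝ} (hf : Tame f) : Approx f f :=
  ⟨hf, hf, fun n => by simp only [sub_self]; exact isBigO_zero _ _⟩

theorem Approx.const (c : ℝ) : Approx (fun _ => c) fun _ => c := .refl (.const c)

theorem Approx.add {f g f' g' : ℝ → ℝ} (h : Approx f f') (h' : Approx g g') :
    Approx (fun t => f t + g t) (fun t => f' t + g' t) :=
  ⟨h.1.add h'.1, h.2.add h'.2, (Negl.add h.3 h'.3).congr fun t => by ring⟩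

theorem Approx.mul {f g f' g' : ℝ → ℝ} (h : Approx f f') (h' : Approx g g') :
    Approx (fun t => f t * g t) (fun t => f' t * g' t) :=
  ⟨h.1.mul h'.1, h.2.mul h'.2,
    ((Negl.mul_left h.1 h'.3).add (Negl.mul_left h'.2 h.3)).congr fun t => by ring⟩

theorem Approx.neg {f f' : ℝ → ℝ} (h : Approx f f') : Approx (fun t => -f t) (fun t => -f' t) := by
  simpa only [neg_one_mul] using (Approx.const (-1)).mul h

theorem Approx.sub {f g f' g' : ℝ → ℝ} (h : Approx f f') (h' : Approx g g') :
    Approx (fun t => f t - g t) (fun t => f' t - g' t) := by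
  simpa only [sub_eq_add_neg] using h.add h'.neg

theorem Approx.pow {f f' : ℝ → ℝ} (h : Approx f f') (k : ℕ) :
    Approx (fun t => f t ^ k) (fun t => f' t ^ k) := by
  induction k with
  | zero => simpa using Approx.const 1
  | succ k ih => simpa only [pow_succ] using ih.mul h

theorem Approx.div {f f' g : ℝ → ℝ} (h : Approx f f') (hg : Tame fun t => (g t)⁻¹) :
    Approx (fun t => f t / g t) (fun t => f' t / g t) := by
  simpa only [div_eq_mul_inv] using h.mul (.refl hg)

theorem Approx.congr_right {f g g' : ℝ → ℝ} (h : Approx f g) (hg : ∀ t, g t = g' t) :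
    Approx f g' := by
  rwa [← funext hg]

theorem Near.isBigO {f g : ℝ → ℝ} (h : Near f g) {n : ℕ}
    (hg : g =O[atTop] fun t : ℝ => (t ^ n)⁻¹) : f =O[atTop] fun t : ℝ => (t ^ n)⁻¹ := by
  simpa using (h n).add hg

/-- Write `coth - 1 = (1 - tanh) / tanh`; the numerator is at most `2 exp (-4C)` and the denominator
at least `1/2`. The weaker rate `exp (-C)` suffices. -/
theorem cothTwo_sub_one_bounds {C : ℝ} (hC : 1 ≤ C) :
    0 ≤ cothTwo C - 1 ∧ cothTwo C - 1 ≤ 4 * Real.exp (-C) := by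
  have h0 : 0 < Real.tanh (2 * C) := tanh_pos (by linarith)
  have h1 := Real.tanh_lt_one (2 * C)
  have hx := Real.exp_pos (-(2 * (2 * C)))
  have hle : Real.exp (-(2 * (2 * C))) ≤ Real.exp (-C) := Real.exp_le_exp.2 (by linarith)
  have h2 : 1 - Real.tanh (2 * C) ≤ 2 * Real.exp (-(2 * (2 * C))) := by
    rw [one_sub_tanh_eq, div_le_iff₀ (by positivity)]
    nlinarith
  -- From `C ≥ 1` and `e⁴ ≥ 5`; this gives `tanh (2C) ≥ 1/2`.
  have h3 : Real.exp (-(2 * (2 * C))) ≤ 1 / 4 := by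
    have h4 : Real.exp (-(2 * (2 * C))) ≤ Real.exp (-(2 * (2 * 1))) :=
      Real.exp_le_exp.2 (by linarith)
    have h5 := Real.add_one_le_exp (2 * (2 * 1) : ℝ)
    refine h4.trans ?_
    rw [Real.exp_neg, one_div, inv_le_inv₀ (Real.exp_pos _) (by norm_num)]
    linarith
  have h6 : cothTwo C - 1 = (1 - Real.tanh (2 * C)) / Real.tanh (2 * C) := by
    rw [cothTwo]; field_simp
  rw [h6]
  refine ⟨div_nonneg (by linarith) h0.le, ?_⟩
  rw [div_le_iff₀ h0]
  nlinarith [Real.exp_pos (-C)]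

theorem negl_cothTwo_sub_one {C : ℝ → ℝ} (hC : ∀ᶠ t in atTop, t ≤ C t) :
    Negl fun t => cothTwo (C t) - 1 := by
  intro n
  have h : (fun t : ℝ => Real.exp (-t)) =O[atTop] fun t : ℝ => (t ^ n)⁻¹ := by
    have h1 := (Real.tendsto_pow_mul_exp_neg_atTop_nhds_zero n).isBigO_one ℝ
    have h2 := h1.mul (isBigO_refl (fun t : ℝ => (t ^ n)⁻¹) atTop)
    refine (h2.congr' ?_ (Eventually.of_forall fun t => one_mul _))
    filter_upwards [eventually_gt_atTop (0 : ℝ)] with t ht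
    field_simp
  refine IsBigO.trans (IsBigO.of_bound 4 ?_) h
  filter_upwards [hC, eventually_ge_atTop 1] with t ht h1
  have h2 := cothTwo_sub_one_bounds (h1.trans ht)
  rw [Real.norm_of_nonneg h2.1, Real.norm_of_nonneg (Real.exp_pos _).le]
  exact h2.2.trans (by gcongr)

theorem Negl.tame {f : ℝ → ℝ} (hf : Negl f) : Tame f := ⟨0, by simpa using hf 0⟩

/-- All twelve are polynomials in `k` and `C`. As `k - 1` is negligible and `C` is tame, the
replacement `k = 1` passes through sums and products. -/
theorem approx_coefficients {C : ℝ → ℝ} (hC : ∀ᶠ t in atTop, t ≤ C t) (hT : Tame C) :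
    Approx (fun t => intP (C t)) (fun t => 8 * C t - 4) ∧
    Approx (fun t => intQ (C t))
      (fun t => 2 * (Real.pi ^ 2 / 9 - 2 / 3) + 8 / 3 * C t ^ 2) ∧
    Approx (fun t => intR (C t)) (fun _ => 8 / 3) ∧
    Approx (fun t => intV (C t)) (fun _ => 4) ∧
    Approx (fun t => intCube (C t)) (fun t => 16 * C t - 12) ∧
    Approx (fun t => intQuartic (C t)) (fun t => 32 * C t - 88 / 3) ∧
    Approx (fun t => intP' (C t)) (fun _ => 8) ∧
    Approx (fun t => intQ' (C t)) (fun t => 16 / 3 * C t) ∧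
    Approx (fun t => intR' (C t)) (fun _ => 0) ∧
    Approx (fun t => intV' (C t)) (fun _ => 0) ∧
    Approx (fun t => intCube' (C t)) (fun _ => 16) ∧
    Approx (fun t => intQuartic' (C t)) (fun _ => 32) := by
  have hε := negl_cothTwo_sub_one hC
  have hk : Approx (fun t => cothTwo (C t)) fun _ => 1 := by
    refine ⟨?_, .const 1, hε⟩
    have h := hε.tame.add (Tame.const 1)
    simpa only [sub_add_cancel] using h
  have hC' := Approx.refl hT
  -- This factor accompanies every term of the highest degree in `C` and removes it.
  have hpi : Approx (fun t => cothTwo (C t) ^ 2 - 1) fun _ => 0 :=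
    ((hk.pow 2).sub (.const 1)).congr_right fun t => by norm_num
  have hP : Approx (fun t => intP (C t)) (fun t => 8 * C t - 4) :=
    (((((Approx.const 8).mul hk).mul hC').sub (.const 4)).congr_right fun t => by ring)
  have hR : Approx (fun t => intR (C t)) (fun _ => 8 / 3) :=
    ((Approx.const (8 / 3)).add (((Approx.const 2).mul hpi).mul hP)).congr_right
      fun t => by ring
  have hV : Approx (fun t => intV (C t)) (fun _ => 4) :=
    ((((Approx.const 4).mul hk).sub
      (((Approx.const 8).mul hpi).mul hC')).congr_right fun t => by ring)
  have hM : Approx (fun t => 2 * cothTwo (C t) * (4 / 3 * C t ^ 3 + Real.pi ^ 2 / 3 * C t)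
      - (Real.pi ^ 2 / 3 + 4 * C t ^ 2)) _ :=
    (((Approx.const 2).mul hk).mul (((Approx.const (4 / 3)).mul (hC'.pow 3)).add
      ((Approx.const (Real.pi ^ 2 / 3)).mul hC'))).sub
      ((Approx.const (Real.pi ^ 2 / 3)).add ((Approx.const 4).mul (hC'.pow 2)))
  have hQ : Approx (fun t => intQ (C t))
      (fun t => 2 * (Real.pi ^ 2 / 9 - 2 / 3) + 8 / 3 * C t ^ 2) :=
    ((((Approx.const (2 * (Real.pi ^ 2 / 9 - 2 / 3))).add
      ((Approx.const (8 / 3)).mul (hC'.pow 2))).sub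
      (((Approx.const 2).mul hpi).mul hM)).congr_right fun t => by ring)
  have hP' : Approx (fun t => intP' (C t)) (fun _ => 8) :=
    (((Approx.const 8).mul hk).sub
      (((Approx.const 16).mul hpi).mul hC')).congr_right fun t => by ring
  have hR' : Approx (fun t => intR' (C t)) (fun _ => 0) :=
    (hpi.mul (((Approx.const 2).mul hP').sub (((Approx.const 8).mul hk).mul hP))).congr_right
      fun t => by ring
  have hV' : Approx (fun t => intV' (C t)) (fun _ => 0) :=
    (hpi.mul ((((Approx.const 32).mul hk).mul hC').sub (.const 16))).congr_right
      fun t => by ring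
  have hQ' : Approx (fun t => intQ' (C t)) (fun t => 16 / 3 * C t) :=
    (((Approx.const (16 / 3)).mul hC').add (hpi.mul
      ((((Approx.const 8).mul hk).mul hM).sub ((Approx.const 2).mul
        ((((((Approx.const 2).mul hk).mul (((Approx.const 4).mul (hC'.pow 2)).add
          (.const (Real.pi ^ 2 / 3)))).sub ((Approx.const 8).mul hC')).sub
        (((Approx.const 4).mul hpi).mul (((Approx.const (4 / 3)).mul (hC'.pow 3)).add
          ((Approx.const (Real.pi ^ 2 / 3)).mul hC'))))))))).congr_right fun t => by ring
  refine ⟨hP, hQ, hR, hV, ?_, ?_, hP', hQ', hR', hV', ?_, ?_⟩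
  · exact ((((Approx.const 2).mul hk).mul hP).sub hV).congr_right fun t => by ring
  · exact (((((Approx.const 4).mul (hk.pow 2)).mul hP).sub
      (((Approx.const 4).mul hk).mul hV)).add hR).congr_right fun t => by ring
  · exact (((((Approx.const 2).mul hk).mul hP').sub (((Approx.const 4).mul hpi).mul hP)).sub
      hV').congr_right fun t => by ring
  · exact (((((((Approx.const 4).mul (hk.pow 2)).mul hP').sub
      ((((Approx.const 16).mul hk).mul hpi).mul hP)).sub (((Approx.const 4).mul hk).mul hV')).add
      (((Approx.const 8).mul hpi).mul hV)).add hR').congr_right fun t => by ring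

/-! ### The equations and the energy at `k = 1`, in the variables `A, B, X` -/

/-- `δS/δA` without exponentially small terms, in terms of `X = C / B`. -/
def limA (b A A₁ A₂ B B₁ B₂ X X₁ X₂ : ℝ) : ℝ :=
  2 / 3 * A * B * (1 - X₁ ^ 2) + 2 * X * (8 * A ^ 3 - (8 / b + 4 * b) * A ^ 2 + 4 * A)
    - (44 / 3 * A ^ 3 - (12 / b + 6 * b) * A ^ 2 + 4 * A) / B
    - ((Real.pi ^ 2 / 9 - 2 / 3) / 2 + 1) * A * B₁ ^ 2 / B ^ 3 + A₁ * B₁ / B ^ 2 + 2 * A₁ * X₁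
    + A₂ * (2 * X - 1 / B) + A * B₂ / (2 * B ^ 2) + A * X₂

/-- `δS/δB` at fixed `X`, without exponentially small terms. -/
def limB (b A A₁ A₂ B B₁ B₂ X₁ : ℝ) : ℝ :=
  A ^ 2 / 3 * (1 - X₁ ^ 2)
    + (11 / 3 * A ^ 4 - (4 / b + 2 * b) * A ^ 3 + 2 * A ^ 2 + A * A₂ / 2) / B ^ 2
    - 3 / 4 * (Real.pi ^ 2 / 9 - 2 / 3) * A ^ 2 * B₁ ^ 2 / B ^ 4
    + (Real.pi ^ 2 / 9 - 2 / 3) * (A ^ 2 * B₂ / 2 + A * A₁ * B₁) / B ^ 3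

/-- `δS/δX` at fixed `B`, without exponentially small terms. -/
def limX (b A A₁ A₂ B B₁ X₁ X₂ : ℝ) : ℝ :=
  2 * (2 * A ^ 4 - 4 / 3 * (2 / b + b) * A ^ 3 + 2 * A ^ 2)
    + 2 / 3 * (2 * A * A₁ * B * X₁ + A ^ 2 * B₁ * X₁ + A ^ 2 * B * X₂) + A * A₂

/-- The energy without exponentially small terms. -/
def limEnergy (b A A₁ B B₁ X X₁ : ℝ) : ℝ :=
  1 / 2 * (A₁ ^ 2 * (2 * X - 1 / B) + (Real.pi ^ 2 / 9 - 2 / 3) / 2 * A ^ 2 * B₁ ^ 2 / B ^ 3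
      + 2 / 3 * A ^ 2 * B * X₁ ^ 2 + A * A₁ * B₁ / B ^ 2 + 2 * A * A₁ * X₁)
    + A ^ 2 * B / 3 + 2 * X * (2 * A ^ 4 - 4 / 3 * (2 / b + b) * A ^ 3 + 2 * A ^ 2)
    - (11 / 3 * A ^ 4 - (4 / b + 2 * b) * A ^ 3 + 2 * A ^ 2) / B

theorem elA_lim {b B : ℝ} (hb : b ≠ 0) (hB : B ≠ 0) (A A₁ A₂ B₁ B₂ X X₁ X₂ : ℝ) :
    elA (4 * (2 + b ^ 2) / (3 * b)) A A₁ A₂ B B₁ B₂ (B * X) (B₁ * X + B * X₁)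
      (B₂ * X + 2 * B₁ * X₁ + B * X₂) (8 * (B * X) - 4)
      (2 * (Real.pi ^ 2 / 9 - 2 / 3) + 8 / 3 * (B * X) ^ 2) (8 / 3) 4 (16 * (B * X) - 12)
      (32 * (B * X) - 88 / 3) 8 0 = limA b A A₁ A₂ B B₁ B₂ X X₁ X₂ := by
  simp only [elA, limA]
  field_simp
  ring

/-- Chain rule for `C = B X`: the variation in `B` at fixed `X` is the variation in `B` at fixed `C`
plus `X δS/δC`, and `δS/δX = B δS/δC`. -/
theorem elB_lim {b B : ℝ} (hb : b ≠ 0) (hB : B ≠ 0) (A A₁ A₂ B₁ B₂ X X₁ X₂ : ℝ) :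
    elB (4 * (2 + b ^ 2) / (3 * b)) A A₁ A₂ B B₁ B₂ (B * X) (B₁ * X + B * X₁)
      (B₂ * X + 2 * B₁ * X₁ + B * X₂) (8 * (B * X) - 4)
      (2 * (Real.pi ^ 2 / 9 - 2 / 3) + 8 / 3 * (B * X) ^ 2) (8 / 3) 4 (16 * (B * X) - 12)
      (32 * (B * X) - 88 / 3) 8 (16 / 3 * (B * X))
      = limB b A A₁ A₂ B B₁ B₂ X₁ - X / B * limX b A A₁ A₂ B B₁ X₁ X₂ := by
  simp only [elB, limB, limX]
  field_simp
  ring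

theorem elC_lim {b B : ℝ} (hb : b ≠ 0) (hB : B ≠ 0) (A A₁ A₂ B₁ B₂ X X₁ X₂ : ℝ) :
    elC (4 * (2 + b ^ 2) / (3 * b)) A A₁ A₂ B B₁ B₂ (B * X) (B₁ * X + B * X₁)
      (B₂ * X + 2 * B₁ * X₁ + B * X₂) (8 / 3) 4 8 (16 / 3 * (B * X)) 0 0 16 32
      = limX b A A₁ A₂ B B₁ X₁ X₂ / B := by
  simp only [elC, limX]
  field_simp
  ring

theorem energy_lim {b B : ℝ} (hb : b ≠ 0) (hB : B ≠ 0) (A A₁ B₁ X X₁ : ℝ) :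
    1 / 2 * kinForm (8 * (B * X) - 4)
        (2 * (Real.pi ^ 2 / 9 - 2 / 3) + 8 / 3 * (B * X) ^ 2) (8 / 3) 4 A B (B * X) A₁ B₁
        (B₁ * X + B * X₁)
      + statForm (4 * (2 + b ^ 2) / (3 * b)) (8 * (B * X) - 4) (8 / 3) (16 * (B * X) - 12)
        (32 * (B * X) - 88 / 3) A B = limEnergy b A A₁ B B₁ X X₁ := by
  simp only [kinForm, statForm, limEnergy]
  field_simp
  ring

/-! ### Reduction of the variational derivatives to algebraic expressions -/

/-- `f₁`, `f₂` are the first two derivatives of `f` for large arguments, and all are tame. -/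
structure TameJet (f f₁ f₂ : ℝ → ℝ) : Prop where
  jet : ∀ᶠ t in atTop, IsJet f f₁ (f₂ t) t
  tame₀ : Tame f
  tame₁ : Tame f₁
  tame₂ : Tame f₂

theorem TameJet.mul {f f₁ f₂ g g₁ g₂ : ℝ → ℝ} (hf : TameJet f f₁ f₂) (hg : TameJet g g₁ g₂) :
    TameJet (fun t => f t * g t) (fun t => f₁ t * g t + f t * g₁ t)
      (fun t => f₂ t * g t + 2 * f₁ t * g₁ t + f t * g₂ t) where
  jet := by
    filter_upwards [hf.jet, hg.jet] with t h h'
    refine ⟨?_, ?_⟩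
    · filter_upwards [h.1, h'.1] with s hs hs'
      exact hs.mul hs'
    · refine ((h.2.mul h'.hasDerivAt).add (h.hasDerivAt.mul h'.2)).congr_deriv ?_
      ring
  tame₀ := hf.tame₀.mul hg.tame₀
  tame₁ := (hf.tame₁.mul hg.tame₀).add (hf.tame₀.mul hg.tame₁)
  tame₂ := ((hf.tame₂.mul hg.tame₀).add (((Tame.const 2).mul hf.tame₁).mul hg.tame₁)).add
    (hf.tame₀.mul hg.tame₂)

/-- A curve `(A, B, X)` along which the profile widens. -/
structure WideCurve (A A₁ A₂ B B₁ B₂ X X₁ X₂ : ℝ → ℝ) : Prop where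
  jetA : TameJet A A₁ A₂
  jetB : TameJet B B₁ B₂
  jetX : TameJet X X₁ X₂
  tame_inv : Tame fun t => (B t)⁻¹
  pos : ∀ᶠ t in atTop, 0 < B t ∧ 0 < X t
  le : ∀ᶠ t in atTop, t ≤ B t * X t

section

variable {a b : ℝ} {A A₁ A₂ B B₁ B₂ X X₁ X₂ : ℝ → ℝ}

theorem isBigO_of_approx {f g h : ℝ → ℝ} {n : ℕ} (hf : f =ᶠ[atTop] g) (hg : Approx g h)
    (hh : h =O[atTop] fun t : ℝ => (t ^ n)⁻¹) : f =O[atTop] fun t : ℝ => (t ^ n)⁻¹ :=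
  hf.trans_isBigO (hg.near.isBigO hh)

theorem WideCurve.variationA_isBigO (w : WideCurve A A₁ A₂ B B₁ B₂ X X₁ X₂) (ha : 0 < a)
    (hb : 0 < b) (hab : Real.tanh (2 * a) = 3 * b / (2 + b ^ 2)) {n : ℕ}
    (hA : (fun t => limA b (A t) (A₁ t) (A₂ t) (B t) (B₁ t) (B₂ t) (X t) (X₁ t) (X₂ t))
      =O[atTop] fun t : ℝ => (t ^ n)⁻¹) :
    variationA a A B (fun t => B t * X t) =O[atTop] fun t : ℝ => (t ^ n)⁻¹ := by
  have hc := tanh_add_inv_tanh ha hab hb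
  have jC := w.jetB.mul w.jetX
  obtain ⟨hP, hQ, hR, hV, h3, h4, hP', hQ', hR', hV', h3', h4'⟩ :=
    approx_coefficients w.le jC.tame₀
  have aA := Approx.refl w.jetA.tame₀
  have aA₁ := Approx.refl w.jetA.tame₁
  have aA₂ := Approx.refl w.jetA.tame₂
  have aB := Approx.refl w.jetB.tame₀
  have aB₁ := Approx.refl w.jetB.tame₁
  have aB₂ := Approx.refl w.jetB.tame₂
  have aX := Approx.refl w.jetX.tame₀
  have aX₁ := Approx.refl w.jetX.tame₁
  have aX₂ := Approx.refl w.jetX.tame₂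
  have hinv := w.tame_inv
  refine isBigO_of_approx
    (g := fun t => elA (4 * (2 + b ^ 2) / (3 * b)) (A t) (A₁ t) (A₂ t) (B t) (B₁ t) (B₂ t)
      (B t * X t) (B₁ t * X t + B t * X₁ t) (B₂ t * X t + 2 * B₁ t * X₁ t + B t * X₂ t)
      (intP (B t * X t)) (intQ (B t * X t)) (intR (B t * X t)) (intV (B t * X t))
      (intCube (B t * X t)) (intQuartic (B t * X t)) (intP' (B t * X t)) (intV' (B t * X t)))
    ?_ ?_
    ((EventuallyEq.isBigO (w.pos.mono fun t ht => elA_lim hb.ne' ht.1.ne' _ _ _ _ _ _ _ _)).trans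
      hA)
  · filter_upwards [w.jetA.jet, w.jetB.jet, jC.jet, w.pos] with t h1 h2 h3 h4
    have h5 := variationA_eq ha hc h1 h2 h3 h4.1 (mul_pos h4.1 h4.2)
    exact h5
  · simp only [elA]
    -- The expression is built by sums, products, powers and division by powers of `B`, and
    -- closeness passes through each of these; the leaves are the hypotheses in the context.
    repeat' first
      | with_reducible exact Approx.const _
      | with_reducible exact Tame.const _
      | with_reducible apply Tame.inv_pow
      | with_reducible apply Approx.add
      | with_reducible apply Approx.sub
      | with_reducible apply Approx.neg
      | with_reducible apply Approx.mul
      | with_reducible apply Approx.pow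
      | with_reducible apply Approx.div
      | with_reducible assumption

theorem WideCurve.variationB_isBigO (w : WideCurve A A₁ A₂ B B₁ B₂ X X₁ X₂) (ha : 0 < a)
    (hb : 0 < b) (hab : Real.tanh (2 * a) = 3 * b / (2 + b ^ 2)) {n : ℕ}
    (hB : (fun t => limB b (A t) (A₁ t) (A₂ t) (B t) (B₁ t) (B₂ t) (X₁ t)
        - X t / B t * limX b (A t) (A₁ t) (A₂ t) (B t) (B₁ t) (X₁ t) (X₂ t))
      =O[atTop] fun t : ℝ => (t ^ n)⁻¹) :
    variationB a A B (fun t => B t * X t) =O[atTop] fun t : ℝ => (t ^ n)⁻¹ := by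
  have hc := tanh_add_inv_tanh ha hab hb
  have jC := w.jetB.mul w.jetX
  obtain ⟨hP, hQ, hR, hV, h3, h4, hP', hQ', hR', hV', h3', h4'⟩ :=
    approx_coefficients w.le jC.tame₀
  have aA := Approx.refl w.jetA.tame₀
  have aA₁ := Approx.refl w.jetA.tame₁
  have aA₂ := Approx.refl w.jetA.tame₂
  have aB := Approx.refl w.jetB.tame₀
  have aB₁ := Approx.refl w.jetB.tame₁
  have aB₂ := Approx.refl w.jetB.tame₂
  have aX := Approx.refl w.jetX.tame₀
  have aX₁ := Approx.refl w.jetX.tame₁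
  have aX₂ := Approx.refl w.jetX.tame₂
  have hinv := w.tame_inv
  refine isBigO_of_approx
    (g := fun t => elB (4 * (2 + b ^ 2) / (3 * b)) (A t) (A₁ t) (A₂ t) (B t) (B₁ t) (B₂ t)
      (B t * X t) (B₁ t * X t + B t * X₁ t) (B₂ t * X t + 2 * B₁ t * X₁ t + B t * X₂ t)
      (intP (B t * X t)) (intQ (B t * X t)) (intR (B t * X t)) (intV (B t * X t))
      (intCube (B t * X t)) (intQuartic (B t * X t)) (intP' (B t * X t)) (intQ' (B t * X t)))
    ?_ ?_
    ((EventuallyEq.isBigO (w.pos.mono fun t ht => elB_lim hb.ne' ht.1.ne' _ _ _ _ _ _ _ _)).trans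
      hB)
  · filter_upwards [w.jetA.jet, w.jetB.jet, jC.jet, w.pos] with t h1 h2 h3 h4
    have h5 := variationB_eq ha hc h1 h2 h3 h4.1 (mul_pos h4.1 h4.2)
    exact h5
  · simp only [elB]
    repeat' first
      | with_reducible exact Approx.const _
      | with_reducible exact Tame.const _
      | with_reducible apply Tame.inv_pow
      | with_reducible apply Approx.add
      | with_reducible apply Approx.sub
      | with_reducible apply Approx.neg
      | with_reducible apply Approx.mul
      | with_reducible apply Approx.pow
      | with_reducible apply Approx.div
      | with_reducible assumption

theorem WideCurve.variationC_isBigO (w : WideCurve A A₁ A₂ B B₁ B₂ X X₁ X₂) (ha : 0 < a)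
    (hb : 0 < b) (hab : Real.tanh (2 * a) = 3 * b / (2 + b ^ 2)) {n : ℕ}
    (hX : (fun t => limX b (A t) (A₁ t) (A₂ t) (B t) (B₁ t) (X₁ t) (X₂ t) / B t)
      =O[atTop] fun t : ℝ => (t ^ n)⁻¹) :
    variationC a A B (fun t => B t * X t) =O[atTop] fun t : ℝ => (t ^ n)⁻¹ := by
  have hc := tanh_add_inv_tanh ha hab hb
  have jC := w.jetB.mul w.jetX
  obtain ⟨hP, hQ, hR, hV, h3, h4, hP', hQ', hR', hV', h3', h4'⟩ :=
    approx_coefficients w.le jC.tame₀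
  have aA := Approx.refl w.jetA.tame₀
  have aA₁ := Approx.refl w.jetA.tame₁
  have aA₂ := Approx.refl w.jetA.tame₂
  have aB := Approx.refl w.jetB.tame₀
  have aB₁ := Approx.refl w.jetB.tame₁
  have aB₂ := Approx.refl w.jetB.tame₂
  have aX := Approx.refl w.jetX.tame₀
  have aX₁ := Approx.refl w.jetX.tame₁
  have aX₂ := Approx.refl w.jetX.tame₂
  have hinv := w.tame_inv
  refine isBigO_of_approx
    (g := fun t => elC (4 * (2 + b ^ 2) / (3 * b)) (A t) (A₁ t) (A₂ t) (B t) (B₁ t) (B₂ t)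
      (B t * X t) (B₁ t * X t + B t * X₁ t) (B₂ t * X t + 2 * B₁ t * X₁ t + B t * X₂ t)
      (intR (B t * X t)) (intV (B t * X t)) (intP' (B t * X t)) (intQ' (B t * X t))
      (intR' (B t * X t)) (intV' (B t * X t)) (intCube' (B t * X t)) (intQuartic' (B t * X t)))
    ?_ ?_
    ((EventuallyEq.isBigO (w.pos.mono fun t ht =>
      elC_lim hb.ne' ht.1.ne' (A t) (A₁ t) (A₂ t) (B₁ t) (B₂ t) (X t) (X₁ t) (X₂ t))).trans hX)
  · filter_upwards [w.jetA.jet, w.jetB.jet, jC.jet, w.pos] with t h1 h2 h3 h4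
    have h5 := variationC_eq ha hc h1 h2 h3 h4.1 (mul_pos h4.1 h4.2)
    exact h5
  · simp only [elC]
    repeat' first
      | with_reducible exact Approx.const _
      | with_reducible exact Tame.const _
      | with_reducible apply Tame.inv_pow
      | with_reducible apply Approx.add
      | with_reducible apply Approx.sub
      | with_reducible apply Approx.neg
      | with_reducible apply Approx.mul
      | with_reducible apply Approx.pow
      | with_reducible apply Approx.div
      | with_reducible assumption

theorem WideCurve.energy_isBigO (w : WideCurve A A₁ A₂ B B₁ B₂ X X₁ X₂) (ha : 0 < a)
    (hb : 0 < b) (hab : Real.tanh (2 * a) = 3 * b / (2 + b ^ 2)) {n : ℕ} {e : ℝ}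
    (hE : (fun t => limEnergy b (A t) (A₁ t) (B t) (B₁ t) (X t) (X₁ t) - e)
      =O[atTop] fun t : ℝ => (t ^ n)⁻¹) :
    (fun t => fieldEnergy a (lump A B X) t - e) =O[atTop] fun t : ℝ => (t ^ n)⁻¹ := by
  have hc := tanh_add_inv_tanh ha hab hb
  have jC := w.jetB.mul w.jetX
  obtain ⟨hP, hQ, hR, hV, h3, h4, -⟩ := approx_coefficients w.le jC.tame₀
  have aA := Approx.refl w.jetA.tame₀
  have aA₁ := Approx.refl w.jetA.tame₁
  have aB := Approx.refl w.jetB.tame₀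
  have aB₁ := Approx.refl w.jetB.tame₁
  have aX := Approx.refl w.jetX.tame₀
  have aX₁ := Approx.refl w.jetX.tame₁
  have hinv := w.tame_inv
  refine isBigO_of_approx
      (g := fun t => 1 / 2 * kinForm (intP (B t * X t)) (intQ (B t * X t)) (intR (B t * X t))
      (intV (B t * X t)) (A t) (B t) (B t * X t) (A₁ t) (B₁ t) (B₁ t * X t + B t * X₁ t)
      + statForm (4 * (2 + b ^ 2) / (3 * b)) (intP (B t * X t)) (intR (B t * X t))
        (intCube (B t * X t)) (intQuartic (B t * X t)) (A t) (B t) - e)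
      ?_ ?_ ((EventuallyEq.isBigO (w.pos.mono fun t ht =>
    congrArg (· - e) (energy_lim hb.ne' ht.1.ne' _ _ _ _ _))).trans hE)
  · filter_upwards [w.jetA.jet, w.jetB.jet, w.jetX.jet, w.pos] with t h1 h2 h3 h4
    rw [fieldEnergy_eq ha hc h1.hasDerivAt h2.hasDerivAt h3.hasDerivAt h4.1 h4.2, kineticForm_eq,
      staticForm_eq]
    rfl
  · simp only [kinForm, statForm]
    repeat' first
      | with_reducible exact Approx.const _
      | with_reducible exact Tame.const _
      | with_reducible apply Tame.inv_pow
      | with_reducible apply Approx.add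
      | with_reducible apply Approx.sub
      | with_reducible apply Approx.neg
      | with_reducible apply Approx.mul
      | with_reducible apply Approx.pow
      | with_reducible apply Approx.div
      | with_reducible assumption

end

/-! ### The formal series solution -/

section

variable {R : Type*} [CommRing R]

/-- `δS/δB` at fixed `X`, rescaled, where `z` is the inverse of time and `Bh = z B`. -/
def residualB (z m r b A A₁ A₂ Bh B₁ B₂ f₁ φ : R) : R :=
  4 * A ^ 2 * Bh ^ 4 * (2 * f₁ - φ ^ 2)
    + (4 * (11 * A ^ 4 - (12 * r + 6 * b) * A ^ 3 + 6 * A ^ 2) + 6 * A * A₂) * Bh ^ 2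
    - 9 * m * z ^ 2 * A ^ 2 * B₁ ^ 2 + z * (6 * m * A ^ 2 * B₂ + 12 * m * A * A₁ * B₁) * Bh

/-- `δS/δA`, rescaled. -/
def residualA (z m r b A A₁ A₂ Bh B₁ B₂ f₁ φ X₁ h ψ η₁ η₂ ψ₂ : R) : R :=
  4 * A * Bh ^ 4 * (2 * f₁ - φ ^ 2) + 48 * (1 + ψ) * A * (2 * A - b) * Bh ^ 3 * h
    - 2 * (44 * A ^ 3 - (36 * r + 18 * b) * A ^ 2 + 12 * A) * Bh ^ 2
    - (3 * m + 6) * z ^ 2 * A * B₁ ^ 2 + 6 * z * A₁ * B₁ * Bh - 12 * η₁ * X₁ * Bh ^ 3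
    + 12 * η₂ * (1 + ψ) * Bh ^ 3 - 6 * A₂ * Bh ^ 2 + 3 * z * A * B₂ * Bh + 6 * ψ₂ * A * Bh ^ 3

/-- `δS/δX` at fixed `B`, rescaled. -/
def residualX (z r b A Bh Θ f₁ f₂ φ g₁ h h₁ ζ ζ₁ η₂ : R) : R :=
  2 * ζ ^ 2 * (6 * A ^ 2 + 4 * (r - b) * A + 2 * (r ^ 2 - 1)) + 3 * A * η₂
    - 2 * (r ^ 2 * g₁ + 2 * r * Bh * (h₁ - h) + (2 * ζ * ζ₁ - ζ ^ 2) * Bh + 2 * r * Θ * ζ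
      + z * Θ * ζ ^ 2 - 2 * A * ζ₁ * φ * Bh - A ^ 2 * Θ * φ - A ^ 2 * Bh * (f₂ - f₁))

/-- The weight `n + k` produced by differentiating the `n`th term of a series. -/
def wt (k : ℕ) (u : ℕ → ℝ) (n : ℕ) : ℝ := (n + k) * u n

/-- The equation `δS/δB = 0` for the coefficient sequences of `X`, `B`, `A`, with constants
realized in `R` by `K` and sequences by `S`. -/
def equationB (K : ℝ → R) (S : (ℕ → ℝ) → R) (z : R) (b m β₀ : ℝ) (ξ β α : ℕ → ℝ) : R :=
  residualB z (K m) (K b⁻¹) (K b) (K b⁻¹ + z ^ 2 * S α) (-(z ^ 3 * S (wt 2 α)))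
    (z ^ 4 * S (wt 3 (wt 2 α))) (2 * (K b⁻¹ ^ 2 - 1) + z * K β₀ + z ^ 2 * S β)
    (2 * (K b⁻¹ ^ 2 - 1) - z ^ 2 * S (wt 1 β)) (z ^ 3 * S (wt 2 (wt 1 β)))
    (S (wt 1 ξ)) (z * S (wt 1 ξ))

/-- The equation `δS/δA = 0` for the coefficient sequences. -/
def equationA (K : ℝ → R) (S : (ℕ → ℝ) → R) (z : R) (b m β₀ : ℝ) (ξ β α : ℕ → ℝ) : R :=
  residualA z (K m) (K b⁻¹) (K b) (K b⁻¹ + z ^ 2 * S α) (-(z ^ 3 * S (wt 2 α)))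
    (z ^ 4 * S (wt 3 (wt 2 α))) (2 * (K b⁻¹ ^ 2 - 1) + z * K β₀ + z ^ 2 * S β)
    (2 * (K b⁻¹ ^ 2 - 1) - z ^ 2 * S (wt 1 β)) (z ^ 3 * S (wt 2 (wt 1 β)))
    (S (wt 1 ξ)) (z * S (wt 1 ξ)) (1 - z ^ 2 * S (wt 1 ξ)) (S α) (z ^ 2 * S ξ)
    (z ^ 2 * S (wt 2 α)) (z ^ 2 * S (wt 3 (wt 2 α))) (z ^ 2 * S (wt 2 (wt 1 ξ)))

/-- The equation `δS/δX = 0` for the coefficient sequences. -/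
def equationX (K : ℝ → R) (S : (ℕ → ℝ) → R) (z : R) (b β₀ : ℝ) (ξ β α : ℕ → ℝ) : R :=
  residualX z (K b⁻¹) (K b) (K b⁻¹ + z ^ 2 * S α)
    (2 * (K b⁻¹ ^ 2 - 1) + z * K β₀ + z ^ 2 * S β) (K β₀ + z * (S (wt 1 β) + S β))
    (S (wt 1 ξ)) (S (wt 2 (wt 1 ξ))) (z * S (wt 1 ξ)) (S (wt 1 β)) (S α) (S (wt 2 α))
    (z * S α) (z * S (wt 2 α)) (z ^ 2 * S (wt 3 (wt 2 α)))

variable {R' : Type*} [CommRing R'] (F : R →+* R') (K : ℝ → R) (S : (ℕ → ℝ) → R) (z : R)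
  (b m β₀ : ℝ) (ξ β α : ℕ → ℝ)

/-- The equation is a ring expression, hence natural under homomorphisms. This is what transports it
between power series, their quotients by a power of `X`, polynomials and real values. -/
theorem map_equationB : F (equationB K S z b m β₀ ξ β α)
    = equationB (fun c => F (K c)) (fun u => F (S u)) (F z) b m β₀ ξ β α := by
  simp only [equationB, residualB, map_add, map_sub, map_mul, map_pow, map_neg, map_ofNat,
    map_one]

theorem map_equationA : F (equationA K S z b m β₀ ξ β α)
    = equationA (fun c => F (K c)) (fun u => F (S u)) (F z) b m β₀ ξ β α := by
  simp only [equationA, residualA, map_add, map_sub, map_mul, map_pow, map_neg, map_ofNat,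
    map_one]

theorem map_equationX : F (equationX K S z b β₀ ξ β α)
    = equationX (fun c => F (K c)) (fun u => F (S u)) (F z) b β₀ ξ β α := by
  simp only [equationX, residualX, map_add, map_sub, map_mul, map_pow, map_ofNat,
    map_one]

end

/-! ### Order-by-order solution of the formal equations -/

/-- A triangular system of equations for a sequence has a solution. -/
theorem exists_of_triangular {E : Type*} [AddCommGroup E] (Q : (ℕ → E) → ℕ → E)
    (L : ℕ → E → E) (hL : ∀ n y, ∃ d, L n d = y)
    (h : ∀ u v n, (∀ m < n, u m = v m) → Q u n - Q v n = L n (u n - v n)) :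
    ∃ u, ∀ n, Q u n = 0 := by
  choose s hs using hL
  -- The sequence `w n` has its first `n` entries determined and zeros afterwards; with entry `n`
  -- still zero, the value `-(Q (w n) n)` is exactly what the new entry must contribute through `L
  -- n`.
  let w : ℕ → ℕ → E := fun n => Nat.rec (fun _ => 0)
    (fun n v => Function.update v n (s n (-(Q v n)))) n
  have hw : ∀ n, w (n + 1) = Function.update (w n) n (s n (-(Q (w n) n))) := fun n => rfl
  have h0 : ∀ n m, n ≤ m → w n m = 0 := by
    intro n
    induction n with
    | zero => intro m _; rfl
    | succ n ih =>
      intro m hm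
      rw [hw, Function.update_of_ne (by omega), ih m (by omega)]
  have h1 : ∀ n m, m < n → w n m = w (m + 1) m := by
    intro n
    induction n with
    | zero => intro m hm; omega
    | succ n ih =>
      intro m hm
      rcases Nat.lt_succ_iff_lt_or_eq.1 hm with hm' | rfl
      · rw [hw, Function.update_of_ne (by omega), ih m hm']
      · rfl
  refine ⟨fun n => w (n + 1) n, fun n => ?_⟩
  have h2 := h (fun n => w (n + 1) n) (w n) n fun m hm => (h1 n m hm).symm
  simp only [hw n, Function.update_self, h0 n n le_rfl, sub_zero, hs] at h2
  exact sub_eq_neg_self.1 h2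

open PowerSeries in
-- If `D` is divisible by `X ^ n`, only the constant term of the other factor reaches order `n`.
theorem coeff_mul_of_coeff_eq_zero {F D : PowerSeries ℝ} {n : ℕ}
    (h : ∀ m < n, coeff m D = 0) : coeff n (F * D) = coeff 0 F * coeff n D := by
  obtain ⟨G, rfl⟩ := X_pow_dvd_iff.2 h
  rw [mul_left_comm, coeff_X_pow_mul', coeff_X_pow_mul']
  simp

open PowerSeries in
/-- Power series that agree modulo `X ^ (n + 1)` have the same `n`th coefficient. -/
theorem coeff_eq_of_mk_eq {F G : PowerSeries ℝ} {n : ℕ}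
    (h : Ideal.Quotient.mk (Ideal.span {(X : PowerSeries ℝ) ^ (n + 1)}) F
      = Ideal.Quotient.mk (Ideal.span {(X : PowerSeries ℝ) ^ (n + 1)}) G) :
    coeff n F = coeff n G := by
  rw [Ideal.Quotient.eq, Ideal.mem_span_singleton] at h
  have := X_pow_dvd_iff.1 h n (Nat.lt_succ_self n)
  rwa [map_sub, sub_eq_zero] at this

open PowerSeries in
theorem mk_eq_of_coeff_eq {F G : PowerSeries ℝ} {n : ℕ} (h : ∀ m < n, coeff m F = coeff m G) :
    Ideal.Quotient.mk (Ideal.span {(X : PowerSeries ℝ) ^ n}) F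
      = Ideal.Quotient.mk (Ideal.span {(X : PowerSeries ℝ) ^ n}) G := by
  rw [Ideal.Quotient.eq, Ideal.mem_span_singleton, X_pow_dvd_iff]
  intro m hm
  rw [map_sub, sub_eq_zero, h m hm]

open PowerSeries in
-- Multiplication by `X` delays a sequence: modulo `X ^ (n + 1)` its entry `n` is no longer visible.
theorem mk_X_pow_mul_eq {u v : ℕ → ℝ} {n k : ℕ} (hk : 1 ≤ k) (h : ∀ m < n, u m = v m) :
    Ideal.Quotient.mk (Ideal.span {(X : PowerSeries ℝ) ^ (n + 1)}) (X ^ k * PowerSeries.mk u)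
      = Ideal.Quotient.mk (Ideal.span {(X : PowerSeries ℝ) ^ (n + 1)})
        (X ^ k * PowerSeries.mk v) := by
  refine mk_eq_of_coeff_eq fun m hm => ?_
  rw [coeff_X_pow_mul', coeff_X_pow_mul']
  split_ifs with h'
  · rw [coeff_mk, coeff_mk, h _ (by omega)]
  · rfl

theorem wt_eq {u v : ℕ → ℝ} {n : ℕ} (k : ℕ) (h : ∀ m < n, u m = v m) :
    ∀ m < n, wt k u m = wt k v m := fun m hm => by rw [wt, wt, h m hm]

section

open PowerSeries

variable {b m β₀ : ℝ} {ξ β α ξ' β' α' : ℕ → ℝ} {n : ℕ}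

/-- Modulo `X ^ (n + 1)` every series multiplied by a positive power of `X` is fixed by the entries
below `n`. The only bare series is `wt 1 ξ`, in the term `8 A² Bh⁴ f₁`; the product `φ = z f₁` is a
separate argument of the residual precisely so that it does not count as bare. -/
theorem coeff_equationB_sub (hξ : ∀ i < n, ξ i = ξ' i) (hβ : ∀ i < n, β i = β' i)
    (hα : ∀ i < n, α i = α' i) :
    coeff n (equationB C PowerSeries.mk X b m β₀ ξ β α)
      - coeff n (equationB C PowerSeries.mk X b m β₀ ξ' β' α')
    = 8 * b⁻¹ ^ 2 * (2 * (b⁻¹ ^ 2 - 1)) ^ 4 * (n + 1) * (ξ n - ξ' n) := by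
  let π := Ideal.Quotient.mk (Ideal.span {(X : PowerSeries ℝ) ^ (n + 1)})
  have e (k : ℕ) (hk : 1 ≤ k) (u v : ℕ → ℝ) (h : ∀ i < n, u i = v i) :
      π X ^ k * π (PowerSeries.mk u) = π X ^ k * π (PowerSeries.mk v) := by
    rw [← map_pow, ← map_mul, ← map_mul]; exact mk_X_pow_mul_eq hk h
  have e1 (u v : ℕ → ℝ) (h : ∀ i < n, u i = v i) :
      π X * π (PowerSeries.mk u) = π X * π (PowerSeries.mk v) := by
    simpa using e 1 le_rfl u v h
  have key : π (equationB C PowerSeries.mk X b m β₀ ξ β α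
      - equationB C PowerSeries.mk X b m β₀ ξ' β' α')
      = π (8 * (C b⁻¹ + X ^ 2 * PowerSeries.mk α) ^ 2
        * (2 * (C b⁻¹ ^ 2 - 1) + X * C β₀ + X ^ 2 * PowerSeries.mk β) ^ 4
        * (PowerSeries.mk (wt 1 ξ) - PowerSeries.mk (wt 1 ξ'))) := by
    rw [map_sub, map_equationB, map_equationB]
    simp only [map_mul, map_add, map_sub, map_pow, map_ofNat, map_one, equationB]
    rw [e 2 (by norm_num) _ _ hα, e 3 (by norm_num) _ _ (wt_eq 2 hα),
      e 4 (by norm_num) _ _ (wt_eq 3 (wt_eq 2 hα)), e 2 (by norm_num) _ _ hβ,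
      e 2 (by norm_num) _ _ (wt_eq 1 hβ), e 3 (by norm_num) _ _ (wt_eq 2 (wt_eq 1 hβ)),
      e1 _ _ (wt_eq 1 hξ)]
    simp only [residualB]
    ring
  rw [← map_sub, coeff_eq_of_mk_eq key, coeff_mul_of_coeff_eq_zero]
  · simp only [wt, coeff_zero_eq_constantCoeff_apply, map_mul, map_add, map_sub, map_pow,
      map_ofNat, map_one, constantCoeff_X, constantCoeff_C, coeff_mk]
    ring
  · intro i hi
    simp [wt, hξ i hi]

/-- The bare series are now `wt 1 ξ` and `α`. The latter comes from `V'(A) = 4A (2A - b)(A - 1/b)`,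
which is linear in the deviation of `A` from the true vacuum. -/
theorem coeff_equationA_sub (hξ : ∀ i < n, ξ i = ξ' i) (hβ : ∀ i < n, β i = β' i)
    (hα : ∀ i < n, α i = α' i) :
    coeff n (equationA C PowerSeries.mk X b m β₀ ξ β α)
      - coeff n (equationA C PowerSeries.mk X b m β₀ ξ' β' α')
    = 8 * b⁻¹ * (2 * (b⁻¹ ^ 2 - 1)) ^ 4 * (n + 1) * (ξ n - ξ' n)
      + 48 * b⁻¹ * (2 * b⁻¹ - b) * (2 * (b⁻¹ ^ 2 - 1)) ^ 3 * (α n - α' n) := by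
  let π := Ideal.Quotient.mk (Ideal.span {(X : PowerSeries ℝ) ^ (n + 1)})
  have e (k : ℕ) (hk : 1 ≤ k) (u v : ℕ → ℝ) (h : ∀ i < n, u i = v i) :
      π X ^ k * π (PowerSeries.mk u) = π X ^ k * π (PowerSeries.mk v) := by
    rw [← map_pow, ← map_mul, ← map_mul]; exact mk_X_pow_mul_eq hk h
  have e1 (u v : ℕ → ℝ) (h : ∀ i < n, u i = v i) :
      π X * π (PowerSeries.mk u) = π X * π (PowerSeries.mk v) := by
    simpa using e 1 le_rfl u v h
  have key : π (equationA C PowerSeries.mk X b m β₀ ξ β α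
      - equationA C PowerSeries.mk X b m β₀ ξ' β' α')
      = π (8 * (C b⁻¹ + X ^ 2 * PowerSeries.mk α)
        * (2 * (C b⁻¹ ^ 2 - 1) + X * C β₀ + X ^ 2 * PowerSeries.mk β) ^ 4
        * (PowerSeries.mk (wt 1 ξ) - PowerSeries.mk (wt 1 ξ'))
        + 48 * (1 + X ^ 2 * PowerSeries.mk ξ) * (C b⁻¹ + X ^ 2 * PowerSeries.mk α)
          * (2 * (C b⁻¹ + X ^ 2 * PowerSeries.mk α) - C b)
          * (2 * (C b⁻¹ ^ 2 - 1) + X * C β₀ + X ^ 2 * PowerSeries.mk β) ^ 3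
          * (PowerSeries.mk α - PowerSeries.mk α')) := by
    rw [map_sub, map_equationA, map_equationA]
    simp only [map_mul, map_add, map_sub, map_pow, map_ofNat, map_one, equationA]
    rw [e 2 (by norm_num) _ _ hα, e 3 (by norm_num) _ _ (wt_eq 2 hα),
      e 4 (by norm_num) _ _ (wt_eq 3 (wt_eq 2 hα)), e 2 (by norm_num) _ _ hβ,
      e 2 (by norm_num) _ _ (wt_eq 1 hβ), e 3 (by norm_num) _ _ (wt_eq 2 (wt_eq 1 hβ)),
      e1 _ _ (wt_eq 1 hξ), e 2 (by norm_num) _ _ (wt_eq 1 hξ), e 2 (by norm_num) _ _ hξ,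
      e 2 (by norm_num) _ _ (wt_eq 2 hα), e 2 (by norm_num) _ _ (wt_eq 3 (wt_eq 2 hα)),
      e 2 (by norm_num) _ _ (wt_eq 2 (wt_eq 1 hξ))]
    simp only [residualA]
    ring
  rw [← map_sub, coeff_eq_of_mk_eq key, map_add, coeff_mul_of_coeff_eq_zero (n := n),
    coeff_mul_of_coeff_eq_zero (n := n)]
  · simp only [wt, coeff_zero_eq_constantCoeff_apply, map_mul, map_add, map_sub, map_pow,
      map_ofNat, map_one, constantCoeff_X, constantCoeff_C, coeff_mk]
    ring
  · intro i hi
    simp [hα i hi]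
  · intro i hi
    simp [wt, hξ i hi]

/-- Here the bare series of `ξ`, `β` and `α` all survive. The factors `n + 1` and `(n + 1)²` arise
as `(n + 2) - 1` and `(n + 2)(n + 1) - (n + 1)`. -/
theorem coeff_equationX_sub (hξ : ∀ i < n, ξ i = ξ' i) (hβ : ∀ i < n, β i = β' i)
    (hα : ∀ i < n, α i = α' i) :
    coeff n (equationX C PowerSeries.mk X b β₀ ξ β α)
      - coeff n (equationX C PowerSeries.mk X b β₀ ξ' β' α')
    = -2 * (b⁻¹ ^ 2 * (n + 1) * (β n - β' n)
      + 2 * b⁻¹ * (2 * (b⁻¹ ^ 2 - 1)) * (n + 1) * (α n - α' n)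
      - b⁻¹ ^ 2 * (2 * (b⁻¹ ^ 2 - 1)) * (n + 1) ^ 2 * (ξ n - ξ' n)) := by
  let π := Ideal.Quotient.mk (Ideal.span {(X : PowerSeries ℝ) ^ (n + 1)})
  have e (k : ℕ) (hk : 1 ≤ k) (u v : ℕ → ℝ) (h : ∀ i < n, u i = v i) :
      π X ^ k * π (PowerSeries.mk u) = π X ^ k * π (PowerSeries.mk v) := by
    rw [← map_pow, ← map_mul, ← map_mul]; exact mk_X_pow_mul_eq hk h
  have e1 (u v : ℕ → ℝ) (h : ∀ i < n, u i = v i) :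
      π X * π (PowerSeries.mk u) = π X * π (PowerSeries.mk v) := by
    simpa using e 1 le_rfl u v h
  have key : π (equationX C PowerSeries.mk X b β₀ ξ β α
      - equationX C PowerSeries.mk X b β₀ ξ' β' α')
      = π (-2 * C b⁻¹ ^ 2 * (PowerSeries.mk (wt 1 β) - PowerSeries.mk (wt 1 β'))
        + -4 * C b⁻¹ * (2 * (C b⁻¹ ^ 2 - 1) + X * C β₀ + X ^ 2 * PowerSeries.mk β)
          * ((PowerSeries.mk (wt 2 α) - PowerSeries.mk α)
            - (PowerSeries.mk (wt 2 α') - PowerSeries.mk α'))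
        + 2 * (C b⁻¹ + X ^ 2 * PowerSeries.mk α) ^ 2
          * (2 * (C b⁻¹ ^ 2 - 1) + X * C β₀ + X ^ 2 * PowerSeries.mk β)
          * ((PowerSeries.mk (wt 2 (wt 1 ξ)) - PowerSeries.mk (wt 1 ξ))
            - (PowerSeries.mk (wt 2 (wt 1 ξ')) - PowerSeries.mk (wt 1 ξ')))) := by
    rw [map_sub, map_equationX, map_equationX]
    simp only [map_mul, map_add, map_sub, map_pow, map_ofNat, map_one, map_neg, equationX,
      mul_add (π X)]
    rw [e 2 (by norm_num) _ _ hα, e1 _ _ hα, e1 _ _ (wt_eq 2 hα),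
      e 2 (by norm_num) _ _ hβ, e1 _ _ hβ, e1 _ _ (wt_eq 1 hβ),
      e1 _ _ (wt_eq 1 hξ), e 2 (by norm_num) _ _ (wt_eq 3 (wt_eq 2 hα))]
    simp only [residualX]
    ring
  rw [← map_sub, coeff_eq_of_mk_eq key, map_add, map_add, coeff_mul_of_coeff_eq_zero (n := n),
    coeff_mul_of_coeff_eq_zero (n := n), coeff_mul_of_coeff_eq_zero (n := n)]
  · simp only [wt, coeff_zero_eq_constantCoeff_apply, map_mul, map_add, map_sub, map_pow, map_neg,
      map_ofNat, map_one, constantCoeff_X, constantCoeff_C, coeff_mk]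
    ring
  · intro i hi
    simp [wt, hξ i hi]
  · intro i hi
    simp [wt, hα i hi]
  · intro i hi
    simp [wt, hβ i hi]

/-- The formal equations are satisfied by some coefficient sequences. -/
theorem exists_formal_solution (hb0 : 0 < b) (hb1 : b < 1) (m β₀ : ℝ) :
    ∃ ξ β α : ℕ → ℝ, equationB C PowerSeries.mk X b m β₀ ξ β α = 0 ∧
      equationA C PowerSeries.mk X b m β₀ ξ β α = 0 ∧
      equationX C PowerSeries.mk X b β₀ ξ β α = 0 := by
  have hr : 1 < b⁻¹ := (one_lt_inv₀ hb0).2 hb1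
  have key := exists_of_triangular (E := ℝ × ℝ × ℝ)
    (fun u n => (coeff n (equationB C PowerSeries.mk X b m β₀ (fun i => (u i).1)
        (fun i => (u i).2.2) (fun i => (u i).2.1)),
      coeff n (equationA C PowerSeries.mk X b m β₀ (fun i => (u i).1)
        (fun i => (u i).2.2) (fun i => (u i).2.1)),
      coeff n (equationX C PowerSeries.mk X b β₀ (fun i => (u i).1)
        (fun i => (u i).2.2) (fun i => (u i).2.1))))
    (fun n d => (8 * b⁻¹ ^ 2 * (2 * (b⁻¹ ^ 2 - 1)) ^ 4 * (n + 1) * d.1,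
      8 * b⁻¹ * (2 * (b⁻¹ ^ 2 - 1)) ^ 4 * (n + 1) * d.1
        + 48 * b⁻¹ * (2 * b⁻¹ - b) * (2 * (b⁻¹ ^ 2 - 1)) ^ 3 * d.2.1,
      -2 * (b⁻¹ ^ 2 * (n + 1) * d.2.2 + 2 * b⁻¹ * (2 * (b⁻¹ ^ 2 - 1)) * (n + 1) * d.2.1
        - b⁻¹ ^ 2 * (2 * (b⁻¹ ^ 2 - 1)) * (n + 1) ^ 2 * d.1)))
    ?_ ?_
  rotate_left
  · rintro n ⟨y₁, y₂, y₃⟩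
    -- These are the pivots of the triangular system; they are nonzero because `0 < b < 1`.
    have h1 : b⁻¹ ^ 2 - 1 ≠ 0 := by nlinarith
    have h2 : 2 * b⁻¹ - b ≠ 0 := by linarith
    have h3 : b⁻¹ ≠ 0 := by positivity
    have h4 : (n : ℝ) + 1 ≠ 0 := by positivity
    generalize b⁻¹ = r at *
    -- Forward substitution: the component of `X` first, then that of `A`, then that of `B`.
    let x := y₁ / (8 * r ^ 2 * (2 * (r ^ 2 - 1)) ^ 4 * (n + 1))
    let y := (y₂ - 8 * r * (2 * (r ^ 2 - 1)) ^ 4 * (n + 1) * x)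
      / (48 * r * (2 * r - b) * (2 * (r ^ 2 - 1)) ^ 3)
    refine ⟨(x, y, (y₃ / -2 - 2 * r * (2 * (r ^ 2 - 1)) * (n + 1) * y
      + r ^ 2 * (2 * (r ^ 2 - 1)) * (n + 1) ^ 2 * x) / (r ^ 2 * (n + 1))), ?_⟩
    have hx : 8 * r ^ 2 * (2 * (r ^ 2 - 1)) ^ 4 * (n + 1) * x = y₁ := by
      simp only [x]; field_simp
    have hy : 48 * r * (2 * r - b) * (2 * (r ^ 2 - 1)) ^ 3 * y
        = y₂ - 8 * r * (2 * (r ^ 2 - 1)) ^ 4 * (n + 1) * x := by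
      simp only [y]
      rw [← mul_div_assoc, mul_div_cancel_left₀]
      exact mul_ne_zero (mul_ne_zero (mul_ne_zero (by norm_num) h3) h2)
        (pow_ne_zero _ (mul_ne_zero two_ne_zero h1))
    refine Prod.ext hx (Prod.ext ?_ ?_)
    · simp only; rw [hy]; ring
    · simp only; field_simp; ring
  · intro u v n h
    refine Prod.ext ?_ (Prod.ext ?_ ?_)
    · exact coeff_equationB_sub (fun i hi => by rw [h i hi]) (fun i hi => by rw [h i hi])
        fun i hi => by rw [h i hi]
    · exact coeff_equationA_sub (fun i hi => by rw [h i hi]) (fun i hi => by rw [h i hi])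
        fun i hi => by rw [h i hi]
    · exact coeff_equationX_sub (fun i hi => by rw [h i hi]) (fun i hi => by rw [h i hi])
        fun i hi => by rw [h i hi]
  obtain ⟨u, hu⟩ := key
  refine ⟨fun i => (u i).1, fun i => (u i).2.2, fun i => (u i).2.1, ?_, ?_, ?_⟩
  · ext n; exact congrArg Prod.fst (hu n)
  · ext n; exact congrArg (fun p => p.2.1) (hu n)
  · ext n; exact congrArg (fun p => p.2.2) (hu n)

end

/-! ### The leading coefficients of the formal solution -/

section

open PowerSeries

variable (F G : PowerSeries ℝ) (k : ℕ)

theorem coeff_zero_mul_eq : coeff 0 (F * G) = coeff 0 F * coeff 0 G := by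
  simp

theorem coeff_one_mul_eq : coeff 1 (F * G) = coeff 0 F * coeff 1 G + coeff 1 F * coeff 0 G := by
  rw [coeff_mul, Finset.Nat.sum_antidiagonal_eq_sum_range_succ_mk]
  simp [Finset.sum_range_succ]

theorem coeff_two_mul_eq : coeff 2 (F * G)
    = coeff 0 F * coeff 2 G + coeff 1 F * coeff 1 G + coeff 2 F * coeff 0 G := by
  rw [coeff_mul, Finset.Nat.sum_antidiagonal_eq_sum_range_succ_mk]
  simp [Finset.sum_range_succ]

theorem coeff_zero_pow_eq : coeff 0 (F ^ k) = coeff 0 F ^ k := by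
  simp

theorem coeff_one_sq_eq : coeff 1 (F ^ 2) = 2 * coeff 0 F * coeff 1 F := by
  rw [pow_two, coeff_one_mul_eq]; ring

theorem coeff_two_sq_eq : coeff 2 (F ^ 2) = 2 * coeff 0 F * coeff 2 F + coeff 1 F ^ 2 := by
  rw [pow_two, coeff_two_mul_eq]; ring

theorem coeff_one_cube_eq : coeff 1 (F ^ 3) = 3 * coeff 0 F ^ 2 * coeff 1 F := by
  rw [pow_succ, coeff_one_mul_eq, coeff_one_sq_eq, coeff_zero_pow_eq]; ring

theorem coeff_two_cube_eq :
    coeff 2 (F ^ 3) = 3 * coeff 0 F ^ 2 * coeff 2 F + 3 * coeff 0 F * coeff 1 F ^ 2 := by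
  rw [pow_succ, coeff_two_mul_eq, coeff_one_sq_eq, coeff_two_sq_eq, coeff_zero_pow_eq]; ring

theorem coeff_one_fourth_eq : coeff 1 (F ^ 4) = 4 * coeff 0 F ^ 3 * coeff 1 F := by
  rw [pow_succ, coeff_one_mul_eq, coeff_one_cube_eq, coeff_zero_pow_eq]; ring

theorem coeff_two_fourth_eq :
    coeff 2 (F ^ 4) = 4 * coeff 0 F ^ 3 * coeff 2 F + 6 * coeff 0 F ^ 2 * coeff 1 F ^ 2 := by
  rw [pow_succ, coeff_two_mul_eq, coeff_one_cube_eq, coeff_two_cube_eq, coeff_zero_pow_eq]; ring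

theorem coeff_zero_ofNat_eq [k.AtLeastTwo] :
    coeff 0 (ofNat(k) : PowerSeries ℝ) = ofNat(k) := by
  rw [coeff_zero_eq_constantCoeff_apply, map_ofNat]

theorem coeff_succ_ofNat_eq (n : ℕ) [k.AtLeastTwo] :
    coeff (n + 1) (ofNat(k) : PowerSeries ℝ) = 0 := by
  rw [← map_ofNat (C (R := ℝ)) k, coeff_C, if_neg (Nat.succ_ne_zero n)]

theorem coeff_one_ofNat_eq [k.AtLeastTwo] : coeff 1 (ofNat(k) : PowerSeries ℝ) = 0 :=
  coeff_succ_ofNat_eq k 0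

theorem coeff_two_ofNat_eq [k.AtLeastTwo] : coeff 2 (ofNat(k) : PowerSeries ℝ) = 0 :=
  coeff_succ_ofNat_eq k 1

theorem coeff_zero_one_eq : coeff 0 (1 : PowerSeries ℝ) = 1 := by simp

theorem coeff_one_one_eq : coeff 1 (1 : PowerSeries ℝ) = 0 := by simp [coeff_one]

theorem coeff_two_one_eq : coeff 2 (1 : PowerSeries ℝ) = 0 := by simp [coeff_one]

theorem coeff_zero_X_eq : coeff 0 (X : PowerSeries ℝ) = 0 := by simp

theorem coeff_one_X_eq : coeff 1 (X : PowerSeries ℝ) = 1 := by simp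

theorem coeff_two_X_eq : coeff 2 (X : PowerSeries ℝ) = 0 := by simp [coeff_X]

theorem coeff_zero_C_eq (c : ℝ) : coeff 0 (C c : PowerSeries ℝ) = c := by simp

theorem coeff_one_C_eq (c : ℝ) : coeff 1 (C c : PowerSeries ℝ) = 0 := by simp

theorem coeff_two_C_eq (c : ℝ) : coeff 2 (C c : PowerSeries ℝ) = 0 := by simp

variable {F G k}

/-- Here `e` is the left-hand side of an order-`n` equation, linear in its new unknown `x` with
slope `K`. A proposed value `y` is then verified by one rational identity. -/
theorem eq_of_mul_sub_eq {K x y e : ℝ} (hK : K ≠ 0) (he : e = 0) (h : K * (x - y) = e) :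
    x = y :=
  sub_eq_zero.1 ((mul_eq_zero.1 (h.trans he)).resolve_left hK)

set_option maxHeartbeats 2000000 in
/-- The leading coefficients of a formal solution. -/
theorem formal_solution_leading {b β₀ : ℝ} {ξ β α : ℕ → ℝ} (hb0 : 0 < b) (hb1 : b < 1)
    (hB : equationB C PowerSeries.mk X b (Real.pi ^ 2 / 9 - 2 / 3) β₀ ξ β α = 0)
    (hA : equationA C PowerSeries.mk X b (Real.pi ^ 2 / 9 - 2 / 3) β₀ ξ β α = 0)
    (hX : equationX C PowerSeries.mk X b β₀ ξ β α = 0) :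
    ξ 0 = b ^ 2 / (8 * (1 - b ^ 2) ^ 2) ∧
    ξ 1 = b ^ 2 / (8 * (1 - b ^ 2) ^ 2) * (-(b ^ 2 * β₀ / (2 * (1 - b ^ 2)))) ∧
    ξ 2 = b ^ 2 / (8 * (1 - b ^ 2) ^ 2) *
      (b ^ 4 * β₀ ^ 2 / (4 * (1 - b ^ 2) ^ 2) + Real.pi ^ 2 * b ^ 2 / 12
        + b ^ 2 * (12 * b ^ 6 - 44 * b ^ 4 + 53 * b ^ 2 - 22)
          / (16 * (2 - b ^ 2) * (1 - b ^ 2) ^ 2)) ∧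
    β 0 = b ^ 2 / (4 * (1 - b ^ 2)) * ((3 - 2 * b ^ 2) / (2 - b ^ 2)) ∧
    β 1 = b ^ 2 / (4 * (1 - b ^ 2)) * (-(β₀ / (2 * (1 - b ^ 2)))) ∧
    β 2 = b ^ 2 / (4 * (1 - b ^ 2)) *
      (b ^ 2 * β₀ ^ 2 / (4 * (1 - b ^ 2) ^ 2)
        + Real.pi ^ 2 * (22 - 13 * b ^ 2) / (36 * (2 - b ^ 2))
        + (80 * b ^ 10 - 686 * b ^ 8 + 2213 * b ^ 6 - 3368 * b ^ 4 + 2450 * b ^ 2 - 692)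
          / (48 * (1 - b ^ 2) ^ 2 * (2 - b ^ 2) ^ 3)) ∧
    α 0 = b / (8 * (2 - b ^ 2)) ∧
    α 1 = b / (8 * (2 - b ^ 2)) * (-(b ^ 2 * β₀ / (2 * (1 - b ^ 2)))) ∧
    α 2 = b / (8 * (2 - b ^ 2)) *
      (b ^ 4 * β₀ ^ 2 / (4 * (1 - b ^ 2) ^ 2) - Real.pi ^ 2 * b ^ 2 / (18 * (1 - b ^ 2))
        - b ^ 2 * (17 * b ^ 6 - 91 * b ^ 4 + 148 * b ^ 2 - 62)
          / (24 * (1 - b ^ 2) ^ 2 * (2 - b ^ 2) ^ 2)) := by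
  have hb2 : b ^ 2 < 1 := by nlinarith
  have hq : 1 - b ^ 2 ≠ 0 := (sub_pos.2 hb2).ne'
  have hs : 2 - b ^ 2 ≠ 0 := (sub_pos.2 (hb2.trans one_lt_two)).ne'
  have hB0 := congrArg (coeff 0) hB
  have hB1 := congrArg (coeff 1) hB
  have hB2 := congrArg (coeff 2) hB
  have hA0 := congrArg (coeff 0) hA
  have hA1 := congrArg (coeff 1) hA
  have hA2 := congrArg (coeff 2) hA
  have hX0 := congrArg (coeff 0) hX
  have hX1 := congrArg (coeff 1) hX
  have hX2 := congrArg (coeff 2) hX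
  clear hB hA hX
  simp only [equationB, equationA, equationX, residualB, residualA, residualX, map_add, map_sub,
    map_neg, map_zero,
    coeff_zero_mul_eq, coeff_one_mul_eq, coeff_two_mul_eq, coeff_zero_pow_eq, coeff_one_sq_eq,
    coeff_two_sq_eq, coeff_one_cube_eq, coeff_two_cube_eq, coeff_one_fourth_eq,
    coeff_two_fourth_eq, coeff_zero_ofNat_eq, coeff_one_ofNat_eq, coeff_two_ofNat_eq,
    coeff_zero_one_eq, coeff_one_one_eq, coeff_two_one_eq, coeff_zero_X_eq, coeff_one_X_eq,
    coeff_two_X_eq, coeff_zero_C_eq, coeff_one_C_eq, coeff_two_C_eq, coeff_mk, wt,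
    mul_zero, zero_mul, add_zero, zero_add, neg_zero, sub_zero, zero_sub, mul_one, one_mul, one_pow,
    ne_eq, OfNat.ofNat_ne_zero, not_false_eq_true, zero_pow, CharP.cast_eq_zero,
    Nat.cast_one, Nat.cast_ofNat] at hB0 hB1 hB2 hA0 hA1 hA2 hX0 hX1 hX2
  have hb : b ≠ 0 := hb0.ne'
  have hp : 2 * (b⁻¹ ^ 2 - 1) ≠ 0 := by
    have : 2 * (b⁻¹ ^ 2 - 1) = 2 * (1 - b ^ 2) / b ^ 2 := by field_simp
    rw [this]; positivity
  have kB (n : ℕ) : 8 * b⁻¹ ^ 2 * (2 * (b⁻¹ ^ 2 - 1)) ^ 4 * ((n : ℝ) + 1) ≠ 0 := by positivity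
  have kA : 48 * b⁻¹ * ((2 - b ^ 2) / b) * (2 * (b⁻¹ ^ 2 - 1)) ^ 3 ≠ 0 := by positivity
  have kX (n : ℕ) : -(2 * b⁻¹ ^ 2 * ((n : ℝ) + 1)) ≠ 0 := neg_ne_zero.2 (by positivity)
  generalize ξ 0 = ξ₁ at *
  generalize ξ 1 = ξ₂ at *
  generalize ξ 2 = ξ₃ at *
  generalize β 0 = β₁ at *
  generalize β 1 = β₂ at *
  generalize β 2 = β₃ at *
  generalize α 0 = α₂ at *
  generalize α 1 = α₃ at *
  generalize α 2 = α₄ at *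
  -- The unknowns are eliminated in triangular order, `X`, then `A`, then `B`, at each of the orders
  -- 0, 1, 2; each value is substituted before the next identity is checked.
  obtain rfl : ξ₁ = b ^ 2 / (8 * (1 - b ^ 2) ^ 2) :=
    eq_of_mul_sub_eq (kB 0) hB0 (by push_cast; field_simp; ring)
  obtain rfl : α₂ = b / (8 * (2 - b ^ 2)) :=
    eq_of_mul_sub_eq kA hA0 (by field_simp; ring)
  obtain rfl : β₁ = b ^ 2 / (4 * (1 - b ^ 2)) * ((3 - 2 * b ^ 2) / (2 - b ^ 2)) :=
    eq_of_mul_sub_eq (kX 0) hX0 (by push_cast; field_simp; ring)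
  obtain rfl : ξ₂ = b ^ 2 / (8 * (1 - b ^ 2) ^ 2) * (-(b ^ 2 * β₀ / (2 * (1 - b ^ 2)))) :=
    eq_of_mul_sub_eq (kB 1) hB1 (by push_cast; field_simp; ring)
  obtain rfl : α₃ = b / (8 * (2 - b ^ 2)) * (-(b ^ 2 * β₀ / (2 * (1 - b ^ 2)))) :=
    eq_of_mul_sub_eq kA hA1 (by field_simp; ring)
  obtain rfl : β₂ = b ^ 2 / (4 * (1 - b ^ 2)) * (-(β₀ / (2 * (1 - b ^ 2)))) :=
    eq_of_mul_sub_eq (kX 1) hX1 (by push_cast; field_simp; ring)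
  obtain rfl : ξ₃ = b ^ 2 / (8 * (1 - b ^ 2) ^ 2) *
      (b ^ 4 * β₀ ^ 2 / (4 * (1 - b ^ 2) ^ 2) + Real.pi ^ 2 * b ^ 2 / 12
        + b ^ 2 * (12 * b ^ 6 - 44 * b ^ 4 + 53 * b ^ 2 - 22)
          / (16 * (2 - b ^ 2) * (1 - b ^ 2) ^ 2)) :=
    eq_of_mul_sub_eq (kB 2) hB2 (by push_cast; field_simp; ring)
  obtain rfl : α₄ = b / (8 * (2 - b ^ 2)) *
      (b ^ 4 * β₀ ^ 2 / (4 * (1 - b ^ 2) ^ 2) - Real.pi ^ 2 * b ^ 2 / (18 * (1 - b ^ 2))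
        - b ^ 2 * (17 * b ^ 6 - 91 * b ^ 4 + 148 * b ^ 2 - 62)
          / (24 * (1 - b ^ 2) ^ 2 * (2 - b ^ 2) ^ 2)) :=
    eq_of_mul_sub_eq kA hA2 (by field_simp; ring)
  obtain rfl : β₃ = b ^ 2 / (4 * (1 - b ^ 2)) *
      (b ^ 2 * β₀ ^ 2 / (4 * (1 - b ^ 2) ^ 2)
        + Real.pi ^ 2 * (22 - 13 * b ^ 2) / (36 * (2 - b ^ 2))
        + (80 * b ^ 10 - 686 * b ^ 8 + 2213 * b ^ 6 - 3368 * b ^ 4 + 2450 * b ^ 2 - 692)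
          / (48 * (1 - b ^ 2) ^ 2 * (2 - b ^ 2) ^ 3)) :=
    eq_of_mul_sub_eq (kX 2) hX2 (by push_cast; field_simp; ring)
  exact ⟨rfl, rfl, rfl, rfl, rfl, rfl, rfl, rfl, rfl⟩

end

/-! ### Truncation of the formal solution -/

/-- The value at `z` of the truncation of a power series. -/
def truncEval (u : ℕ → ℝ) (N : ℕ) (z : ℝ) : ℝ := ∑ i ∈ Finset.range N, u i * z ^ i

/-- The truncation of a power series as a polynomial. -/
def truncPoly (N : ℕ) (u : ℕ → ℝ) : Polynomial ℝ :=
  ∑ i ∈ Finset.range N, Polynomial.C (u i) * Polynomial.X ^ i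

theorem eval_truncPoly (u : ℕ → ℝ) (N : ℕ) (z : ℝ) :
    (truncPoly N u).eval z = truncEval u N z := by
  simp [truncPoly, truncEval, Polynomial.eval_finsetSum]

theorem coeff_truncPoly (u : ℕ → ℝ) {N i : ℕ} (hi : i < N) : (truncPoly N u).coeff i = u i := by
  simp [truncPoly, Polynomial.finsetSum_coeff, Polynomial.coeff_X_pow, hi]

theorem continuous_truncEval (u : ℕ → ℝ) (N : ℕ) : Continuous (truncEval u N) := by
  unfold truncEval
  fun_prop

/-- The reduction of polynomials to power series modulo `X ^ N`. -/
def truncQuotient (N : ℕ) : Polynomial ℝ →+*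
    PowerSeries ℝ ⧸ Ideal.span {(PowerSeries.X : PowerSeries ℝ) ^ N} :=
  (Ideal.Quotient.mk _).comp Polynomial.coeToPowerSeries.ringHom

theorem truncQuotient_truncPoly (N : ℕ) (u : ℕ → ℝ) :
    truncQuotient N (truncPoly N u) = Ideal.Quotient.mk _ (PowerSeries.mk u) :=
  mk_eq_of_coeff_eq fun i hi => by
    simp [coeff_truncPoly u hi]

theorem truncQuotient_C (N : ℕ) (c : ℝ) :
    truncQuotient N (Polynomial.C c) = Ideal.Quotient.mk _ (PowerSeries.C c) := by
  simp [truncQuotient]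

theorem truncQuotient_X (N : ℕ) :
    truncQuotient N Polynomial.X = Ideal.Quotient.mk _ PowerSeries.X := by
  simp [truncQuotient]

theorem X_pow_dvd_of_truncQuotient_eq_zero {N : ℕ} {p : Polynomial ℝ}
    (h : truncQuotient N p = 0) : Polynomial.X ^ N ∣ p := by
  rw [truncQuotient, RingHom.comp_apply, Ideal.Quotient.eq_zero_iff_mem,
    Ideal.mem_span_singleton, PowerSeries.X_pow_dvd_iff] at h
  rw [Polynomial.X_pow_dvd_iff]
  intro i hi
  simpa using h i hi

section

variable {b m β₀ : ℝ} {ξ β α : ℕ → ℝ}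

/-- The polynomial truncation and the formal solution have the same image modulo `X ^ N`. The
equation for the truncation therefore maps to zero there, so as a polynomial it is divisible by `X ^
N`; then evaluate at `z`. -/
theorem equationB_truncEval (N : ℕ)
    (h : equationB PowerSeries.C PowerSeries.mk PowerSeries.X b m β₀ ξ β α = 0) :
    ∃ q : Polynomial ℝ, ∀ z : ℝ,
      equationB (fun c => c) (fun u => truncEval u N z) z b m β₀ ξ β α = z ^ N * q.eval z := by
  obtain ⟨q, hq⟩ := X_pow_dvd_of_truncQuotient_eq_zero (N := N)
    (p := equationB Polynomial.C (truncPoly N) Polynomial.X b m β₀ ξ β α) (by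
      simp only [map_equationB, truncQuotient_C, truncQuotient_truncPoly, truncQuotient_X]
      rw [← map_equationB, h, map_zero])
  refine ⟨q, fun z => ?_⟩
  have := congrArg (Polynomial.evalRingHom z) hq
  rw [map_equationB] at this
  simpa [eval_truncPoly] using this

theorem equationA_truncEval (N : ℕ)
    (h : equationA PowerSeries.C PowerSeries.mk PowerSeries.X b m β₀ ξ β α = 0) :
    ∃ q : Polynomial ℝ, ∀ z : ℝ,
      equationA (fun c => c) (fun u => truncEval u N z) z b m β₀ ξ β α = z ^ N * q.eval z := by
  obtain ⟨q, hq⟩ := X_pow_dvd_of_truncQuotient_eq_zero (N := N)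
    (p := equationA Polynomial.C (truncPoly N) Polynomial.X b m β₀ ξ β α) (by
      simp only [map_equationA, truncQuotient_C, truncQuotient_truncPoly, truncQuotient_X]
      rw [← map_equationA, h, map_zero])
  refine ⟨q, fun z => ?_⟩
  have := congrArg (Polynomial.evalRingHom z) hq
  rw [map_equationA] at this
  simpa [eval_truncPoly] using this

theorem equationX_truncEval (N : ℕ)
    (h : equationX PowerSeries.C PowerSeries.mk PowerSeries.X b β₀ ξ β α = 0) :
    ∃ q : Polynomial ℝ, ∀ z : ℝ,
      equationX (fun c => c) (fun u => truncEval u N z) z b β₀ ξ β α = z ^ N * q.eval z := by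
  obtain ⟨q, hq⟩ := X_pow_dvd_of_truncQuotient_eq_zero (N := N)
    (p := equationX Polynomial.C (truncPoly N) Polynomial.X b β₀ ξ β α) (by
      simp only [map_equationX, truncQuotient_C, truncQuotient_truncPoly, truncQuotient_X]
      rw [← map_equationX, h, map_zero])
  refine ⟨q, fun z => ?_⟩
  have := congrArg (Polynomial.evalRingHom z) hq
  rw [map_equationX] at this
  simpa [eval_truncPoly] using this

end

/-! ### The truncated curve -/

/-- The function `∑ i < N, uᵢ (t + T) ^ (-(i + k))`. -/
def tail (T : ℝ) (N k : ℕ) (u : ℕ → ℝ) (t : ℝ) : ℝ :=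
  (t + T)⁻¹ ^ k * truncEval u N (t + T)⁻¹

section

variable (T : ℝ) (N : ℕ)

theorem tendsto_inv_add : Tendsto (fun t : ℝ => (t + T)⁻¹) atTop (nhds 0) :=
  tendsto_inv_atTop_zero.comp (tendsto_atTop_add_const_right _ T tendsto_id)

theorem tendsto_tail_succ (k : ℕ) (u : ℕ → ℝ) : Tendsto (tail T N (k + 1) u) atTop (nhds 0) := by
  have h := ((tendsto_inv_add T).pow (k + 1)).mul
    (((continuous_truncEval u N).tendsto 0).comp (tendsto_inv_add T))
  rwa [zero_pow k.succ_ne_zero, zero_mul] at h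

theorem Tame.of_tendsto {f : ℝ → ℝ} {c : ℝ} (h : Tendsto f atTop (nhds c)) : Tame f :=
  ⟨0, by simpa using h.isBigO_one ℝ⟩

theorem tame_tail_succ (k : ℕ) (u : ℕ → ℝ) : Tame (tail T N (k + 1) u) :=
  .of_tendsto (tendsto_tail_succ T N k u)

variable {T}

/-- Each term `(t + T) ^ (-(i + k))` contributes the factor `-(i + k)`, which is the weight in `wt
k`, and one more power of the inverse time. -/
theorem hasDerivAt_tail (k : ℕ) (u : ℕ → ℝ) {t : ℝ} (ht : t + T ≠ 0) :
    HasDerivAt (tail T N k u) (-tail T N (k + 1) (wt k u) t) t := by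
  have h1 : HasDerivAt (fun t : ℝ => (t + T)⁻¹) (-1 / (t + T) ^ 2) t :=
    ((hasDerivAt_id t).add_const T).inv ht
  have h2 : HasDerivAt (fun t : ℝ => ∑ i ∈ Finset.range N, u i * (t + T)⁻¹ ^ (i + k))
      (∑ i ∈ Finset.range N, u i * (((i + k : ℕ) : ℝ) * (t + T)⁻¹ ^ (i + k - 1)
        * (-1 / (t + T) ^ 2))) t :=
    HasDerivAt.fun_sum fun i _ => (h1.pow (i + k)).const_mul (u i)
  refine (h2.congr_deriv ?_).congr_of_eventuallyEq (Eventually.of_forall fun s => ?_)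
  · rw [tail, truncEval, Finset.mul_sum, ← Finset.sum_neg_distrib]
    refine Finset.sum_congr rfl fun i _ => ?_
    rw [wt]
    -- The exponent `i + k - 1` is a truncated subtraction; when `i + k = 0` the term is constant
    -- and the factor `i + k` vanishes.
    rcases Nat.eq_zero_or_pos (i + k) with h | h
    · have h1 : i = 0 := by omega
      have h2 : k = 0 := by omega
      simp [h1, h2]
    · obtain ⟨j, hj⟩ : ∃ j, i + k = j + 1 := ⟨i + k - 1, by omega⟩
      have e : (t + T)⁻¹ ^ (k + 1) * (((i : ℝ) + k) * u i * (t + T)⁻¹ ^ i)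
          = ((i + k : ℕ) : ℝ) * u i * (t + T)⁻¹ ^ (i + k + 1) := by push_cast; ring
      rw [e, hj, Nat.add_sub_cancel]
      simp only [inv_pow]
      field_simp
      ring
  · simp only [tail, truncEval, Finset.mul_sum]
    exact Finset.sum_congr rfl fun i _ => by ring

variable (T)

theorem eventually_add_ne_zero : ∀ᶠ t in atTop, t + T ≠ 0 := by
  filter_upwards [eventually_gt_atTop (-T)] with t ht
  linarith

theorem isJet_of_forall {f f₁ f₂ : ℝ → ℝ} (h : ∀ t, t + T ≠ 0 → HasDerivAt f (f₁ t) t)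
    (h' : ∀ t, t + T ≠ 0 → HasDerivAt f₁ (f₂ t) t) : ∀ᶠ t in atTop, IsJet f f₁ (f₂ t) t := by
  filter_upwards [eventually_add_ne_zero T] with t ht
  have hc : ContinuousAt (fun s : ℝ => s + T) t := by fun_prop
  exact ⟨(hc.eventually_ne ht).mono h, h' t ht⟩

theorem tame_add : Tame fun t => t + T :=
  Tame.add ⟨1, by simpa using isBigO_refl (fun t : ℝ => t) atTop⟩ (.const T)

theorem tameJet_tail (k : ℕ) (u : ℕ → ℝ) :
    TameJet (tail T N (k + 1) u) (fun t => -tail T N (k + 2) (wt (k + 1) u) t)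
      (tail T N (k + 3) (wt (k + 2) (wt (k + 1) u))) where
  jet := isJet_of_forall T (fun _ ht => hasDerivAt_tail N (k + 1) u ht)
    fun _ ht => ((hasDerivAt_tail N (k + 2) _ ht).neg).congr_deriv (neg_neg _)
  tame₀ := tame_tail_succ T N k u
  tame₁ := (tame_tail_succ T N (k + 1) _).neg
  tame₂ := tame_tail_succ T N (k + 2) _

theorem TameJet.affine_add {f f₁ f₂ : ℝ → ℝ} (h : TameJet f f₁ f₂) (p c : ℝ) :
    TameJet (fun t => p * (t + T) + c + f t) (fun t => p + f₁ t) f₂ where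
  jet := by
    filter_upwards [h.jet] with t ht
    refine ⟨ht.1.mono fun s hs => ?_, by simpa using ht.2.const_add p⟩
    exact (((((hasDerivAt_id s).add_const T).const_mul p).add_const c).fun_add hs).congr_deriv
      (by rw [mul_one])
  tame₀ := (((Tame.const p).mul (tame_add T)).add (.const c)).add h.tame₀
  tame₁ := (Tame.const p).add h.tame₁
  tame₂ := h.tame₂

/-- The truncations of the three series, with their derivatives. -/
theorem wideCurve_tail {p : ℝ} (hp : 0 < p) (r β₀ : ℝ) (ξ β α : ℕ → ℝ) :
    WideCurve (fun t => 0 * (t + T) + r + tail T N 2 α t)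
      (fun t => 0 + -tail T N 3 (wt 2 α) t) (tail T N 4 (wt 3 (wt 2 α)))
      (fun t => p * (t + T) + β₀ + tail T N 1 β t)
      (fun t => p + -tail T N 2 (wt 1 β) t) (tail T N 3 (wt 2 (wt 1 β)))
      (fun t => 1 * (t + T) + 0 + tail T N 1 ξ t)
      (fun t => 1 + -tail T N 2 (wt 1 ξ) t) (tail T N 3 (wt 2 (wt 1 ξ))) := by
  have hB : ∀ᶠ t in atTop, 2 ≤ p * (t + T) + β₀ + tail T N 1 β t := by
    have h : Tendsto (fun t => p * (t + T) + β₀ + tail T N 1 β t) atTop atTop :=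
      (tendsto_atTop_add_const_right _ _ ((tendsto_atTop_add_const_right _ T
        tendsto_id).const_mul_atTop hp)).atTop_add (tendsto_tail_succ T N 0 β)
    exact h.eventually_ge_atTop 2
  have hX : ∀ᶠ t in atTop, t + T - 1 ≤ 1 * (t + T) + 0 + tail T N 1 ξ t := by
    filter_upwards [(tendsto_tail_succ T N 0 ξ).eventually (eventually_ge_nhds neg_one_lt_zero)]
      with t ht
    linarith
  refine ⟨(tameJet_tail T N 1 α).affine_add T 0 r, (tameJet_tail T N 0 β).affine_add T p β₀,
    (tameJet_tail T N 0 ξ).affine_add T 1 0, ⟨0, ?_⟩, ?_, ?_⟩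
  · refine IsBigO.of_bound 1 ?_
    filter_upwards [hB] with t ht
    rw [Real.norm_of_nonneg (inv_nonneg.2 (by linarith))]
    simpa using inv_le_one_of_one_le₀ (by linarith)
  · filter_upwards [hB, hX, eventually_gt_atTop (1 - T)] with t h1 h2 h3
    exact ⟨by linarith, by linarith⟩
  -- From `B ≥ 2` and `X ≥ t + T - 1`, the product is at least `2(t + T - 1)`, which exceeds `t`
  -- once `t > 2 - 2T`.
  · filter_upwards [hB, hX, eventually_gt_atTop (1 - T), eventually_gt_atTop (2 - 2 * T)]
      with t h1 h2 h3 h4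
    nlinarith

theorem tail_succ (k : ℕ) (u : ℕ → ℝ) (t : ℝ) :
    tail T (N + 1) k u t = tail T N k u t + u N / (t + T) ^ (N + k) := by
  rw [tail, truncEval, Finset.sum_range_succ, mul_add, tail, truncEval, pow_add, div_eq_mul_inv,
    mul_inv, ← inv_pow, ← inv_pow]
  ring

theorem sum_Icc_one_eq_tail (u : ℕ → ℝ) (t : ℝ) :
    ∑ n ∈ Finset.Icc 1 N, u n / (t + T) ^ n = tail T N 1 (fun i => u (i + 1)) t := by
  induction N with
  | zero => simp [tail, truncEval]
  | succ N ih => rw [Finset.sum_Icc_succ_top (by omega), ih, tail_succ]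

theorem sum_Icc_two_eq_tail (u : ℕ → ℝ) (t : ℝ) :
    ∑ n ∈ Finset.Icc 2 (N + 1), u n / (t + T) ^ n = tail T N 2 (fun i => u (i + 2)) t := by
  induction N with
  | zero => simp [tail, truncEval]
  | succ N ih => rw [Finset.sum_Icc_succ_top (by omega), ih, tail_succ]

end

/-! ### The Euler-Lagrange equations in terms of the inverse time -/

section

variable {b z Bh : ℝ}

/-- The prefactor `z²` reflects `1 - X'² = z² (2 f₁ - z² f₁²)` and `B = Bh / z`. -/
theorem limB_eq_residualB (hb : b ≠ 0) (hB : Bh ≠ 0) (A A₁ A₂ B₁ B₂ f₁ : ℝ) :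
    limB b A A₁ A₂ (Bh / z) B₁ B₂ (1 - z ^ 2 * f₁)
      = z ^ 2 * (residualB z (Real.pi ^ 2 / 9 - 2 / 3) b⁻¹ b A A₁ A₂ Bh B₁ B₂ f₁ (z * f₁)
        / (12 * Bh ^ 4)) := by
  simp only [limB, residualB]
  field_simp
  ring

/-- The prefactor is only `z`: the term `2 X V'(A)` combines a factor of order `1/z` from `X` with
the deviation `A - 1/b` of order `z²`. -/
theorem limA_eq_residualA (hb : b ≠ 0) (hz : z ≠ 0) (hB : Bh ≠ 0) (h h₁ h₂ B₁ B₂ f f₁ f₂ : ℝ) :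
    limA b (b⁻¹ + z ^ 2 * h) (-(z ^ 3 * h₁)) (z ^ 4 * h₂) (Bh / z) B₁ B₂ ((1 + z ^ 2 * f) / z)
        (1 - z ^ 2 * f₁) (z ^ 3 * f₂)
      = z * (residualA z (Real.pi ^ 2 / 9 - 2 / 3) b⁻¹ b (b⁻¹ + z ^ 2 * h) (-(z ^ 3 * h₁))
        (z ^ 4 * h₂) Bh B₁ B₂ f₁ (z * f₁) (1 - z ^ 2 * f₁) h (z ^ 2 * f) (z ^ 2 * h₁)
        (z ^ 2 * h₂) (z ^ 2 * f₂) / (6 * Bh ^ 3)) := by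
  simp only [limA, residualA]
  field_simp
  ring

/-- The leading terms cancel because `2 V(1/b) = -(2/3) b⁻² B'` at `B' = 2 (b⁻² - 1)`, and `V(A) -
V(1/b)` is quadratic in `A - 1/b`. The argument `β₀ + z (g₁ + g)` is `(Bh - B') / z`, so the terms
of order `z` cancel as well. -/
theorem limX_eq_residualX (hb : b ≠ 0) (β₀ h h₁ h₂ g g₁ f₁ f₂ : ℝ) :
    limX b (b⁻¹ + z ^ 2 * h) (-(z ^ 3 * h₁)) (z ^ 4 * h₂)
        ((2 * (b⁻¹ ^ 2 - 1) + z * β₀ + z ^ 2 * g) / z) (2 * (b⁻¹ ^ 2 - 1) - z ^ 2 * g₁)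
        (1 - z ^ 2 * f₁) (z ^ 3 * f₂)
      = z ^ 2 * (residualX z b⁻¹ b (b⁻¹ + z ^ 2 * h) (2 * (b⁻¹ ^ 2 - 1) + z * β₀ + z ^ 2 * g)
        (β₀ + z * (g₁ + g)) f₁ f₂ (z * f₁) g₁ h h₁ (z * h) (z * h₁) (z ^ 2 * h₂) / 3) := by
  simp only [limX, residualX]
  field_simp
  ring

/-- The correction of order `z` to the energy at the inverse time `z`. -/
def energyRemainder (b z A B₁ Bh f f₁ g h h₁ : ℝ) : ℝ :=
  2 / 3 * (b⁻¹ ^ 2 * g + (2 * b⁻¹ * h + z ^ 2 * h ^ 2) * Bh)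
    - 2 / 3 * A ^ 2 * Bh * f₁ + z ^ 2 * A ^ 2 * Bh * f₁ ^ 2 / 3
    + 2 / 3 * z ^ 2 * h ^ 2 * (6 * A ^ 2 + 4 * (b⁻¹ - b) * A + 2 * (b⁻¹ ^ 2 - 1))
    + 1 / 2 * (z ^ 4 * h₁ ^ 2 * (2 * (1 + z ^ 2 * f) - z ^ 2 / Bh)
      + (Real.pi ^ 2 / 9 - 2 / 3) / 2 * A ^ 2 * B₁ ^ 2 * z ^ 2 / Bh ^ 3
      - A * z ^ 4 * h₁ * B₁ / Bh ^ 2 - 2 * A * z ^ 2 * h₁ * (1 - z ^ 2 * f₁))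
    + 2 * f * (2 * A ^ 4 - 4 / 3 * (2 / b + b) * A ^ 3 + 2 * A ^ 2)
    - (11 / 3 * A ^ 4 - (4 / b + 2 * b) * A ^ 3 + 2 * A ^ 2) / Bh

/-- The flanks carry energy `(2/3) A² B` and the interior `2 X V(A)`, up to smaller terms. Their
linear growth cancels, and what survives at order zero is the constant part `β₀` of `B`, with weight
`2 / (3 b²)`. -/
theorem limEnergy_eq_add_energyRemainder (hb : b ≠ 0) (hz : z ≠ 0) (β₀ h h₁ g B₁ f f₁ : ℝ)
    (hBh : Bh = 2 * (b⁻¹ ^ 2 - 1) + z * β₀ + z ^ 2 * g) (hB : Bh ≠ 0) {A : ℝ}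
    (hA : A = b⁻¹ + z ^ 2 * h) :
    limEnergy b A (-(z ^ 3 * h₁)) (Bh / z) B₁ ((1 + z ^ 2 * f) / z) (1 - z ^ 2 * f₁)
      = 2 / 3 * β₀ / b ^ 2 + z * energyRemainder b z A B₁ Bh f f₁ g h h₁ := by
  -- Eliminating `g` in favour of `Bh` turns the claim into a rational identity in independent
  -- variables.
  have hg : g = (Bh - 2 * (b⁻¹ ^ 2 - 1) - z * β₀) / z ^ 2 := by rw [hBh]; field_simp; ring
  simp only [limEnergy, energyRemainder, hg, hA]
  field_simp
  ring

theorem continuousAt_energyRemainder (b : ℝ) {A B₁ Bh f f₁ g h h₁ : ℝ → ℝ}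
    (hA : Continuous A) (hB₁ : Continuous B₁) (hBh : Continuous Bh) (hf : Continuous f)
    (hf₁ : Continuous f₁) (hg : Continuous g) (hh : Continuous h) (hh₁ : Continuous h₁)
    (h0 : Bh 0 ≠ 0) :
    ContinuousAt (fun z => energyRemainder b z (A z) (B₁ z) (Bh z) (f z) (f₁ z) (g z) (h z)
      (h₁ z)) 0 := by
  have h2 : Bh 0 ^ 2 ≠ 0 := pow_ne_zero 2 h0
  have h3 : Bh 0 ^ 3 ≠ 0 := pow_ne_zero 3 h0
  unfold energyRemainder
  fun_prop (disch := assumption)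

end

/-! ### Energy conservation and integration of its error from infinity -/

/-- Conservation of the energy. -/
theorem hasDerivAt_limEnergy (b : ℝ) {A A₁ B B₁ X X₁ : ℝ → ℝ} {A₂ B₂ X₂ t : ℝ}
    (hA : HasDerivAt A (A₁ t) t) (hA₁ : HasDerivAt A₁ A₂ t) (hB : HasDerivAt B (B₁ t) t)
    (hB₁ : HasDerivAt B₁ B₂ t) (hX : HasDerivAt X (X₁ t) t) (hX₁ : HasDerivAt X₁ X₂ t)
    (h0 : B t ≠ 0) :
    HasDerivAt (fun t => limEnergy b (A t) (A₁ t) (B t) (B₁ t) (X t) (X₁ t))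
      (A₁ t * limA b (A t) (A₁ t) A₂ (B t) (B₁ t) B₂ (X t) (X₁ t) X₂
        + B₁ t * limB b (A t) (A₁ t) A₂ (B t) (B₁ t) B₂ (X₁ t)
        + X₁ t * limX b (A t) (A₁ t) A₂ (B t) (B₁ t) (X₁ t) X₂) t := by
  have t1 := (hA₁.fun_pow 2).fun_mul ((hX.const_mul 2).fun_sub
    ((hasDerivAt_const t (1 : ℝ)).fun_div hB h0))
  have t2 := (((hA.fun_pow 2).const_mul ((Real.pi ^ 2 / 9 - 2 / 3) / 2)).fun_mul
    (hB₁.fun_pow 2)).fun_div (hB.fun_pow 3) (pow_ne_zero 3 h0)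
  have t3 := (((hA.fun_pow 2).const_mul (2 / 3)).fun_mul hB).fun_mul (hX₁.fun_pow 2)
  have t4 := ((hA.fun_mul hA₁).fun_mul hB₁).fun_div (hB.fun_pow 2) (pow_ne_zero 2 h0)
  have t5 := ((hA.const_mul 2).fun_mul hA₁).fun_mul hX₁
  have t6 := ((hA.fun_pow 2).fun_mul hB).div_const 3
  have t7 := (hX.const_mul 2).fun_mul ((((hA.fun_pow 4).const_mul 2).fun_sub
    ((hA.fun_pow 3).const_mul (4 / 3 * (2 / b + b)))).fun_add ((hA.fun_pow 2).const_mul 2))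
  have t8 := ((((hA.fun_pow 4).const_mul (11 / 3)).fun_sub
    ((hA.fun_pow 3).const_mul (4 / b + 2 * b))).fun_add
    ((hA.fun_pow 2).const_mul 2)).fun_div hB h0
  refine ((((((((t1.fun_add t2).fun_add t3).fun_add t4).fun_add t5).const_mul (1 / 2)).fun_add
    t6).fun_add t7).fun_sub t8).congr_deriv ?_
  simp only [limA, limB, limX, div_eq_mul_inv _ b]
  generalize b⁻¹ = r
  field_simp
  ring

/-- A convergent function whose derivative decays like a power approaches its limit like the
next lower power. -/
theorem isBigO_sub_of_deriv {f f' : ℝ → ℝ} {e : ℝ} {n : ℕ}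
    (hf : ∀ᶠ t in atTop, HasDerivAt f (f' t) t) (hlim : Tendsto f atTop (nhds e))
    (hf' : f' =O[atTop] fun t : ℝ => (t ^ (n + 2))⁻¹) :
    (fun t => f t - e) =O[atTop] fun t : ℝ => (t ^ (n + 1))⁻¹ := by
  obtain ⟨c, hc0, hc⟩ := hf'.exists_nonneg
  obtain ⟨t₀, ht₀⟩ := eventually_atTop.1 ((hf.and hc.bound).and (eventually_gt_atTop (0 : ℝ)))
  have hd (t : ℝ) (ht : t₀ ≤ t) :
      HasDerivAt (fun s : ℝ => c * (s ^ (n + 1))⁻¹) (-(c * (n + 1) * (t ^ (n + 2))⁻¹)) t := by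
    have h0 : t ≠ 0 := (ht₀ t ht).2.ne'
    refine (((hasDerivAt_pow (n + 1) t).fun_inv (pow_ne_zero _ h0)).const_mul c).congr_deriv ?_
    push_cast
    field_simp
    ring
  have hb (t : ℝ) (ht : t₀ ≤ t) : |f' t| ≤ c * (n + 1) * (t ^ (n + 2))⁻¹ := by
    obtain ⟨⟨-, h1⟩, h2⟩ := ht₀ t ht
    have h3 : 0 ≤ (t ^ (n + 2))⁻¹ := by positivity
    rw [Real.norm_eq_abs, Real.norm_of_nonneg h3] at h1
    refine h1.trans (mul_le_mul_of_nonneg_right ?_ h3)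
    nlinarith [mul_nonneg hc0 (Nat.cast_nonneg (α := ℝ) n)]
  have h0 : Tendsto (fun s : ℝ => c * (s ^ (n + 1))⁻¹) atTop (nhds 0) := by
    simpa using (tendsto_inv_atTop_zero.comp (tendsto_pow_atTop n.succ_ne_zero)).const_mul c
  -- Adding or subtracting `c s^(-(n+1))` makes the function monotone, since the derivative of this
  -- term dominates `f'`. A monotone function lies on one side of its limit, which yields the two
  -- bounds.
  have hanti : AntitoneOn (fun s => f s + c * (s ^ (n + 1))⁻¹) (Set.Ici t₀) := by
    refine antitoneOn_of_hasDerivWithinAt_nonpos (convex_Ici t₀)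
      (fun s hs => (((ht₀ s hs).1.1).fun_add (hd s hs)).continuousAt.continuousWithinAt)
      (fun s hs => (((ht₀ s (interior_subset hs)).1.1).fun_add
        (hd s (interior_subset hs))).hasDerivWithinAt) fun s hs => ?_
    linarith [abs_le.1 (hb s (interior_subset hs))]
  have hmono : MonotoneOn (fun s => f s - c * (s ^ (n + 1))⁻¹) (Set.Ici t₀) := by
    refine monotoneOn_of_hasDerivWithinAt_nonneg (convex_Ici t₀)
      (fun s hs => (((ht₀ s hs).1.1).fun_sub (hd s hs)).continuousAt.continuousWithinAt)
      (fun s hs => (((ht₀ s (interior_subset hs)).1.1).fun_sub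
        (hd s (interior_subset hs))).hasDerivWithinAt) fun s hs => ?_
    linarith [abs_le.1 (hb s (interior_subset hs))]
  refine IsBigO.of_bound c ?_
  filter_upwards [eventually_ge_atTop t₀] with t ht
  have hpos : 0 < t := (ht₀ t ht).2
  rw [Real.norm_eq_abs, Real.norm_of_nonneg (by positivity), abs_le]
  constructor
  · have : e + 0 ≤ f t + c * (t ^ (n + 1))⁻¹ := by
      refine le_of_tendsto (hlim.add h0) ?_
      filter_upwards [eventually_ge_atTop t] with s hs
      exact hanti ht (ht.trans hs) hs
    linarith
  · have : f t - c * (t ^ (n + 1))⁻¹ ≤ e - 0 := by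
      refine ge_of_tendsto (hlim.sub h0) ?_
      filter_upwards [eventually_ge_atTop t] with s hs
      exact hmono ht (ht.trans hs) hs
    linarith

theorem isBigO_inv_add_pow_mul (T : ℝ) (n : ℕ) {φ : ℝ → ℝ} (hφ : ContinuousAt φ 0) :
    (fun t : ℝ => (t + T)⁻¹ ^ n * φ (t + T)⁻¹) =O[atTop] fun t : ℝ => (t ^ n)⁻¹ := by
  have h1 : (fun t : ℝ => (t + T)⁻¹) =O[atTop] fun t : ℝ => t⁻¹ := by
    refine IsBigO.of_bound 2 ?_
    filter_upwards [eventually_gt_atTop (0 : ℝ), eventually_gt_atTop (-2 * T)] with t h0 hT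
    have h2 : t / 2 ≤ t + T := by linarith
    rw [Real.norm_of_nonneg (inv_nonneg.2 (by linarith)), Real.norm_of_nonneg (by positivity)]
    calc (t + T)⁻¹ ≤ (t / 2)⁻¹ := inv_anti₀ (by positivity) h2
      _ = 2 * t⁻¹ := by field_simp
  have h2 : (fun t : ℝ => φ (t + T)⁻¹) =O[atTop] fun _ => (1 : ℝ) :=
    (hφ.tendsto.comp (tendsto_inv_add T)).isBigO_one ℝ
  simpa using (h1.pow n).mul h2

/-! ### Error estimates for the truncated curve -/

/-- The truncations of a formal solution solve the Euler-Lagrange equations approximately. -/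
theorem formal_solution_truncation {b β₀ : ℝ} {ξ β α : ℕ → ℝ} (hb0 : 0 < b) (hb1 : b < 1)
    (hB : equationB PowerSeries.C PowerSeries.mk PowerSeries.X b (Real.pi ^ 2 / 9 - 2 / 3) β₀
      ξ β α = 0)
    (hA : equationA PowerSeries.C PowerSeries.mk PowerSeries.X b (Real.pi ^ 2 / 9 - 2 / 3) β₀
      ξ β α = 0)
    (hX : equationX PowerSeries.C PowerSeries.mk PowerSeries.X b β₀ ξ β α = 0) (T : ℝ) (N : ℕ) :
    ∃ A A₁ A₂ B B₁ B₂ X X₁ X₂ : ℝ → ℝ,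
      A = (fun t => 0 * (t + T) + b⁻¹ + tail T N 2 α t) ∧
      B = (fun t => 2 * (b⁻¹ ^ 2 - 1) * (t + T) + β₀ + tail T N 1 β t) ∧
      X = (fun t => 1 * (t + T) + 0 + tail T N 1 ξ t) ∧
      WideCurve A A₁ A₂ B B₁ B₂ X X₁ X₂ ∧
      (fun t => limA b (A t) (A₁ t) (A₂ t) (B t) (B₁ t) (B₂ t) (X t) (X₁ t) (X₂ t))
        =O[atTop] (fun t : ℝ => (t ^ (N + 1))⁻¹) ∧
      (fun t => limB b (A t) (A₁ t) (A₂ t) (B t) (B₁ t) (B₂ t) (X₁ t)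
          - X t / B t * limX b (A t) (A₁ t) (A₂ t) (B t) (B₁ t) (X₁ t) (X₂ t))
        =O[atTop] (fun t : ℝ => (t ^ (N + 1))⁻¹) ∧
      (fun t => limX b (A t) (A₁ t) (A₂ t) (B t) (B₁ t) (X₁ t) (X₂ t) / B t)
        =O[atTop] (fun t : ℝ => (t ^ (N + 1))⁻¹) ∧
      (fun t => limEnergy b (A t) (A₁ t) (B t) (B₁ t) (X t) (X₁ t) - 2 / 3 * β₀ / b ^ 2)
        =O[atTop] (fun t : ℝ => (t ^ (N + 1))⁻¹) := by
  obtain ⟨qB, hqB⟩ := equationB_truncEval N hB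
  obtain ⟨qA, hqA⟩ := equationA_truncEval N hA
  obtain ⟨qX, hqX⟩ := equationX_truncEval N hX
  have hb : b ≠ 0 := hb0.ne'
  have hr : 1 < b⁻¹ := (one_lt_inv₀ hb0).2 hb1
  have hp : 0 < 2 * (b⁻¹ ^ 2 - 1) := by nlinarith
  let s (z : ℝ) : ℝ := 2 * (b⁻¹ ^ 2 - 1) + z * β₀ + z ^ 2 * truncEval β N z
  have cu (u : ℕ → ℝ) : Continuous (truncEval u N) := continuous_truncEval u N
  have hs : Continuous s := by fun_prop
  have hs0 : s 0 ≠ 0 := by simpa [s] using hp.ne'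
  have hz : ∀ᶠ t : ℝ in atTop, (t + T)⁻¹ ≠ 0 ∧ s (t + T)⁻¹ ≠ 0 :=
    ((eventually_add_ne_zero T).mono fun t => inv_ne_zero).and
      ((hs.continuousAt.tendsto.comp (tendsto_inv_add T)).eventually_ne hs0)
  -- The nine functions are made opaque, so that they can later be rewritten by their expressions in
  -- the inverse time alone.
  obtain ⟨A, hA'⟩ : ∃ F : ℝ → ℝ, F = fun t => 0 * (t + T) + b⁻¹ + tail T N 2 α t := ⟨_, rfl⟩
  obtain ⟨A₁, hA₁⟩ : ∃ F : ℝ → ℝ, F = fun t => 0 + -tail T N 3 (wt 2 α) t := ⟨_, rfl⟩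
  obtain ⟨A₂, hA₂⟩ : ∃ F : ℝ → ℝ, F = tail T N 4 (wt 3 (wt 2 α)) := ⟨_, rfl⟩
  obtain ⟨B, hB'⟩ : ∃ F : ℝ → ℝ, F = fun t =>
    2 * (b⁻¹ ^ 2 - 1) * (t + T) + β₀ + tail T N 1 β t := ⟨_, rfl⟩
  obtain ⟨B₁, hB₁⟩ : ∃ F : ℝ → ℝ, F = fun t =>
    2 * (b⁻¹ ^ 2 - 1) + -tail T N 2 (wt 1 β) t := ⟨_, rfl⟩
  obtain ⟨B₂, hB₂⟩ : ∃ F : ℝ → ℝ, F = tail T N 3 (wt 2 (wt 1 β)) := ⟨_, rfl⟩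
  obtain ⟨X, hX'⟩ : ∃ F : ℝ → ℝ, F = fun t => 1 * (t + T) + 0 + tail T N 1 ξ t := ⟨_, rfl⟩
  obtain ⟨X₁, hX₁⟩ : ∃ F : ℝ → ℝ, F = fun t => 1 + -tail T N 2 (wt 1 ξ) t := ⟨_, rfl⟩
  obtain ⟨X₂, hX₂⟩ : ∃ F : ℝ → ℝ, F = tail T N 3 (wt 2 (wt 1 ξ)) := ⟨_, rfl⟩
  have w : WideCurve A A₁ A₂ B B₁ B₂ X X₁ X₂ := by
    subst hA' hA₁ hA₂ hB' hB₁ hB₂ hX' hX₁ hX₂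
    exact wideCurve_tail T N hp b⁻¹ β₀ ξ β α
  refine ⟨A, A₁, A₂, B, B₁, B₂, X, X₁, X₂, hA', hB', hX', w, ?_⟩
  have eA (t : ℝ) : A t = b⁻¹ + (t + T)⁻¹ ^ 2 * truncEval α N (t + T)⁻¹ := by
    rw [hA']; simp only [tail]; ring
  have eA₁ (t : ℝ) : A₁ t = -((t + T)⁻¹ ^ 3 * truncEval (wt 2 α) N (t + T)⁻¹) := by
    rw [hA₁]; simp only [tail]; ring
  have eA₂ (t : ℝ) : A₂ t = (t + T)⁻¹ ^ 4 * truncEval (wt 3 (wt 2 α)) N (t + T)⁻¹ := by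
    rw [hA₂]; rfl
  have eB (t : ℝ) (ht : (t + T)⁻¹ ≠ 0) : B t = s (t + T)⁻¹ / (t + T)⁻¹ := by
    rw [hB', eq_div_iff ht]
    simp only [tail, s]
    have := inv_ne_zero ht
    rw [inv_inv] at this
    field_simp
  have eB₁ (t : ℝ) :
      B₁ t = 2 * (b⁻¹ ^ 2 - 1) - (t + T)⁻¹ ^ 2 * truncEval (wt 1 β) N (t + T)⁻¹ := by
    rw [hB₁]; simp only [tail]; ring
  have eB₂ (t : ℝ) : B₂ t = (t + T)⁻¹ ^ 3 * truncEval (wt 2 (wt 1 β)) N (t + T)⁻¹ := by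
    rw [hB₂]; rfl
  have eX (t : ℝ) (ht : (t + T)⁻¹ ≠ 0) :
      X t = (1 + (t + T)⁻¹ ^ 2 * truncEval ξ N (t + T)⁻¹) / (t + T)⁻¹ := by
    rw [hX', eq_div_iff ht]
    simp only [tail]
    have := inv_ne_zero ht
    rw [inv_inv] at this
    field_simp
    ring
  have eX₁ (t : ℝ) : X₁ t = 1 - (t + T)⁻¹ ^ 2 * truncEval (wt 1 ξ) N (t + T)⁻¹ := by
    rw [hX₁]; simp only [tail]; ring
  have eX₂ (t : ℝ) : X₂ t = (t + T)⁻¹ ^ 3 * truncEval (wt 2 (wt 1 ξ)) N (t + T)⁻¹ := by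
    rw [hX₂]; rfl
  clear hA' hA₁ hA₂ hB' hB₁ hB₂ hX' hX₁ hX₂
  -- The factor `z ^ N` from truncation and the prefactor `z` give `N + 1`; the other two equations
  -- have prefactor `z²` and give `N + 2`.
  have zA : ∀ᶠ t in atTop,
      limA b (A t) (A₁ t) (A₂ t) (B t) (B₁ t) (B₂ t) (X t) (X₁ t) (X₂ t)
        = (t + T)⁻¹ ^ (N + 1) * (fun z => qA.eval z / (6 * s z ^ 3)) (t + T)⁻¹ := by
    filter_upwards [hz] with t ht
    have h := hqA (t + T)⁻¹
    rw [eA, eA₁, eA₂, eB t ht.1, eB₁, eB₂, eX t ht.1, eX₁, eX₂,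
      limA_eq_residualA hb ht.1 ht.2]
    simp only [equationA] at h
    simp only [s] at *
    rw [h]
    ring
  have zB : ∀ᶠ t in atTop,
      limB b (A t) (A₁ t) (A₂ t) (B t) (B₁ t) (B₂ t) (X₁ t)
        = (t + T)⁻¹ ^ (N + 2) * (fun z => qB.eval z / (12 * s z ^ 4)) (t + T)⁻¹ := by
    filter_upwards [hz] with t ht
    have h := hqB (t + T)⁻¹
    rw [eA, eA₁, eA₂, eB t ht.1, eB₁, eB₂, eX₁, limB_eq_residualB hb ht.2]
    simp only [equationB] at h
    simp only [s] at *
    rw [h]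
    ring
  have zX : ∀ᶠ t in atTop,
      limX b (A t) (A₁ t) (A₂ t) (B t) (B₁ t) (X₁ t) (X₂ t)
        = (t + T)⁻¹ ^ (N + 2) * (fun z => qX.eval z / 3) (t + T)⁻¹ := by
    filter_upwards [hz] with t ht
    have h := hqX (t + T)⁻¹
    rw [eA, eA₁, eA₂, eB t ht.1, eB₁, eX₁, eX₂, limX_eq_residualX hb]
    simp only [equationX] at h
    rw [h]
    ring
  have cA : ContinuousAt (fun z => qA.eval z / (6 * s z ^ 3)) 0 :=
    qA.continuous.continuousAt.div (by fun_prop)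
      (mul_ne_zero (by norm_num) (pow_ne_zero 3 hs0))
  have cB : ContinuousAt (fun z => qB.eval z / (12 * s z ^ 4)) 0 :=
    qB.continuous.continuousAt.div (by fun_prop)
      (mul_ne_zero (by norm_num) (pow_ne_zero 4 hs0))
  have cX : ContinuousAt (fun z => qX.eval z / 3) 0 := qX.continuous.continuousAt.div_const 3
  have oA : (fun t => limA b (A t) (A₁ t) (A₂ t) (B t) (B₁ t) (B₂ t) (X t) (X₁ t) (X₂ t))
      =O[atTop] (fun t : ℝ => (t ^ (N + 1))⁻¹) :=
    EventuallyEq.trans_isBigO zA (isBigO_inv_add_pow_mul T (N + 1) cA)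
  refine ⟨oA, ?_, ?_, ?_⟩
  -- Since `X / B` stays bounded, one power of `z` is to spare here, and it is placed in `φ`.
  · refine EventuallyEq.trans_isBigO ?_ (isBigO_inv_add_pow_mul T (N + 1)
      (φ := fun z => z * (qB.eval z / (12 * s z ^ 4)
        - (1 + z ^ 2 * truncEval ξ N z) / s z * (qX.eval z / 3))) ?_)
    · filter_upwards [hz, zB, zX] with t ht h1 h2
      rw [h1, h2, eB t ht.1, eX t ht.1]
      have h3 := ht.1
      have h4 := ht.2
      generalize (t + T)⁻¹ = z at *
      field_simp
      ring
    · refine continuousAt_id.mul (cB.sub (ContinuousAt.mul (ContinuousAt.div ?_ ?_ hs0) cX)) <;>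
        fun_prop
  · refine EventuallyEq.trans_isBigO ?_ (isBigO_inv_add_pow_mul T (N + 1)
      (φ := fun z => z ^ 2 * (qX.eval z / 3) / s z) ?_)
    · filter_upwards [hz, zX] with t ht h2
      rw [h2, eB t ht.1]
      have h3 := ht.1
      have h4 := ht.2
      generalize (t + T)⁻¹ = z at *
      field_simp
      ring
    · exact (ContinuousAt.mul (by fun_prop) cX).div hs.continuousAt hs0
  -- A direct expansion would give only the limit of the energy; the rate comes from its derivative,
  -- in which the three Euler-Lagrange expressions appear.
  · refine isBigO_sub_of_deriv (f' := fun t =>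
      A₁ t * limA b (A t) (A₁ t) (A₂ t) (B t) (B₁ t) (B₂ t) (X t) (X₁ t) (X₂ t)
        + B₁ t * limB b (A t) (A₁ t) (A₂ t) (B t) (B₁ t) (B₂ t) (X₁ t)
        + X₁ t * limX b (A t) (A₁ t) (A₂ t) (B t) (B₁ t) (X₁ t) (X₂ t)) ?_ ?_ ?_
    · filter_upwards [w.jetA.jet, w.jetB.jet, w.jetX.jet, w.pos] with t h1 h2 h3 h4
      exact hasDerivAt_limEnergy b h1.hasDerivAt h1.2 h2.hasDerivAt h2.2 h3.hasDerivAt h3.2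
        h4.1.ne'
    · have cE : ContinuousAt (fun z => 2 / 3 * β₀ / b ^ 2 + z * energyRemainder b z
          (b⁻¹ + z ^ 2 * truncEval α N z) (2 * (b⁻¹ ^ 2 - 1) - z ^ 2 * truncEval (wt 1 β) N z)
          (s z) (truncEval ξ N z) (truncEval (wt 1 ξ) N z) (truncEval β N z) (truncEval α N z)
          (truncEval (wt 2 α) N z)) 0 :=
        continuousAt_const.add (continuousAt_id.mul (continuousAt_energyRemainder b
          (by fun_prop) (by fun_prop) hs (cu _) (cu _) (cu _) (cu _) (cu _) hs0))
      have lE := cE.tendsto.comp (tendsto_inv_add T)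
      rw [zero_mul, add_zero] at lE
      refine lE.congr' ?_
      filter_upwards [hz] with t ht
      rw [eA₁, eB t ht.1, eX t ht.1, eX₁, limEnergy_eq_add_energyRemainder hb ht.1 β₀ _ _ _ _ _ _
        rfl ht.2 (eA t), eA, eB₁]
      rfl
    -- The weakest estimate, that of `limA`, is multiplied by `A' = O(z³)`, so order `N + 2` holds
    -- for the whole sum.
    · refine EventuallyEq.trans_isBigO ?_ (isBigO_inv_add_pow_mul T (N + 2)
        (φ := fun z => -(z ^ 2 * truncEval (wt 2 α) N z) * (qA.eval z / (6 * s z ^ 3))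
          + (2 * (b⁻¹ ^ 2 - 1) - z ^ 2 * truncEval (wt 1 β) N z) * (qB.eval z / (12 * s z ^ 4))
          + (1 - z ^ 2 * truncEval (wt 1 ξ) N z) * (qX.eval z / 3)) ?_)
      · filter_upwards [zA, zB, zX] with t h1 h2 h3
        rw [h1, h2, h3, eA₁, eB₁, eX₁]
        ring
      · refine ((ContinuousAt.mul ?_ cA).add (ContinuousAt.mul ?_ cB)).add
          (ContinuousAt.mul ?_ cX) <;> fun_prop

theorem seriesA_eq (b T : ℝ) (α : ℕ → ℝ) (N : ℕ) : seriesA b T α (N + 1)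
    = fun t => 0 * (t + T) + b⁻¹ + tail T N 2 (fun i => α (i + 2)) t := by
  funext t
  rw [seriesA, sum_Icc_two_eq_tail, zero_mul, zero_add, one_div]

theorem seriesB_eq {b : ℝ} (hb : b ≠ 0) (T B₀ : ℝ) (β : ℕ → ℝ) (N : ℕ) : seriesB b T B₀ β N
    = fun t => 2 * (b⁻¹ ^ 2 - 1) * (t + T) + B₀ + tail T N 1 (fun i => β (i + 1)) t := by
  funext t
  have h : 2 * (1 - b ^ 2) / b ^ 2 = 2 * (b⁻¹ ^ 2 - 1) := by field_simp
  rw [seriesB, sum_Icc_one_eq_tail, h]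

theorem seriesX_eq (T : ℝ) (ξ : ℕ → ℝ) (N : ℕ) : seriesX T ξ N
    = fun t => 1 * (t + T) + 0 + tail T N 1 (fun i => ξ (i + 1)) t := by
  funext t
  rw [seriesX, sum_Icc_one_eq_tail, one_mul, add_zero]

end Sphaleron

end

theorem theorem1 (a b : ℝ) (ha : 0 < a) (hb0 : 0 < b) (hb1 : b < 1)
    (hab : Real.tanh (2 * a) = 3 * b / (2 + b ^ 2)) (B₀ : ℝ) :
    ∃ ξ β α : ℕ → ℝ,
      -- the explicit coefficients of `X`
      ξ 1 = b ^ 2 / (8 * (1 - b ^ 2) ^ 2) ∧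
      ξ 2 = b ^ 2 / (8 * (1 - b ^ 2) ^ 2) * (-(b ^ 2 * B₀ / (2 * (1 - b ^ 2)))) ∧
      ξ 3 = b ^ 2 / (8 * (1 - b ^ 2) ^ 2) *
        (b ^ 4 * B₀ ^ 2 / (4 * (1 - b ^ 2) ^ 2) + Real.pi ^ 2 * b ^ 2 / 12
          + b ^ 2 * (12 * b ^ 6 - 44 * b ^ 4 + 53 * b ^ 2 - 22)
            / (16 * (2 - b ^ 2) * (1 - b ^ 2) ^ 2)) ∧
      -- the explicit coefficients of `B`
      β 1 = b ^ 2 / (4 * (1 - b ^ 2)) * ((3 - 2 * b ^ 2) / (2 - b ^ 2)) ∧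
      β 2 = b ^ 2 / (4 * (1 - b ^ 2)) * (-(B₀ / (2 * (1 - b ^ 2)))) ∧
      β 3 = b ^ 2 / (4 * (1 - b ^ 2)) *
        (b ^ 2 * B₀ ^ 2 / (4 * (1 - b ^ 2) ^ 2)
          + Real.pi ^ 2 * (22 - 13 * b ^ 2) / (36 * (2 - b ^ 2))
          + (80 * b ^ 10 - 686 * b ^ 8 + 2213 * b ^ 6 - 3368 * b ^ 4 + 2450 * b ^ 2 - 692)
            / (48 * (1 - b ^ 2) ^ 2 * (2 - b ^ 2) ^ 3)) ∧
      -- the explicit coefficients of `A`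
      α 2 = b / (8 * (2 - b ^ 2)) ∧
      α 3 = b / (8 * (2 - b ^ 2)) * (-(b ^ 2 * B₀ / (2 * (1 - b ^ 2)))) ∧
      α 4 = b / (8 * (2 - b ^ 2)) *
        (b ^ 4 * B₀ ^ 2 / (4 * (1 - b ^ 2) ^ 2) - Real.pi ^ 2 * b ^ 2 / (18 * (1 - b ^ 2))
          - b ^ 2 * (17 * b ^ 6 - 91 * b ^ 4 + 148 * b ^ 2 - 62)
            / (24 * (1 - b ^ 2) ^ 2 * (2 - b ^ 2) ^ 2)) ∧
      ∀ T : ℝ,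
        -- the series solve the Euler-Lagrange equations to all orders
        Sphaleron.IsSeriesSolution a (Sphaleron.seriesA b T α) (Sphaleron.seriesB b T B₀ β)
          (Sphaleron.seriesX T ξ) ∧
        -- the energy of the lump is `(2 / 3) B₀ / b²` to all orders
        ∀ N : ℕ,
          (fun t : ℝ => Sphaleron.fieldEnergy a
              (Sphaleron.lump (Sphaleron.seriesA b T α (N + 1)) (Sphaleron.seriesB b T B₀ β N)
                (Sphaleron.seriesX T ξ N)) t
            - 2 / 3 * B₀ / b ^ 2)
            =O[atTop] fun t : ℝ => (t ^ (N + 1))⁻¹ := by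
  obtain ⟨ξ, β, α, hB, hA, hX⟩ :=
    Sphaleron.exists_formal_solution hb0 hb1 (Real.pi ^ 2 / 9 - 2 / 3) B₀
  obtain ⟨hξ₁, hξ₂, hξ₃, hβ₁, hβ₂, hβ₃, hα₂, hα₃, hα₄⟩ :=
    Sphaleron.formal_solution_leading hb0 hb1 hB hA hX
  -- The formal sequences start at index 0, whereas the corrections start at order 1 for `X` and `B`
  -- and at order 2 for `A`. This is why `N` terms of each reach order `N` in `X` and `B` but `N +
  -- 1` in `A`.
  refine ⟨fun n => ξ (n - 1), fun n => β (n - 1), fun n => α (n - 2), hξ₁, hξ₂, hξ₃, hβ₁, hβ₂, hβ₃,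
    hα₂, hα₃, hα₄, fun T => ⟨fun N => ?_, fun N => ?_⟩⟩
  all_goals
    obtain ⟨A, A₁, A₂, B, B₁, B₂, X, X₁, X₂, eA, eB, eX, w, oA, oB, oX, oE⟩ :=
      Sphaleron.formal_solution_truncation hb0 hb1 hB hA hX T N
    have fA : Sphaleron.seriesA b T (fun n => α (n - 2)) (N + 1) = A :=
      (Sphaleron.seriesA_eq b T _ N).trans eA.symm
    have fB : Sphaleron.seriesB b T B₀ (fun n => β (n - 1)) N = B :=
      (Sphaleron.seriesB_eq hb0.ne' T B₀ _ N).trans eB.symm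
    have fX : Sphaleron.seriesX T (fun n => ξ (n - 1)) N = X :=
      (Sphaleron.seriesX_eq T _ N).trans eX.symm
    rw [fA, fB, fX]
  · exact ⟨w.variationA_isBigO ha hb0 hab oA, w.variationB_isBigO ha hb0 hab oB,
      w.variationC_isBigO ha hb0 hab oX⟩
  · exact w.energy_isBigO ha hb0 hab oE
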